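/- Conventions. Everything depends on a security parameter $\eta\in\mathbb N$. A function $\mu(\eta)$ is negligible if it decays faster than every inverse polynomial. A $\Sigma$-protocol $\Pi$ for a relation $R\subseteq\mathcal X\times\mathcal W$ is a three-round protocol: the prover sends a commitment $a\in\mathcal Y$, the verifier sends a uniformly random challenge $c\in\mathcal C$ ($\mathcal C$ finite and non-empty), the prover sends a response $z\in\mathcal Z$, and the verifier accepts the instance $x$ iff $V(x,a,c,z)=1$. Instances, witnesses and messages are bit strings of polynomial length, $V$ has polynomial-size circuits, and uniform elements of $\mathcal C$ can be sampled, up to a negligible statistical error, in uniform quantum polynomial time. No correctness of an honest prover is assumed. Adversaries are non-uniform quantum polynomial-time: polynomial-size circuits with an arbitrary initial state (quantum advice). The algorithms $E$ and $\mathcal K$ below are uniform quantum polynomial-time without advice. $\Pi$ has *$t$-soundness* if there are a quantum polynomial-time algorithm $E$ and a negligible $\mu$ such that for all $\eta$, all $x\in\mathcal X$, all $a\in\mathcal Y$ and every map $\zeta=(\zeta_1,\dots,\zeta_t):\mathcal C^t\to\mathcal Z^t$, if $c=(c_1,\dots,c_t)\in\mathcal C^t$ is uniformly random and $z_i=\zeta_i(c)$,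 then the probability that $V(x,a,c_i,z_i)=1$ for all $i$ but $E(x,a,c_1,\dots,c_t,z_1,\dots,z_t)$ does not output a $w$ with $(x,w)\in R$ is at most $\mu(\eta)$. $\Pi$ has *quantum computationally unique responses* if for all $x$ the predicate $V(x,\cdot,\cdot,\cdot)$ is collapsing from $\mathcal Z$ to $\mathcal Y\times\mathcal C$: for every non-uniform quantum polynomial-time two-stage adversary $(\mathcal A_1,\mathcal A_2)$ there is a negligible $\mu$ such that for all $\eta$ and all $x\in\mathcal X$ the probabilities of $r=b=1$ in the following two games differ by at most $\mu(\eta)$. In both games $\mathcal A_1$ outputs registers $S$, $Z$ and $(Y,C)$, and the bit $r=V(x,Y,C,Z)$ is computed coherently and measured. In Game 1 then both $Z$ and $(Y,C)$ are measured in the computational basis, in Game 2 only $(Y,C)$ is. Finally $\mathcal A_2$ gets all registers and outputs a bit $b$. $\Pi$ is a *computational proof of knowledge* for static provers if there are a quantum polynomial-time black-box extractor $\mathcal K$ (having access to one copy of the prover's initial state, to its messages, and to the unitaries of its two stages and their inverses), a positive polynomial $p$ and a constant $d\ge 0$ such that for every polynomial $q$ there is a negligible $\kappa$ such that for all $\eta$,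 all two-stage quantum provers $\mathcal A$ of size at most $q(\eta)$ with arbitrary initial state, and all $x\in\mathcal X$, $$\Pr\left[(x,w)\in R: w\leftarrow\mathcal K^{\mathcal A}(x)\right]\ \ge\ \frac1{p(\eta)}\Pr\left[\langle\mathcal A,\mathcal V(x)\rangle=\mathit{accept}\right]^d-\kappa(\eta).$$ For adaptive provers, who output $x$ along with $a$, the condition is, with the same quantifiers and for all subsets $X\subseteq\mathcal X$, $$\Pr\left[x\in X\wedge(x,w)\in R:(x,w)\leftarrow\mathcal K^{\mathcal A}\right]\ \ge\ \frac1{p(\eta)}\Pr\left[x\in X\wedge v=\mathit{accept}:(x,v)\leftarrow\langle\mathcal A,\mathcal V\rangle\right]^d-\kappa(\eta).$$ **Theorem.** Let $t$ be a constant. Every $\Sigma$-protocol $\Pi$ with $t$-soundness and quantum computationally unique responses is a computational proof of knowledge, both for static and for adaptive provers. -/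

import Mathlib

open Finset Filter Asymptotics
open scoped BigOperators

/-! ### Negligible functions, bit strings -/

/-- A function of the security parameter is negligible if it decays faster than every inverse
polynomial. -/
def Negligible (f : ℕ → ℝ) : Prop :=
  SuperpolynomialDecay atTop (fun η : ℕ => (η : ℝ)) f

/-- Bit strings of length `n`. -/
abbrev Bits (n : ℕ) : Type := Fin n → Bool

/-! ### Quantum circuits -/

/-- (Not necessarily normalised) state vectors of a system with one qubit for every wire in `W`,
given by their amplitudes in the computational basis. -/
abbrev QState (W : Type) : Type := (W → Bool) → ℂ

/-- A universal set of elementary gates. In `CNOT u v` the target is `v`, in `CCNOT u v w` it is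
`w`. -/
inductive Gate (W : Type) : Type
  | X (w : W)
  | H (w : W)
  | T (w : W)
  | Tdg (w : W)
  | CNOT (u v : W)
  | CCNOT (u v w : W)

/-- Quantum circuits; the gate at the head of the list is applied first. -/
abbrev Circuit (W : Type) : Type := List (Gate W)

namespace Gate

/-- The action of a gate on state vectors. A controlled gate whose target is one of its controls
acts as the identity, so that every gate is unitary. -/
noncomputable def apply {W : Type} [DecidableEq W] : Gate W → QState W → QState W
  | X w, ψ => fun b => ψ (Function.update b w (!(b w)))
  | H w, ψ => fun b =>
      (ψ (Function.update b w false) +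
        (if b w then -1 else 1) * ψ (Function.update b w true)) / (Real.sqrt 2 : ℂ)
  | T w, ψ => fun b => (if b w then Complex.exp (Complex.I * (Real.pi / 4)) else 1) * ψ b
  | Tdg w, ψ => fun b => (if b w then Complex.exp (-(Complex.I * (Real.pi / 4))) else 1) * ψ b
  | CNOT u v, ψ => fun b =>
      if u = v then ψ b else ψ (Function.update b v (xor (b v) (b u)))
  | CCNOT u v w, ψ => fun b =>
      if u = w ∨ v = w then ψ b else ψ (Function.update b w (xor (b w) (b u && b v)))

/-- The inverse gate. -/
def inv {W : Type} : Gate W → Gate W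
  | T w => Tdg w
  | Tdg w => T w
  | g => g

/-- Relabelling of wires. -/
def map {V W : Type} (f : V → W) : Gate V → Gate W
  | X w => X (f w)
  | H w => H (f w)
  | T w => T (f w)
  | Tdg w => Tdg (f w)
  | CNOT u v => CNOT (f u) (f v)
  | CCNOT u v w => CCNOT (f u) (f v) (f w)

/-- The wires a gate acts on. -/
def wires {W : Type} : Gate W → List W
  | X w => [w]
  | H w => [w]
  | T w => [w]
  | Tdg w => [w]
  | CNOT u v => [u, v]
  | CCNOT u v w => [u, v, w]

/-- Partial relabelling of wires. -/
def partialMap {V W : Type} (f : V → Option W) : Gate V → Option (Gate W)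
  | X w => (f w).map X
  | H w => (f w).map H
  | T w => (f w).map T
  | Tdg w => (f w).map Tdg
  | CNOT u v => (f u).bind fun u' => (f v).map fun v' => CNOT u' v'
  | CCNOT u v w =>
      (f u).bind fun u' => (f v).bind fun v' => (f w).map fun w' => CCNOT u' v' w'

end Gate

namespace Circuit

/-- The unitary computed by a circuit. -/
noncomputable def run {W : Type} [DecidableEq W] (C : Circuit W) (ψ : QState W) : QState W :=
  C.foldl (fun φ g => g.apply φ) ψ

/-- The inverse circuit. -/
def inv {W : Type} (C : Circuit W) : Circuit W := (List.map Gate.inv C).reverse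

/-- Relabelling of wires. -/
def relabel {V W : Type} (f : V → W) (C : Circuit V) : Circuit W := List.map (Gate.map f) C

/-- The circuit only acts on wires with property `P`. -/
def Within {W : Type} (C : Circuit W) (P : W → Prop) : Prop := ∀ g ∈ C, ∀ w ∈ g.wires, P w

end Circuit

open scoped Classical in
/-- The probability that measuring all wires in the computational basis yields a string in `P`.
For a vector that arises from a unit vector by projecting on earlier measurement outcomes this is
the joint probability with these outcomes. -/
noncomputable def prob {W : Type} [Fintype W] [DecidableEq W] (P : (W → Bool) → Prop)
    (ψ : QState W) : ℝ :=
  ∑ b : W → Bool, if P b then ‖ψ b‖ ^ 2 else 0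

open scoped Classical in
/-- The projection on the span of the basis vectors in `P` (not renormalised). -/
noncomputable def proj {W : Type} (P : (W → Bool) → Prop) (ψ : QState W) : QState W :=
  fun b => if P b then ψ b else 0

open scoped Classical in
/-- The basis vector `|v⟩`. -/
noncomputable def ket {W : Type} (v : W → Bool) : QState W := fun b => if b = v then 1 else 0

/-- The product vector `φ ⊗ |v⟩`. -/
noncomputable def withKet {N W : Type} (φ : QState N) (v : W → Bool) : QState (N ⊕ W) :=
  fun b => φ (fun i => b (Sum.inl i)) * ket v (fun w => b (Sum.inr w))

/-- `φ` is a unit vector. -/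
def IsUnitVector {W : Type} [Fintype W] [DecidableEq W] (φ : QState W) : Prop :=
  ∑ b : W → Bool, ‖φ b‖ ^ 2 = 1

/-! ### Registers -/

/-- The bit lengths of instances, witnesses, commitments, challenges and responses. -/
structure Sizes : Type where
  inst : ℕ
  wit : ℕ
  com : ℕ
  chal : ℕ
  resp : ℕ

/-- Names of quantum registers: an instance, a witness, a commitment, `t` challenges, `t`
responses, and `s` work registers. -/
inductive Reg (t s : ℕ) : Type
  | inst
  | wit
  | com
  | chal (j : Fin t)
  | resp (j : Fin t)
  | work (i : Fin s)
  deriving DecidableEq, Fintype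

/-- The number of qubits of a register; work registers have `m` qubits. -/
def regLen {t s : ℕ} (L : Sizes) (m : ℕ) : Reg t s → ℕ
  | .inst => L.inst
  | .wit => L.wit
  | .com => L.com
  | .chal _ => L.chal
  | .resp _ => L.resp
  | .work _ => m

/-- The qubits of all registers. -/
abbrev Wire (t s : ℕ) (L : Sizes) (m : ℕ) : Type := Σ r : Reg t s, Fin (regLen L m r)

section Registers

variable {t s : ℕ} {L : Sizes} {m : ℕ}

/-- The contents of the single registers in a basis state. -/
def instOf (b : Wire t s L m → Bool) : Bits L.inst := fun i => b ⟨.inst, i⟩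

def witOf (b : Wire t s L m → Bool) : Bits L.wit := fun i => b ⟨.wit, i⟩

def comOf (b : Wire t s L m → Bool) : Bits L.com := fun i => b ⟨.com, i⟩

def chalOf (j : Fin t) (b : Wire t s L m → Bool) : Bits L.chal := fun i => b ⟨.chal j, i⟩

def respOf (j : Fin t) (b : Wire t s L m → Bool) : Bits L.resp := fun i => b ⟨.resp j, i⟩

/-- The basis state with the given instance, commitment, challenges and responses; the witness
register and the work registers are zero. -/
def loaded (x : Bits L.inst) (a : Bits L.com) (c : Fin t → Bits L.chal)
    (z : Fin t → Bits L.resp) : Wire t s L m → Bool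
  | ⟨.inst, i⟩ => x i
  | ⟨.wit, _⟩ => false
  | ⟨.com, i⟩ => a i
  | ⟨.chal j, i⟩ => c j i
  | ⟨.resp j, i⟩ => z j i
  | ⟨.work _, _⟩ => false

/-- The basis state with instance `x` and all other registers zero. -/
def loadedInst (x : Bits L.inst) : Wire t s L m → Bool :=
  loaded x (fun _ => false) (fun _ _ => false) (fun _ _ => false)

/-- The basis state in which all registers are zero. -/
def zeroRegs : Wire t s L m → Bool := fun _ => false

end Registers

/-! ### Uniform quantum algorithms with black-box calls

A uniform quantum algorithm is a classical program that on input of the security parameter (and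
of the register lengths) writes down a quantum circuit. The programs are structured programs for a
random access machine with successor and predecessor as unit-cost arithmetic. -/

/-- Elementary steps of a quantum algorithm: a gate, or a call to a black box in `Ω`. -/
inductive Op (Ω W : Type) : Type
  | gate (g : Gate W)
  | call (o : Ω)

namespace Op

def map {Ω V W : Type} (f : V → W) : Op Ω V → Op Ω W
  | gate g => gate (g.map f)
  | call o => call o

def partialMap {Ω V W : Type} (f : V → Option W) : Op Ω V → Option (Op Ω W)
  | gate g => (g.partialMap f).map gate
  | call o => some (call o)

def wires {Ω W : Type} : Op Ω W → List W
  | gate g => g.wires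
  | call _ => []

/-- Replace a call to the black box `o` by the circuit `U o`. -/
def expand {Ω V W : Type} (f : V → W) (U : Ω → Circuit W) : Op Ω V → Circuit W
  | gate g => [g.map f]
  | call o => U o

end Op

/-- Classical programs that write down quantum circuits. The memory consists of counters `k`
and of arrays `k`, with natural numbers as entries. A qubit is addressed as a pair of
a register name in `ρ` and the number of a counter that holds the index within this register. -/
inductive Prog (Ω ρ : Type) : Type
  | skip
  | inc (k : ℕ)
  | dec (k : ℕ)
  /-- Counter `k` becomes the entry of array `a` at the index in counter `i`. -/
  | get (k a i : ℕ)
  /-- The entry of array `a` at the index in counter `i` becomes the value of counter `k`. -/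
  | put (a i k : ℕ)
  /-- Append an elementary step to the circuit. -/
  | emit (o : Op Ω (ρ × ℕ))
  | seq (P Q : Prog Ω ρ)
  /-- If counter `k` is zero then `P` else `Q`. -/
  | ifZero (k : ℕ) (P Q : Prog Ω ρ)
  /-- Repeat `P` as often as the value of counter `k` at the start says. -/
  | loop (k : ℕ) (P : Prog Ω ρ)
  /-- Run `P` as a subroutine with its own fresh memory. -/
  | sub (P : Prog Ω ρ)

/-- The classical memory. -/
structure Mem : Type where
  ctr : ℕ → ℕ
  arr : ℕ → ℕ → ℕ

/-- A configuration: the memory, the circuit written so far (with qubits addressed by register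
name and index), and the number of steps done so far. -/
structure Config (Ω ρ : Type) : Type where
  mem : Mem
  out : List (Op Ω (ρ × ℕ))
  time : ℕ

/-- Count one step. -/
def Config.tick {Ω ρ : Type} (σ : Config Ω ρ) : Config Ω ρ := { σ with time := σ.time + 1 }

/-- Change a counter. -/
def Config.setCtr {Ω ρ : Type} (σ : Config Ω ρ) (k v : ℕ) : Config Ω ρ :=
  { σ with mem := { σ.mem with ctr := Function.update σ.mem.ctr k v } }

/-- The step-counting execution of a program; `ini` is the memory at the start of the program and
of its subroutines. -/
def Prog.exec {Ω ρ : Type} (ini : Mem) : Prog Ω ρ → Config Ω ρ → Config Ω ρ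
  | .skip, σ => σ.tick
  | .inc k, σ => (σ.setCtr k (σ.mem.ctr k + 1)).tick
  | .dec k, σ => (σ.setCtr k (σ.mem.ctr k - 1)).tick
  | .get k a i, σ => (σ.setCtr k (σ.mem.arr a (σ.mem.ctr i))).tick
  | .put a i k, σ =>
      Config.tick { σ with
        mem := { σ.mem with
          arr := Function.update σ.mem.arr a
            (Function.update (σ.mem.arr a) (σ.mem.ctr i) (σ.mem.ctr k)) } }
  | .emit o, σ =>
      Config.tick { σ with out := σ.out ++ [o.map fun w => (w.1, σ.mem.ctr w.2)] }
  | .seq P Q, σ => Q.exec ini (P.exec ini σ)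
  | .ifZero k P Q, σ => if σ.mem.ctr k = 0 then P.exec ini σ.tick else Q.exec ini σ.tick
  | .loop k P, σ => (fun τ => P.exec ini τ.tick)^[σ.mem.ctr k] σ.tick
  | .sub P, σ => { P.exec ini { σ with mem := ini, time := σ.time + 1 } with mem := σ.mem }

/-- The input of a program: counters `0, …, 5` hold the security parameter and the register
lengths, everything else is zero. -/
def inputMem (η : ℕ) (L : Sizes) : Mem where
  ctr := fun k => [η, L.inst, L.wit, L.com, L.chal, L.resp].getD k 0
  arr := fun _ _ => 0

/-- A uniform quantum algorithm with black-box calls in `Ω`, working on the registers `Reg t s`;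
`bound` is meant to bound its running time, and is the length of each work register. -/
structure QAlg (Ω : Type) (t : ℕ) : Type where
  s : ℕ
  prog : Prog Ω (Reg t s)
  bound : Polynomial ℕ

namespace QAlg

variable {Ω : Type} {t : ℕ}

/-- The length of the work registers. -/
noncomputable def workLen (K : QAlg Ω t) (η : ℕ) : ℕ := K.bound.eval η

/-- The qubits of the algorithm. -/
abbrev W (K : QAlg Ω t) (L : Sizes) (η : ℕ) : Type := Wire t K.s L (K.workLen η)

/-- The final configuration of the program. -/
def final (K : QAlg Ω t) (L : Sizes) (η : ℕ) : Config Ω (Reg t K.s) :=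
  K.prog.exec (inputMem η L) ⟨inputMem η L, [], 0⟩

/-- The algorithm is polynomial-time (a black-box call counts as one step), and the circuit which
its program writes down only addresses existing qubits. -/
def PolyTime (K : QAlg Ω t) (L : ℕ → Sizes) : Prop :=
  ∀ η, (K.final (L η) η).time ≤ K.bound.eval η ∧
    ∀ o ∈ (K.final (L η) η).out, ∀ w ∈ o.wires, w.2 < regLen (L η) (K.workLen η) w.1

/-- The steps of the algorithm, as operations on its qubits. -/
noncomputable def ops (K : QAlg Ω t) (L : Sizes) (η : ℕ) : List (Op Ω (K.W L η)) :=
  (K.final L η).out.filterMap <| Op.partialMap fun w =>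
    if h : w.2 < regLen L (K.workLen η) w.1 then some ⟨w.1, ⟨w.2, h⟩⟩ else none

/-- The circuit of an algorithm without black boxes. -/
noncomputable def circuit (E : QAlg Empty t) (L : Sizes) (η : ℕ) : Circuit (E.W L η) :=
  (E.ops L η).flatMap (Op.expand id Empty.elim)

end QAlg

/-! ### Malicious provers and black-box access to them -/

/-- The qubits of a malicious prover with `n` private qubits, and of its messages. -/
abbrev ProverWire (L : Sizes) (n : ℕ) : Type := Fin n ⊕ Wire 1 0 L 0

/-- The private qubits and those of the registers in `S`. -/
def Accessible {L : Sizes} {n : ℕ} (S : Set (Reg 1 0)) : ProverWire L n → Prop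
  | Sum.inl _ => True
  | Sum.inr w => w.1 ∈ S

/-- A malicious two-stage quantum prover: an arbitrary initial state of its private register (the
quantum advice), a unitary first stage that writes its message to the registers in `S`, and a
unitary second stage that gets the challenge in the challenge register and writes its answer to the
response register. -/
structure MaliciousProver (S : Set (Reg 1 0)) (L : Sizes) : Type where
  n : ℕ
  state : QState (Fin n)
  unit_state : IsUnitVector state
  stage1 : Circuit (ProverWire L n)
  stage2 : Circuit (ProverWire L n)
  stage1_within : stage1.Within (Accessible S)
  stage2_within : stage2.Within (Accessible {Reg.chal 0, Reg.resp 0})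

/-- A static prover only outputs a commitment in its first stage. -/
abbrev StaticProver (L : Sizes) : Type := MaliciousProver {Reg.com} L

/-- An adaptive prover outputs an instance and a commitment in its first stage. -/
abbrev AdaptiveProver (L : Sizes) : Type := MaliciousProver {Reg.inst, Reg.com} L

/-- The handing over of the challenge `c`: the (so far empty) challenge register is set to `c`. -/
def sendChallenge {L : Sizes} {n : ℕ} (c : Bits L.chal) (ψ : QState (ProverWire L n)) :
    QState (ProverWire L n) :=
  fun b => ψ fun w => match w with
    | Sum.inr ⟨.chal j, i⟩ => xor (b (Sum.inr ⟨.chal j, i⟩)) (c i)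
    | w => b w

namespace MaliciousProver

variable {S : Set (Reg 1 0)} {L : Sizes}

/-- The size of a prover: the number of its qubits and gates. -/
def size (A : MaliciousProver S L) : ℕ := A.n + A.stage1.length + A.stage2.length

/-- The state after the second stage if the challenge is `c`. The first message is not touched by
the second stage, so that it can be measured at the end. -/
noncomputable def outcome (A : MaliciousProver S L) (c : Bits L.chal) :
    QState (ProverWire L A.n) :=
  A.stage2.run (sendChallenge c (A.stage1.run (withKet A.state zeroRegs)))

end MaliciousProver

/-- What an extractor can do with a prover as a black box: apply the unitaries of the two stages
and their inverses. -/
inductive ProverCall : Type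
  | first
  | firstInv
  | second
  | secondInv

/-- The message registers of the prover are the registers of the extractor of the same name. -/
def shareWire {s m : ℕ} {L : Sizes} : Wire 1 0 L 0 → Wire 1 s L m
  | ⟨.inst, i⟩ => ⟨.inst, i⟩
  | ⟨.wit, i⟩ => ⟨.wit, i⟩
  | ⟨.com, i⟩ => ⟨.com, i⟩
  | ⟨.chal j, i⟩ => ⟨.chal j, i⟩
  | ⟨.resp j, i⟩ => ⟨.resp j, i⟩
  | ⟨.work i, _⟩ => i.elim0

/-- The black box that an extractor with additional registers has access to. -/
def MaliciousProver.blackBox {S : Set (Reg 1 0)} {L : Sizes} (A : MaliciousProver S L)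
    (s m : ℕ) : ProverCall → Circuit (Fin A.n ⊕ Wire 1 s L m)
  | .first => A.stage1.relabel (Sum.map id shareWire)
  | .firstInv => (A.stage1.relabel (Sum.map id shareWire)).inv
  | .second => A.stage2.relabel (Sum.map id shareWire)
  | .secondInv => (A.stage2.relabel (Sum.map id shareWire)).inv

namespace QAlg

/-- The circuit of the extractor `K` with black-box access to the prover `A`. It acts on the private
register of `A` only through the calls. -/
noncomputable def withProver (K : QAlg ProverCall 1) {S : Set (Reg 1 0)} {L : Sizes} (η : ℕ)
    (A : MaliciousProver S L) : Circuit (Fin A.n ⊕ K.W L η) :=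
  (K.ops L η).flatMap (Op.expand Sum.inr (A.blackBox K.s (K.workLen η)))

/-- The final state of `K` with black-box access to `A`, if the instance register is initially
`x`. The private register of `A` is in the initial state of `A`. -/
noncomputable def extract (K : QAlg ProverCall 1) {S : Set (Reg 1 0)} {L : Sizes} (η : ℕ)
    (A : MaliciousProver S L) (x : Bits L.inst) : QState (Fin A.n ⊕ K.W L η) :=
  (K.withProver η A).run (withKet A.state (loadedInst x))

end QAlg

/-! ### The collapsing property -/

/-- A two-stage adversary in the collapsing game, for relations between the bit strings indexed by
`P` and by `Q`: an arbitrary initial state of its private register `S` of `n` qubits (the other two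
registers are initially zero), two unitaries on `S`, `X` and `Y`, and the qubit that holds the output
bit. -/
structure CollapsingAdversary (P Q : Type) : Type where
  n : ℕ
  state : QState (Fin n)
  unit_state : IsUnitVector state
  stage1 : Circuit (Fin n ⊕ (P ⊕ Q))
  stage2 : Circuit (Fin n ⊕ (P ⊕ Q))
  outBit : Fin n ⊕ (P ⊕ Q)

namespace CollapsingAdversary

variable {P Q : Type} [Fintype P] [DecidableEq P] [Fintype Q] [DecidableEq Q]

/-- The size of an adversary: the number of its private qubits and gates. -/
def size (A : CollapsingAdversary P Q) : ℕ := A.n + A.stage1.length + A.stage2.length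

/-- The contents of the registers `X` and `Y` in a basis state. -/
def xOf {n : ℕ} (b : Fin n ⊕ (P ⊕ Q) → Bool) : P → Bool := fun i => b (Sum.inr (Sum.inl i))

def yOf {n : ℕ} (b : Fin n ⊕ (P ⊕ Q) → Bool) : Q → Bool := fun i => b (Sum.inr (Sum.inr i))

/-- The state after the first stage. -/
noncomputable def mid (A : CollapsingAdversary P Q) : QState (Fin A.n ⊕ (P ⊕ Q)) :=
  A.stage1.run (withKet A.state fun _ => false)

open scoped Classical in
/-- The probability of `r = b = 1` in the first game: the relation is measured, then the registers
`X` and `Y` are measured. -/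
noncomputable def game1 (A : CollapsingAdversary P Q) (R : (P → Bool) → (Q → Bool) → Prop) : ℝ :=
  ∑ x : P → Bool, ∑ y : Q → Bool,
    prob (fun b => b A.outBit = true)
      (A.stage2.run (proj (fun b => xOf b = x ∧ yOf b = y)
        (proj (fun b => R (xOf b) (yOf b)) A.mid)))

open scoped Classical in
/-- The probability of `r = b = 1` in the second game: the relation is measured, then only the
register `Y` is measured. -/
noncomputable def game2 (A : CollapsingAdversary P Q) (R : (P → Bool) → (Q → Bool) → Prop) : ℝ :=
  ∑ y : Q → Bool,
    prob (fun b => b A.outBit = true)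
      (A.stage2.run (proj (fun b => yOf b = y)
        (proj (fun b => R (xOf b) (yOf b)) A.mid)))

end CollapsingAdversary

/-! ### Sigma protocols -/

/-- A Sigma protocol, for a security parameter `η`: the instances, witnesses and messages are bit
strings, the challenge is uniform in a non-empty set of challenges, and the verifier accepts the
transcript `(a, c, z)` for the instance `x` iff `verify η x a c z = true`. (The values of `verify`
at strings that are not challenges play no role. The honest prover is not part of the data because
no completeness is asked for.) -/
structure SigmaProtocol : Type where
  size : ℕ → Sizes
  instances : (η : ℕ) → Set (Bits (size η).inst)
  rel : (η : ℕ) → Bits (size η).inst → Bits (size η).wit → Prop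
  challenges : (η : ℕ) → Finset (Bits (size η).chal)
  challenges_nonempty : ∀ η, (challenges η).Nonempty
  verify : (η : ℕ) → Bits (size η).inst → Bits (size η).com → Bits (size η).chal →
    Bits (size η).resp → Bool

namespace SigmaProtocol

/-- Instances, witnesses and messages have polynomial length. -/
def PolySize (Pi : SigmaProtocol) : Prop :=
  ∃ q : Polynomial ℕ, ∀ η, (Pi.size η).inst + (Pi.size η).wit + (Pi.size η).com +
    (Pi.size η).chal + (Pi.size η).resp ≤ q.eval η

/-- The verification predicate has circuits of polynomial size: with `k` auxiliary qubits that are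
initially zero, the qubit `o` of the final state is `verify η x a c z`. -/
def PolyVerifiable (Pi : SigmaProtocol) : Prop :=
  ∃ q : Polynomial ℕ, ∀ η, ∃ (k : ℕ) (C : Circuit (Wire 1 1 (Pi.size η) k))
    (o : Wire 1 1 (Pi.size η) k), k + C.length ≤ q.eval η ∧
      ∀ x ∈ Pi.instances η, ∀ a, ∀ c ∈ Pi.challenges η, ∀ z,
        prob (fun b => b o = Pi.verify η x a c z)
          (C.run (ket (loaded x a (fun _ => c) (fun _ => z)))) = 1

open scoped Classical in
/-- A quantum polynomial-time algorithm samples challenges, with a distribution that has negligible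
distance from the uniform distribution on the set of challenges. -/
def PolySamplable (Pi : SigmaProtocol) : Prop :=
  ∃ D : QAlg Empty 1, D.PolyTime Pi.size ∧
    Negligible fun η =>
      ∑ c : Bits (Pi.size η).chal,
        |prob (fun b => chalOf 0 b = c) ((D.circuit (Pi.size η) η).run (ket zeroRegs)) -
          if c ∈ Pi.challenges η then 1 / ((Pi.challenges η).card : ℝ) else 0|

/-- The verifier is efficient. -/
structure EfficientVerifier (Pi : SigmaProtocol) : Prop where
  polySize : Pi.PolySize
  polyVerifiable : Pi.PolyVerifiable
  polySamplable : Pi.PolySamplable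

/-- All `t` transcripts `(a, c j, z j)` are accepted. -/
def AllAccepted (Pi : SigmaProtocol) {t : ℕ} (η : ℕ) (x : Bits (Pi.size η).inst)
    (a : Bits (Pi.size η).com) (c : Fin t → Bits (Pi.size η).chal)
    (z : Fin t → Bits (Pi.size η).resp) : Prop :=
  ∀ j, Pi.verify η x a (c j) (z j) = true

/-- The probability that `E` on input `x`, `a`, `c 1, …, c t`, `z 1, …, z t` does not output a
witness for `x`. -/
noncomputable def failProb (Pi : SigmaProtocol) {t : ℕ} (E : QAlg Empty t) (η : ℕ)
    (x : Bits (Pi.size η).inst) (a : Bits (Pi.size η).com) (c : Fin t → Bits (Pi.size η).chal)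
    (z : Fin t → Bits (Pi.size η).resp) : ℝ :=
  prob (fun b => ¬ Pi.rel η x (witOf b))
    ((E.circuit (Pi.size η) η).run (ket (loaded x a c z)))

open scoped Classical in
/-- `t`-soundness: a quantum polynomial-time algorithm `E` computes a witness from `t` accepting
transcripts with the same first message `a`. For every `a`, and for independent uniform challenges
`c`, it fails for some accepted responses, which may be chosen as a function `ζ` of all the
challenges, only with negligible probability. -/
def TSound (Pi : SigmaProtocol) (t : ℕ) : Prop :=
  ∃ E : QAlg Empty t, E.PolyTime Pi.size ∧
    ∃ μ : ℕ → ℝ, Negligible μ ∧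
      ∀ η, ∀ x ∈ Pi.instances η, ∀ a : Bits (Pi.size η).com,
        ∀ ζ : (Fin t → Bits (Pi.size η).chal) → Fin t → Bits (Pi.size η).resp,
          (∑ c ∈ Fintype.piFinset (fun _ : Fin t => Pi.challenges η),
              if Pi.AllAccepted η x a c (ζ c) then Pi.failProb E η x a c (ζ c) else 0) /
            ((Pi.challenges η).card : ℝ) ^ t ≤ μ η

/-- The verification predicate for `x`, as a relation between responses `z` and pairs `(a, c)` of a
commitment and a challenge. -/
def responseRel (Pi : SigmaProtocol) (η : ℕ) (x : Bits (Pi.size η).inst)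
    (z : Fin (Pi.size η).resp → Bool)
    (y : Fin (Pi.size η).com ⊕ Fin (Pi.size η).chal → Bool) : Prop :=
  (fun i => y (Sum.inr i)) ∈ Pi.challenges η ∧
    Pi.verify η x (fun i => y (Sum.inl i)) (fun i => y (Sum.inr i)) z = true

/-- Quantum computationally unique responses: the verification predicate is collapsing from
responses to pairs of a commitment and a challenge, for all polynomial-size adversaries. -/
def QuantumUniqueResponses (Pi : SigmaProtocol) : Prop :=
  ∀ A : (η : ℕ) → CollapsingAdversary (Fin (Pi.size η).resp)
      (Fin (Pi.size η).com ⊕ Fin (Pi.size η).chal),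
    (∃ q : Polynomial ℕ, ∀ η, (A η).size ≤ q.eval η) →
      ∃ μ : ℕ → ℝ, Negligible μ ∧ ∀ η, ∀ x ∈ Pi.instances η,
        |(A η).game1 (Pi.responseRel η x) - (A η).game2 (Pi.responseRel η x)| ≤ μ η

/-- The probability that the static prover `A` makes the verifier accept `x`. -/
noncomputable def acceptProb (Pi : SigmaProtocol) (η : ℕ) (A : StaticProver (Pi.size η))
    (x : Bits (Pi.size η).inst) : ℝ :=
  (∑ c ∈ Pi.challenges η,
    prob (fun b => Pi.verify η x (comOf (b ∘ Sum.inr)) c (respOf 0 (b ∘ Sum.inr)) = true)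
      (A.outcome c)) / ((Pi.challenges η).card : ℝ)

/-- The probability that the adaptive prover `A` chooses an instance in `I` and makes the verifier
accept it. -/
noncomputable def adaptiveAcceptProb (Pi : SigmaProtocol) (η : ℕ)
    (A : AdaptiveProver (Pi.size η)) (I : Set (Bits (Pi.size η).inst)) : ℝ :=
  (∑ c ∈ Pi.challenges η,
    prob (fun b => instOf (b ∘ Sum.inr) ∈ I ∧
        Pi.verify η (instOf (b ∘ Sum.inr)) (comOf (b ∘ Sum.inr)) c
          (respOf 0 (b ∘ Sum.inr)) = true)
      (A.outcome c)) / ((Pi.challenges η).card : ℝ)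

/-- The probability that `K` on input `x`, with black-box access to `A`, outputs a witness for
`x`. -/
noncomputable def extractProb (Pi : SigmaProtocol) (K : QAlg ProverCall 1) (η : ℕ)
    (A : StaticProver (Pi.size η)) (x : Bits (Pi.size η).inst) : ℝ :=
  prob (fun b => Pi.rel η x (witOf (b ∘ Sum.inr))) (K.extract η A x)

/-- The probability that `K`, with black-box access to `A`, outputs an instance in `I` together with
a witness for it. -/
noncomputable def adaptiveExtractProb (Pi : SigmaProtocol) (K : QAlg ProverCall 1) (η : ℕ)
    (A : AdaptiveProver (Pi.size η)) (I : Set (Bits (Pi.size η).inst)) : ℝ :=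
  prob (fun b => instOf (b ∘ Sum.inr) ∈ I ∧
      Pi.rel η (instOf (b ∘ Sum.inr)) (witOf (b ∘ Sum.inr)))
    (K.extract η A (fun _ => false))

/-- Computational proof of knowledge, for static provers. The negligible function `κ` depends
on the prover only through a polynomial bound `q` on its size. -/
def StaticPoK (Pi : SigmaProtocol) : Prop :=
  ∃ (K : QAlg ProverCall 1) (p : Polynomial ℕ) (d : ℕ),
    K.PolyTime Pi.size ∧ (∀ η, 0 < p.eval η) ∧
    ∀ q : Polynomial ℕ, ∃ κ : ℕ → ℝ, Negligible κ ∧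
      ∀ (η : ℕ) (A : StaticProver (Pi.size η)), A.size ≤ q.eval η →
        ∀ x ∈ Pi.instances η,
          1 / ((p.eval η : ℕ) : ℝ) * Pi.acceptProb η A x ^ d - κ η ≤ Pi.extractProb K η A x

/-- Computational proof of knowledge, for adaptive provers. -/
def AdaptivePoK (Pi : SigmaProtocol) : Prop :=
  ∃ (K : QAlg ProverCall 1) (p : Polynomial ℕ) (d : ℕ),
    K.PolyTime Pi.size ∧ (∀ η, 0 < p.eval η) ∧
    ∀ q : Polynomial ℕ, ∃ κ : ℕ → ℝ, Negligible κ ∧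
      ∀ (η : ℕ) (A : AdaptiveProver (Pi.size η)), A.size ≤ q.eval η →
        ∀ I ⊆ Pi.instances η,
          1 / ((p.eval η : ℕ) : ℝ) * Pi.adaptiveAcceptProb η A I ^ d - κ η ≤
            Pi.adaptiveExtractProb K η A I

/-- Computational proof of knowledge against quantum adversaries. -/
def ComputationalPoK (Pi : SigmaProtocol) : Prop := Pi.StaticPoK ∧ Pi.AdaptivePoK

end SigmaProtocol

/-!
The extractor rewinds the prover, in the manner of Unruh. It runs the first stage of the prover
once. Then, for each of `t` challenges `c` sampled by the algorithm of the verifier, it hands over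
`c`, runs the second stage, copies the response and runs the second stage backwards. Finally it
gives the `t` transcripts to the algorithm of `t`-soundness. The same program serves static and
adaptive provers; if the prover succeeds with probability `ε`, the extractor succeeds with
probability at least `ε ^ (2 * t + 1)` up to a negligible error.

Let `U c` be the unitary by which the prover answers `c`, let `P c` be the projection which tests
whether the response is accepted, conjugated by `U c`, and let `A` be the average of `P c` over the
challenges. Then `⟨φ, A φ⟩ = ε` for the state `φ` after the first stage. If the extractor measured
only whether the responses are accepted, all `t` would be accepted with a probability that is the
average of `‖P c_t ⋯ P c_1 φ‖²`. By convexity this is at least `‖A ^ t φ‖²`, and the norms of the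
iterates of the symmetric operator `A` are log-convex, which gives a lower bound by a power of `ε`
(`pow_le_seqAvg`, `pow_le_sum_acceptedProb`).

The extractor does measure the responses. Here the collapsing property comes in: no efficient test
notices the measurement of an accepted response, and the later questions together with their
acceptance are an efficient test (`realizes_measuredProb`). So dropping the measurements one after
the other costs a negligible error each time (`SigmaProtocol.abs_sum_measure_sub_le`,
`abs_measuredProb_sub_acceptedProb_le`). The error has to be uniform over all provers of a given
size, while the collapsing property provides an error for each family of adversaries; the family of
nearly worst adversaries, whose advice may depend on the security parameter, gives a uniform one
(`SigmaProtocol.QuantumUniqueResponses.exists_uniform_bound`).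

If all responses are accepted, the algorithm of `t`-soundness fails only with negligible
probability: for each instance and commitment, and for each choice of challenges, the failure
probability is at most that for the worst accepted responses, which are a function of the
challenges (`pow_sub_le_sum_answerPath`). The first message is not touched by the second stage, so
that one may argue as if it were measured at the beginning. Together with the negligible distance
of the sampled challenges from uniform ones this yields
`SigmaProtocol.TSound.exists_rewinding_bound`.

The rest of the proof writes the extractor as a polynomial-time program (`extractor`) and computes
the state that its circuit leaves behind (`prob_extractorCircuit`). Measurements are deferred: a
response is copied to fresh qubits which are only read afterwards.
-/

/-! ### Linearity and unitarity of circuits -/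

/-- The squared norm of a state vector. -/
noncomputable def sqNorm {W : Type} [Fintype W] [DecidableEq W] (ψ : QState W) : ℝ :=
  ∑ b : W → Bool, ‖ψ b‖ ^ 2

namespace Gate

theorem inv_inv {W : Type} (g : Gate W) : g.inv.inv = g := by cases g <;> rfl

theorem inv_map {V W : Type} (f : V → W) (g : Gate V) : (g.map f).inv = g.inv.map f := by
  cases g <;> rfl

theorem map_map {U V W : Type} (h : U → V) (f : V → W) (g : Gate U) :
    (g.map h).map f = g.map (f ∘ h) := by
  cases g <;> rfl

variable {W : Type} [DecidableEq W]

theorem apply_add (g : Gate W) (ψ φ : QState W) :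
    g.apply (ψ + φ) = g.apply ψ + g.apply φ := by
  cases g <;> funext b <;> simp only [apply, Pi.add_apply] <;> (try split_ifs) <;> ring

theorem apply_smul (g : Gate W) (s : ℂ) (ψ : QState W) :
    g.apply (s • ψ) = s • g.apply ψ := by
  cases g <;> funext b <;> simp only [apply, Pi.smul_apply, smul_eq_mul] <;>
    (try split_ifs) <;> ring

theorem sqrt_two_mul_self : (Real.sqrt 2 : ℂ) * (Real.sqrt 2 : ℂ) = 2 := by
  rw [← Complex.ofReal_mul, Real.mul_self_sqrt (by norm_num)]; norm_num

theorem inv_apply_apply (g : Gate W) (ψ : QState W) : g.inv.apply (g.apply ψ) = ψ := by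
  cases g with
  | X w => funext b; simp [apply, inv]
  | H w =>
    funext b
    have h2 := sqrt_two_mul_self
    have h0 : (Real.sqrt 2 : ℂ) ≠ 0 := by
      intro h; rw [h] at h2; norm_num at h2
    simp only [apply, inv, Function.update_idem, Function.update_self]
    rcases hb : b w with _ | _
    · have : Function.update b w false = b := by rw [← hb]; exact Function.update_eq_self _ _
      rw [this]; simp; field_simp; rw [pow_two, h2]; ring
    · have : Function.update b w true = b := by rw [← hb]; exact Function.update_eq_self _ _
      rw [this]; simp; field_simp; rw [pow_two, h2]; ring
  | T w =>
    funext b; simp only [apply, inv]; split_ifs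
    · rw [← mul_assoc, ← Complex.exp_add]; simp
    · simp
  | Tdg w =>
    funext b; simp only [apply, inv]; split_ifs
    · rw [← mul_assoc, ← Complex.exp_add]; simp
    · simp
  | CNOT u v =>
    funext b; simp only [apply, inv]; split_ifs with h
    · rfl
    · simp [h]
  | CCNOT u v w =>
    funext b; simp only [apply, inv]; split_ifs with h
    · rfl
    · push Not at h
      simp [h.1, h.2]

/-- The norm of a vector may be compared on pairs of basis states that differ in one qubit. -/
theorem sum_eq_of_pair [Fintype W] (w : W) (F G : (W → Bool) → ℝ)
    (h : ∀ b, F b + F (Function.update b w (!(b w))) = G b + G (Function.update b w (!(b w)))) :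
    ∑ b, F b = ∑ b, G b := by
  have inv : Function.Involutive fun b : W → Bool => Function.update b w (!(b w)) := by
    intro b; simp
  have key : ∀ F : (W → Bool) → ℝ, ∑ b, F (Function.update b w (!(b w))) = ∑ b, F b := fun F =>
    Fintype.sum_equiv (Function.Involutive.toPerm _ inv) _ _ fun b => rfl
  have := Finset.sum_congr rfl fun b (_ : b ∈ (univ : Finset (W → Bool))) => h b
  rw [sum_add_distrib, sum_add_distrib, key, key] at this
  linarith

theorem norm_add_sq_add_norm_sub_sq (x y : ℂ) :
    ‖x + y‖ ^ 2 + ‖x - y‖ ^ 2 = 2 * (‖x‖ ^ 2 + ‖y‖ ^ 2) := by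
  have := parallelogram_law_with_norm ℝ x y
  nlinarith

theorem sqNorm_apply [Fintype W] (g : Gate W) (ψ : QState W) : sqNorm (g.apply ψ) = sqNorm ψ := by
  have hexp : ∀ r : ℝ, ‖Complex.exp (Complex.I * r)‖ = 1 := fun r => by
    rw [mul_comm]; exact Complex.norm_exp_ofReal_mul_I r
  cases g with
  | X w =>
    apply sum_eq_of_pair w
    intro b
    simp [apply, add_comm]
  | H w =>
    apply sum_eq_of_pair w
    intro b
    have h2 : ‖(Real.sqrt 2 : ℂ)‖ ^ 2 = 2 := by
      rw [Complex.norm_real, Real.norm_eq_abs, sq_abs, Real.sq_sqrt (by norm_num)]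
    simp only [apply, Function.update_idem, Function.update_self, norm_div, div_pow, h2]
    rcases hb : b w with _ | _
    · have : Function.update b w false = b := by rw [← hb]; exact Function.update_eq_self _ _
      rw [this]
      have := norm_add_sq_add_norm_sub_sq (ψ b) (ψ (Function.update b w true))
      simp [← sub_eq_add_neg] at this ⊢
      linarith
    · have : Function.update b w true = b := by rw [← hb]; exact Function.update_eq_self _ _
      rw [this]
      have := norm_add_sq_add_norm_sub_sq (ψ (Function.update b w false)) (ψ b)
      simp [← sub_eq_add_neg] at this ⊢
      linarith
  | T w =>
    refine sum_congr rfl fun b _ => ?_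
    have := hexp (Real.pi / 4)
    push_cast at this
    simp only [apply, norm_mul]; split_ifs <;> simp [this]
  | Tdg w =>
    refine sum_congr rfl fun b _ => ?_
    have := hexp (-(Real.pi / 4))
    push_cast at this
    simp only [apply, norm_mul]; split_ifs <;> simp [← mul_neg, this]
  | CNOT u v =>
    by_cases h : u = v
    · simp [apply, h]
    · apply sum_eq_of_pair v
      intro b
      have e : Function.update b v (b v) = b := Function.update_eq_self _ _
      rcases hu : b u with _ | _ <;> rcases hv : b v with _ | _ <;> rw [hv] at e <;>
        simp [apply, h, hu, hv, e, add_comm, Function.update_idem]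
  | CCNOT u v w =>
    by_cases h : u = w ∨ v = w
    · simp [apply, h]
    · apply sum_eq_of_pair w
      intro b
      have h' := h
      push Not at h'
      have e : Function.update b w (b w) = b := Function.update_eq_self _ _
      rcases hc : (b u && b v) with _ | _ <;> rcases hw : b w with _ | _ <;> rw [hw] at e <;>
        simp [apply, h'.1, h'.2, hc, hw, e, add_comm, Function.update_idem]

theorem extend_update_comp {V W : Type} [DecidableEq V] [DecidableEq W] {f : V → W}
    (hf : Function.Injective f) (v : V → Bool) (b : W → Bool) (w : V) (x : Bool) :
    Function.extend f (Function.update v w x) b =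
      Function.update (Function.extend f v b) (f w) x := by
  funext u
  by_cases h : ∃ a, f a = u
  · obtain ⟨a, rfl⟩ := h
    rw [hf.extend_apply]
    by_cases ha : a = w
    · subst ha; simp
    · rw [Function.update_of_ne ha, Function.update_of_ne (fun h => ha (hf h)), hf.extend_apply]
  · rw [Function.extend_apply' _ _ _ h, Function.update_of_ne, Function.extend_apply' _ _ _ h]
    rintro rfl; exact h ⟨w, rfl⟩

theorem extend_comp_self {V W : Type} {f : V → W} (hf : Function.Injective f) (b : W → Bool) :
    Function.extend f (b ∘ f) b = b := by
  funext u
  by_cases h : ∃ a, f a = u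
  · obtain ⟨a, rfl⟩ := h; rw [hf.extend_apply]; rfl
  · rw [Function.extend_apply' _ _ _ h]

theorem extend_extend {V W : Type} {f : V → W} (hf : Function.Injective f) (v v' : V → Bool)
    (b : W → Bool) : Function.extend f v' (Function.extend f v b) = Function.extend f v' b := by
  funext u
  by_cases h : ∃ a, f a = u
  · obtain ⟨a, rfl⟩ := h; rw [hf.extend_apply, hf.extend_apply]
  · simp only [Function.extend_apply' _ _ _ h]

/-- A relabelled gate acts on the fibres of the restriction to its wires. -/
theorem apply_map {V : Type} [DecidableEq V] {f : V → W} (hf : Function.Injective f) (g : Gate V)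
    (Ψ : QState W) (b : W → Bool) :
    (g.map f).apply Ψ b = g.apply (fun v => Ψ (Function.extend f v b)) (b ∘ f) := by
  cases g <;>
    simp [apply, map, extend_update_comp hf, extend_comp_self hf, hf.eq_iff]

end Gate

namespace Circuit

theorem relabel_append {V W : Type} (f : V → W) (C D : Circuit V) :
    relabel f (C ++ D) = relabel f C ++ relabel f D := by simp [relabel]

theorem relabel_relabel {U V W : Type} (h : U → V) (f : V → W) (C : Circuit U) :
    relabel f (relabel h C) = relabel (f ∘ h) C := by
  simp only [relabel, List.map_map]
  exact List.map_congr_left fun g _ => Gate.map_map h f g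

theorem relabel_inv {V W : Type} (f : V → W) (C : Circuit V) :
    relabel f (inv C) = inv (relabel f C) := by
  simp only [relabel, inv, List.map_reverse, List.map_map]
  congr 1
  exact List.map_congr_left fun g _ => (Gate.inv_map f g).symm

theorem length_inv {W : Type} (C : Circuit W) : (inv C).length = C.length := by simp [inv]

theorem length_relabel {V W : Type} (f : V → W) (C : Circuit V) :
    (relabel f C).length = C.length := by simp [relabel]

variable {W : Type} [DecidableEq W]

@[simp] theorem run_nil (ψ : QState W) : run ([] : Circuit W) ψ = ψ := rfl

@[simp] theorem run_cons (g : Gate W) (C : Circuit W) (ψ : QState W) :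
    run (g :: C) ψ = run C (g.apply ψ) := rfl

theorem run_append (C D : Circuit W) (ψ : QState W) : run (C ++ D) ψ = run D (run C ψ) := by
  simp [run]

theorem run_add (C : Circuit W) (ψ φ : QState W) : run C (ψ + φ) = run C ψ + run C φ := by
  induction C generalizing ψ φ with
  | nil => rfl
  | cons g C ih => simp [Gate.apply_add, ih]

theorem run_smul (C : Circuit W) (s : ℂ) (ψ : QState W) : run C (s • ψ) = s • run C ψ := by
  induction C generalizing ψ with
  | nil => rfl
  | cons g C ih => simp [Gate.apply_smul, ih]

@[simp] theorem run_zero (C : Circuit W) : run C 0 = 0 := by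
  have := run_smul C 0 0
  simpa using this

theorem run_inv_run (C : Circuit W) (ψ : QState W) : run (inv C) (run C ψ) = ψ := by
  induction C generalizing ψ with
  | nil => rfl
  | cons g C ih =>
    have : inv (g :: C) = inv C ++ [g.inv] := by simp [inv]
    rw [this, run_append, run_cons, run_cons, ih, Gate.inv_apply_apply, run_nil]

theorem inv_inv {W : Type} (C : Circuit W) : inv (inv C) = C := by
  have : Gate.inv ∘ Gate.inv = (id : Gate W → Gate W) := funext Gate.inv_inv
  simp [inv, List.map_reverse, this]

theorem run_run_inv (C : Circuit W) (ψ : QState W) : run C (run (inv C) ψ) = ψ := by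
  have := run_inv_run (inv C) ψ
  rwa [inv_inv] at this

theorem sqNorm_run [Fintype W] (C : Circuit W) (ψ : QState W) : sqNorm (run C ψ) = sqNorm ψ := by
  induction C generalizing ψ with
  | nil => rfl
  | cons g C ih => rw [run_cons, ih, Gate.sqNorm_apply]

/-- A relabelled circuit acts on the fibres of the restriction to its wires. -/
theorem run_relabel {V : Type} [DecidableEq V] {f : V → W} (hf : Function.Injective f)
    (C : Circuit V) (Ψ : QState W) (b : W → Bool) :
    run (relabel f C) Ψ b = run C (fun v => Ψ (Function.extend f v b)) (b ∘ f) := by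
  induction C generalizing Ψ with
  | nil => simp [relabel, Gate.extend_comp_self hf]
  | cons g C ih =>
    have h1 : relabel f (g :: C) = g.map f :: relabel f C := rfl
    rw [h1, run_cons, ih, run_cons]
    congr 1
    funext v
    rw [Gate.apply_map hf, show Function.extend f v b ∘ f = v from funext (hf.extend_apply v b)]
    simp only [Gate.extend_extend hf]

end Circuit

/-! ### Measurement probabilities -/

section Prob

variable {W : Type} [Fintype W] [DecidableEq W]

theorem sqNorm_nonneg (ψ : QState W) : 0 ≤ sqNorm ψ := sum_nonneg fun _ _ => by positivity

theorem sqNorm_smul (s : ℂ) (ψ : QState W) : sqNorm (s • ψ) = ‖s‖ ^ 2 * sqNorm ψ := by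
  simp [sqNorm, mul_sum, mul_pow]

theorem sqNorm_eq_zero {ψ : QState W} (h : sqNorm ψ = 0) : ψ = 0 := by
  funext b
  have := (sum_eq_zero_iff_of_nonneg (fun _ _ => by positivity)).1 h b (mem_univ b)
  simpa using this

theorem prob_eq_sqNorm_proj (P : (W → Bool) → Prop) (ψ : QState W) :
    prob P ψ = sqNorm (proj P ψ) := by
  refine sum_congr rfl fun b _ => ?_
  simp only [proj]; split_ifs <;> simp

theorem prob_nonneg (P : (W → Bool) → Prop) (ψ : QState W) : 0 ≤ prob P ψ := by
  rw [prob_eq_sqNorm_proj]; exact sqNorm_nonneg _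

theorem prob_mono {P Q : (W → Bool) → Prop} {ψ : QState W} (h : ∀ b, ψ b ≠ 0 → P b → Q b) :
    prob P ψ ≤ prob Q ψ := by
  refine sum_le_sum fun b _ => ?_
  by_cases hb : ψ b = 0
  · simp [hb]
  · have := h b hb
    split_ifs with h1 h2
    · rfl
    · exact absurd (this h1) h2
    · positivity
    · rfl

theorem prob_congr {P Q : (W → Bool) → Prop} {ψ : QState W} (h : ∀ b, ψ b ≠ 0 → (P b ↔ Q b)) :
    prob P ψ = prob Q ψ :=
  le_antisymm (prob_mono fun b hb => (h b hb).1) (prob_mono fun b hb => (h b hb).2)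

theorem prob_true (ψ : QState W) : prob (fun _ => True) ψ = sqNorm ψ := by
  simp [prob, sqNorm]

theorem prob_le_sqNorm (P : (W → Bool) → Prop) (ψ : QState W) : prob P ψ ≤ sqNorm ψ := by
  rw [← prob_true]; exact prob_mono fun _ _ _ => trivial

theorem prob_not (P : (W → Bool) → Prop) (ψ : QState W) :
    prob P ψ = sqNorm ψ - prob (fun b => ¬ P b) ψ := by
  rw [eq_sub_iff_add_eq, prob, prob, sqNorm, ← sum_add_distrib]
  refine sum_congr rfl fun b _ => ?_
  by_cases h : P b <;> simp [h]

theorem prob_smul (P : (W → Bool) → Prop) (s : ℂ) (ψ : QState W) :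
    prob P (s • ψ) = ‖s‖ ^ 2 * prob P ψ := by
  simp [prob, mul_sum, mul_pow]

theorem prob_zero (P : (W → Bool) → Prop) : prob P (0 : QState W) = 0 := by
  simp [prob]

theorem sqNorm_ket (v : W → Bool) : sqNorm (ket v) = 1 := by
  have : ∀ b : W → Bool, ‖ket v b‖ ^ 2 = if b = v then 1 else 0 := fun b => by
    simp only [ket]; split_ifs <;> simp
  simp [sqNorm, this]

/-- The outcomes of a measurement are exhaustive and mutually exclusive. -/
theorem sum_sqNorm_proj {α : Type} [Fintype α] (f : (W → Bool) → α) (ψ : QState W) :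
    ∑ a, sqNorm (proj (fun b => f b = a) ψ) = sqNorm ψ := by
  classical
  simp only [sqNorm]
  rw [sum_comm]
  refine sum_congr rfl fun b _ => ?_
  rw [sum_eq_single (f b)]
  · simp [proj]
  · intro a _ ha
    simp [proj, ha.symm]
  · simp

end Prob

/-! ### Bit flips and copies in the computational basis -/

/-- Flip the qubits `w` with `v w = true`. -/
def shift {W : Type} (v : W → Bool) (ψ : QState W) : QState W :=
  fun b => ψ fun w => xor (b w) (v w)

theorem shift_shift {W : Type} (v : W → Bool) (ψ : QState W) : shift v (shift v ψ) = ψ := by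
  funext b; simp [shift]

theorem prob_shift {W : Type} [Fintype W] [DecidableEq W] (v : W → Bool)
    (P : (W → Bool) → Prop) (ψ : QState W) :
    prob P (shift v ψ) = prob (fun b => P fun w => xor (b w) (v w)) ψ := by
  have inv : Function.Involutive fun b : W → Bool => fun w => xor (b w) (v w) := by
    intro b; simp
  refine Fintype.sum_equiv (Function.Involutive.toPerm _ inv) _ _ fun b => ?_
  have h : (fun w => xor (Function.Involutive.toPerm _ inv b w) (v w)) = b := inv b
  by_cases hb : P b
  · rw [if_pos hb, if_pos (Eq.mpr (congrArg P h) hb)]; rfl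
  · rw [if_neg hb, if_neg (mt (Eq.mp (congrArg P h)) hb)]

/-- The bit strings obtained from `b` by adding the contents of the qubits `u i` to the
qubits `v i`. -/
noncomputable def addInto {W : Type} {k : ℕ} (u v : Fin k → W) (b : W → Bool) : W → Bool :=
  Function.extend v (fun i => xor (b (v i)) (b (u i))) b

namespace Circuit

/-- The circuit that flips the qubits `w` with `v w = true`. -/
noncomputable def flips {W : Type} [Fintype W] (v : W → Bool) : Circuit W :=
  (univ.filter fun w => v w = true).toList.map Gate.X

theorem length_flips {W : Type} [Fintype W] (v : W → Bool) :
    (flips v).length ≤ Fintype.card W := by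
  simpa [flips] using card_le_univ _

theorem run_map_X {W : Type} [DecidableEq W] (l : List W) (hl : l.Nodup) (ψ : QState W) :
    run (l.map Gate.X) ψ = shift (fun w => decide (w ∈ l)) ψ := by
  induction l generalizing ψ with
  | nil => funext b; simp [shift]
  | cons a l ih =>
    rw [List.nodup_cons] at hl
    rw [List.map_cons, run_cons, ih hl.2]
    funext b
    simp only [shift, Gate.apply]
    congr 1
    funext w
    by_cases h : w = a
    · subst h; simp [hl.1]
    · simp [h]

theorem run_flips {W : Type} [Fintype W] [DecidableEq W] (v : W → Bool) (ψ : QState W) :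
    run (flips v) ψ = shift v ψ := by
  rw [flips, run_map_X _ (nodup_toList _)]
  simp

/-- The circuit that adds the contents of the qubits `u i` to the qubits `v i`. -/
def copy {W : Type} {k : ℕ} (u v : Fin k → W) : Circuit W :=
  (List.finRange k).map fun i => Gate.CNOT (u i) (v i)

theorem length_copy {W : Type} {k : ℕ} (u v : Fin k → W) : (copy u v).length = k := by
  simp [copy]

theorem relabel_copy {V W : Type} {k : ℕ} (f : V → W) (u v : Fin k → V) :
    relabel f (copy u v) = copy (f ∘ u) (f ∘ v) := by
  simp [relabel, copy, Function.comp_def, Gate.map]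

theorem run_copy {W : Type} [DecidableEq W] {k : ℕ} {u v : Fin k → W}
    (hv : Function.Injective v) (huv : ∀ i j, u i ≠ v j) (ψ : QState W) :
    run (copy u v) ψ = fun b => ψ (addInto u v b) := by
  have key : ∀ (l : List (Fin k)) (_ : l.Nodup) (ψ : QState W) (b : W → Bool),
      run (l.map fun i => Gate.CNOT (u i) (v i)) ψ b =
        ψ (Function.extend v (fun i => if i ∈ l then xor (b (v i)) (b (u i)) else b (v i)) b) := by
    intro l hl
    induction l with
    | nil =>
      intro ψ b
      have := Gate.extend_comp_self hv b
      simpa [Function.comp_def] using congrArg ψ this.symm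
    | cons a l ih =>
      intro ψ b
      rw [List.nodup_cons] at hl
      rw [List.map_cons, run_cons, ih hl.2]
      simp only [Gate.apply, huv a a, if_false]
      congr 1
      rw [hv.extend_apply, Function.extend_apply' _ _ _ (fun ⟨j, hj⟩ => huv a j hj.symm),
        if_neg hl.1]
      rw [← Gate.extend_update_comp hv]
      congr 1
      funext i
      by_cases h : i = a
      · subst h; simp
      · simp [h]
  funext b
  rw [copy, key _ (List.nodup_finRange k)]
  simp [addInto]

end Circuit

theorem addInto_apply {W : Type} {k : ℕ} {u v : Fin k → W} (hv : Function.Injective v)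
    (b : W → Bool) (i : Fin k) : addInto u v b (v i) = xor (b (v i)) (b (u i)) :=
  hv.extend_apply _ _ _

theorem addInto_of_ne {W : Type} {k : ℕ} {u v : Fin k → W} (b : W → Bool) {w : W}
    (h : ∀ i, v i ≠ w) : addInto u v b w = b w :=
  Function.extend_apply' _ _ _ fun ⟨i, hi⟩ => h i hi

/-! ### Composite systems -/

/-- The state of a composite system in which, if the second part is in the basis state `r`, the
first part is in the (not normalised) state `F r`. Every state has this form. -/
def glue {M R : Type} (F : (R → Bool) → QState M) : QState (M ⊕ R) :=
  fun b => F (b ∘ Sum.inr) (b ∘ Sum.inl)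

section Join

variable {M R : Type}

theorem withKet_eq_glue (φ : QState M) (v : R → Bool) :
    withKet φ v = glue fun r => ket v r • φ := by
  funext b; simp [withKet, glue, Function.comp_def, mul_comm]

theorem extend_inl (v : M → Bool) (b : M ⊕ R → Bool) :
    Function.extend Sum.inl v b = Sum.elim v (b ∘ Sum.inr) := by
  funext w
  rcases w with w | w
  · exact Sum.inl_injective.extend_apply _ _ _
  · exact Function.extend_apply' _ _ _ (by simp)

theorem extend_inr (v : R → Bool) (b : M ⊕ R → Bool) :
    Function.extend Sum.inr v b = Sum.elim (b ∘ Sum.inl) v := by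
  funext w
  rcases w with w | w
  · exact Function.extend_apply' _ _ _ (by simp)
  · exact Sum.inr_injective.extend_apply _ _ _

variable [DecidableEq M] [DecidableEq R]

theorem run_inl_glue (C : Circuit M) (F : (R → Bool) → QState M) :
    (C.relabel Sum.inl).run (glue F) = glue fun r => C.run (F r) := by
  funext b
  rw [Circuit.run_relabel Sum.inl_injective]
  simp only [extend_inl]
  rfl

theorem run_inr_glue (C : Circuit R) (F : (R → Bool) → QState M) :
    (C.relabel Sum.inr).run (glue F) = glue fun r b => C.run (fun r' => F r' b) r := by
  funext b
  rw [Circuit.run_relabel Sum.inr_injective]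
  simp only [extend_inr]
  rfl

theorem run_inl_withKet (C : Circuit M) (φ : QState M) (v : R → Bool) :
    (C.relabel Sum.inl).run (withKet φ v) = withKet (C.run φ) v := by
  rw [withKet_eq_glue, run_inl_glue, withKet_eq_glue]
  simp [Circuit.run_smul]

theorem run_copy_inl_inr {k : ℕ} (u : Fin k → M) {v : Fin k → R} (hv : Function.Injective v)
    (F : (R → Bool) → QState M) :
    (Circuit.copy (fun i => Sum.inl (u i)) (fun i => Sum.inr (v i))).run (glue F) =
      glue fun r b => F (Function.extend v (fun i => xor (r (v i)) (b (u i))) r) b := by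
  rw [Circuit.run_copy (fun i j h => hv (Sum.inr_injective h)) (by simp)]
  funext b
  have h1 : addInto (fun i => Sum.inl (u i)) (fun i => Sum.inr (v i)) b ∘ Sum.inl =
      b ∘ Sum.inl := by
    funext w; exact addInto_of_ne _ (by simp)
  have h2 : addInto (fun i => Sum.inl (u i)) (fun i => Sum.inr (v i)) b ∘ Sum.inr =
      Function.extend v (fun i => xor (b (Sum.inr (v i))) (b (Sum.inl (u i)))) (b ∘ Sum.inr) := by
    funext w
    by_cases h : ∃ i, v i = w
    · obtain ⟨i, rfl⟩ := h
      rw [hv.extend_apply]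
      exact addInto_apply (v := fun i => Sum.inr (v i)) (fun i j h => hv (Sum.inr_injective h)) b i
    · rw [Function.extend_apply' _ _ _ h]
      exact addInto_of_ne _ fun i hi => h ⟨i, Sum.inr_injective hi⟩
  simp only [glue, h1, h2]
  rfl

theorem run_copy_inr_inl {k : ℕ} (u : Fin k → R) {v : Fin k → M} (hv : Function.Injective v)
    (F : (R → Bool) → QState M) :
    (Circuit.copy (fun i => Sum.inr (u i)) (fun i => Sum.inl (v i))).run (glue F) =
      glue fun r => shift (Function.extend v (fun i => r (u i)) fun _ => false) (F r) := by
  rw [Circuit.run_copy (fun i j h => hv (Sum.inl_injective h)) (by simp)]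
  funext b
  have h1 : addInto (fun i => Sum.inr (u i)) (fun i => Sum.inl (v i)) b ∘ Sum.inr =
      b ∘ Sum.inr := by
    funext w; exact addInto_of_ne _ (by simp)
  have h2 : addInto (fun i => Sum.inr (u i)) (fun i => Sum.inl (v i)) b ∘ Sum.inl =
      fun w => xor (b (Sum.inl w))
        (Function.extend v (fun i => b (Sum.inr (u i))) (fun _ => false) w) := by
    funext w
    by_cases h : ∃ i, v i = w
    · obtain ⟨i, rfl⟩ := h
      rw [hv.extend_apply]
      exact addInto_apply (v := fun i => Sum.inl (v i)) (fun i j h => hv (Sum.inl_injective h)) b i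
    · rw [Function.extend_apply' _ _ _ h, Bool.xor_false]
      exact addInto_of_ne _ fun i hi => h ⟨i, Sum.inl_injective hi⟩
  simp only [glue, h1, h2, shift]
  rfl

end Join

theorem sum_sum_arrow {M R : Type} [Fintype M] [Fintype R] [DecidableEq M] [DecidableEq R]
    (f : (M ⊕ R → Bool) → ℝ) :
    ∑ b, f b = ∑ r : R → Bool, ∑ b : M → Bool, f (Sum.elim b r) := by
  rw [sum_comm, ← Fintype.sum_prod_type']
  exact Fintype.sum_equiv (Equiv.sumArrowEquivProdArrow M R Bool) _ _ fun b => by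
    congr 1; funext w; rcases w with w | w <;> rfl

theorem prob_glue {M R : Type} [Fintype M] [Fintype R] [DecidableEq M] [DecidableEq R]
    (P : (M ⊕ R → Bool) → Prop) (F : (R → Bool) → QState M) :
    prob P (glue F) = ∑ r : R → Bool, prob (fun b => P (Sum.elim b r)) (F r) := by
  classical
  rw [prob, sum_sum_arrow]
  refine sum_congr rfl fun r _ => sum_congr rfl fun b _ => ?_
  simp [glue]

theorem prob_withKet {M R : Type} [Fintype M] [Fintype R] [DecidableEq M] [DecidableEq R]
    (P : (M ⊕ R → Bool) → Prop) (φ : QState M) (v : R → Bool) :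
    prob P (withKet φ v) = prob (fun b => P (Sum.elim b v)) φ := by
  rw [withKet_eq_glue, prob_glue, sum_eq_single v]
  · simp [ket]
  · intro r _ hr
    simp [ket, hr, prob_zero]
  · simp

/-- The state of a larger system in which the subsystem of the qubits in the range of `e` is in the
state `ψ` and all other qubits are zero. -/
noncomputable def embed {M N : Type} (e : M → N) (ψ : QState M) : QState N :=
  open scoped Classical in
  fun b => if ∀ w, (∀ i, e i ≠ w) → b w = false then ψ (b ∘ e) else 0

section Embed

variable {M N : Type}

theorem embed_embed {V : Type} {g : N → V} (hg : Function.Injective g) (e : M → N)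
    (ψ : QState M) : embed g (embed e ψ) = embed (g ∘ e) ψ := by
  funext b
  simp only [embed]
  by_cases h : ∀ w, (∀ i, (g ∘ e) i ≠ w) → b w = false
  · rw [if_pos h, if_pos fun w hw => h w fun i => hw (e i), if_pos]
    · rfl
    · intro w hw
      exact h (g w) fun i hi => hw i (hg hi)
  · rw [if_neg h]
    split_ifs with h1 h2
    · exfalso
      apply h
      intro w hw
      by_cases hgw : ∃ j, g j = w
      · obtain ⟨j, rfl⟩ := hgw
        exact h2 j fun i hi => hw i (congrArg g hi)
      · exact h1 w fun i hi => hgw ⟨i, hi⟩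
    · rfl
    · rfl

theorem embed_inl {R : Type} (ψ : QState M) :
    embed (Sum.inl : M → M ⊕ R) ψ = withKet ψ fun _ => false := by
  funext b
  have : (∀ w, (∀ i : M, (Sum.inl i : M ⊕ R) ≠ w) → b w = false) ↔
      (fun w => b (Sum.inr w)) = fun _ : R => false := by
    constructor
    · intro h; funext w; exact h _ (by simp)
    · rintro h (w | w) hw
      · exact absurd rfl (hw w)
      · exact congrFun h w
  simp only [embed, withKet, ket]
  by_cases h : (fun w => b (Sum.inr w)) = fun _ : R => false
  · rw [if_pos h, if_pos (this.2 h), mul_one]; rfl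
  · rw [if_neg h, if_neg (mt this.1 h), mul_zero]

theorem embed_smul (e : M → N) (s : ℂ) (ψ : QState M) : embed e (s • ψ) = s • embed e ψ := by
  funext b; simp [embed]

theorem run_relabel_embed [DecidableEq M] [DecidableEq N] {e : M → N} (he : Function.Injective e)
    (C : Circuit M) (ψ : QState M) : (C.relabel e).run (embed e ψ) = embed e (C.run ψ) := by
  funext b
  rw [Circuit.run_relabel he]
  have h : ∀ v : M → Bool, (∀ w, (∀ i, e i ≠ w) → Function.extend e v b w = false) ↔
      ∀ w, (∀ i, e i ≠ w) → b w = false := fun v =>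
    forall_congr' fun w => forall_congr' fun hw => by
      rw [Function.extend_apply' _ _ _ fun ⟨i, hi⟩ => hw i hi]
  have h2 : ∀ v : M → Bool, Function.extend e v b ∘ e = v := fun v =>
    funext fun i => he.extend_apply _ _ _
  by_cases hb : ∀ w, (∀ i, e i ≠ w) → b w = false
  · have : (fun v => embed e ψ (Function.extend e v b)) = ψ := by
      funext v
      rw [embed, if_pos ((h v).2 hb), h2]
    rw [this, embed, if_pos hb]
  · have : (fun v => embed e ψ (Function.extend e v b)) = 0 := by
      funext v
      rw [embed, if_neg (mt (h v).1 hb)]; rfl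
    rw [this, embed, if_neg hb, Circuit.run_zero]; rfl

theorem proj_embed (e : M → N) (P : (M → Bool) → Prop) (ψ : QState M) :
    proj (fun b => P (b ∘ e)) (embed e ψ) = embed e (proj P ψ) := by
  funext b; simp only [proj, embed]; split_ifs <;> rfl

theorem prob_embed [Fintype M] [Fintype N] [DecidableEq M] [DecidableEq N] {e : M → N}
    (he : Function.Injective e) (P : (M → Bool) → Prop) (ψ : QState M) :
    prob (fun b => P (b ∘ e)) (embed e ψ) = prob P ψ := by
  classical
  symm
  have hinj : Function.Injective fun v : M → Bool => Function.extend e v fun _ => false := by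
    intro v v' h
    funext i
    have := congrFun h (e i)
    simpa [he.extend_apply] using this
  refine Fintype.sum_of_injective (fun v : M → Bool => Function.extend e v fun _ => false) hinj _ _
    ?_ ?_
  · intro b hb
    have : ¬ ∀ w, (∀ i, e i ≠ w) → b w = false := by
      intro h
      apply hb
      refine ⟨b ∘ e, funext fun w => ?_⟩
      by_cases hw : ∃ i, e i = w
      · obtain ⟨i, rfl⟩ := hw
        exact he.extend_apply _ _ _
      · exact (Function.extend_apply' _ _ _ hw).trans (h w fun i hi => hw ⟨i, hi⟩).symm
    simp [embed, this]
  · intro v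
    have h1 : (Function.extend e v fun _ => false) ∘ e = v :=
      funext fun i => he.extend_apply _ _ _
    have h2 : ∀ w, (∀ i, e i ≠ w) → Function.extend e v (fun _ => false) w = false := fun w hw =>
      Function.extend_apply' _ _ _ fun ⟨i, hi⟩ => hw i hi
    simp only [h1, embed, if_pos h2]

theorem sqNorm_embed [Fintype M] [Fintype N] [DecidableEq M] [DecidableEq N] {e : M → N}
    (he : Function.Injective e) (ψ : QState M) : sqNorm (embed e ψ) = sqNorm ψ := by
  simp only [← prob_true]
  exact prob_embed he (fun _ => True) ψ

end Embed

/-! ### Circuits that leave some qubits alone -/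

theorem Circuit.run_proj_comm {W : Type} [DecidableEq W] {Q : W → Prop} {C : Circuit W}
    (hC : C.Within Q) (P : (W → Bool) → Prop)
    (hP : ∀ b w x, Q w → (P (Function.update b w x) ↔ P b)) (ψ : QState W) :
    C.run (proj P ψ) = proj P (C.run ψ) := by
  induction C generalizing ψ with
  | nil => rfl
  | cons g C ih =>
    rw [run_cons, run_cons, ← ih fun g' hg' => hC g' (List.mem_cons_of_mem _ hg')]
    congr 1
    have hg := hC g (List.mem_cons_self ..)
    have hP' : ∀ b w x, Q w → (P (Function.update b w x) = P b) := fun b w x hw =>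
      propext (hP b w x hw)
    cases g <;> simp only [Gate.wires, List.mem_cons, List.not_mem_nil, or_false, forall_eq,
        forall_eq_or_imp] at hg <;> funext b <;> by_cases hb : P b <;>
      simp [proj, Gate.apply, hP', hg, hb]

theorem Circuit.run_shift_comm {W : Type} [DecidableEq W] {Q : W → Prop} {C : Circuit W}
    (hC : C.Within Q) (v : W → Bool) (hv : ∀ w, Q w → v w = false) (ψ : QState W) :
    C.run (shift v ψ) = shift v (C.run ψ) := by
  have hu : ∀ (b : W → Bool) w x, Q w → (fun w' => xor (Function.update b w x w') (v w')) =
      Function.update (fun w' => xor (b w') (v w')) w x := by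
    intro b w x hw
    funext w'
    by_cases h : w' = w
    · subst h; simp [hv _ hw]
    · simp [h]
  induction C generalizing ψ with
  | nil => rfl
  | cons g C ih =>
    rw [run_cons, run_cons, ← ih fun g' hg' => hC g' (List.mem_cons_of_mem _ hg')]
    congr 1
    have hg := hC g (List.mem_cons_self ..)
    cases g <;> simp only [Gate.wires, List.mem_cons, List.not_mem_nil, or_false, forall_eq,
        forall_eq_or_imp] at hg <;> funext b <;>
      simp only [shift, Gate.apply, hu, hv, hg, Bool.xor_false]

theorem prob_comp_involutive {W : Type} [Fintype W] [DecidableEq W]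
    {σ : (W → Bool) → W → Bool} (hσ : Function.Involutive σ)
    (P : (W → Bool) → Prop) (ψ : QState W) :
    prob P (fun b => ψ (σ b)) = prob (fun b => P (σ b)) ψ := by
  refine Fintype.sum_equiv (Function.Involutive.toPerm _ hσ) _ _ fun b => ?_
  have h : σ (Function.Involutive.toPerm _ hσ b) = b := hσ b
  by_cases hb : P b
  · rw [if_pos hb, if_pos (Eq.mpr (congrArg P h) hb)]; rfl
  · rw [if_neg hb, if_neg (mt (Eq.mp (congrArg P h)) hb)]

theorem prob_CCNOT {W : Type} [Fintype W] [DecidableEq W] {u v w : W} (huw : u ≠ w) (hvw : v ≠ w)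
    {ψ : QState W} (hψ : ∀ b, ψ b ≠ 0 → b w = false) :
    prob (fun b => b w = true) (Circuit.run [Gate.CCNOT u v w] ψ) =
      prob (fun b => b u = true ∧ b v = true) ψ := by
  have inv : Function.Involutive fun b : W → Bool =>
      Function.update b w (xor (b w) (b u && b v)) := by
    intro b; simp [huw, hvw]
  have : Circuit.run [Gate.CCNOT u v w] ψ =
      fun b => ψ (Function.update b w (xor (b w) (b u && b v))) := by
    funext b; simp [Gate.apply, huw, hvw]
  rw [this, prob_comp_involutive inv]
  exact prob_congr fun b hb => by simp [hψ b hb]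

theorem sqNorm_proj_le {W : Type} [Fintype W] [DecidableEq W] (P : (W → Bool) → Prop)
    (ψ : QState W) : sqNorm (proj P ψ) ≤ sqNorm ψ := by
  rw [← prob_eq_sqNorm_proj]; exact prob_le_sqNorm _ _

theorem proj_zero {W : Type} (P : (W → Bool) → Prop) : proj P (0 : QState W) = 0 := by
  funext b; simp [proj]

theorem proj_smul {W : Type} (P : (W → Bool) → Prop) (s : ℂ) (ψ : QState W) :
    proj P (s • ψ) = s • proj P ψ := by
  funext b; simp [proj]

theorem proj_false {W : Type} {P : (W → Bool) → Prop} (h : ∀ b, ¬ P b) (ψ : QState W) :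
    proj P ψ = 0 := by
  funext b; simp [proj, h]

theorem proj_proj {W : Type} (P Q : (W → Bool) → Prop) (ψ : QState W) :
    proj P (proj Q ψ) = proj (fun b => P b ∧ Q b) ψ := by
  funext b; by_cases hp : P b <;> by_cases hq : Q b <;> simp [proj, hp, hq]

theorem proj_congr {W : Type} {P Q : (W → Bool) → Prop} (h : ∀ b, P b ↔ Q b) (ψ : QState W) :
    proj P ψ = proj Q ψ := by
  rw [show P = Q from funext fun b => propext (h b)]

theorem sqNorm_withKet {M R : Type} [Fintype M] [Fintype R] [DecidableEq M] [DecidableEq R]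
    (φ : QState M) (v : R → Bool) : sqNorm (withKet φ v) = sqNorm φ := by
  simp only [← prob_true, prob_withKet]

/-! ### Registers that record a function of the rest of the system -/

/-- The state in which the second part of the system records the function `κ` of the first part. -/
noncomputable def tagged {M R : Type} (κ : (M → Bool) → R → Bool) (ψ : QState M) :
    QState (M ⊕ R) :=
  glue fun r b => ket (κ b) r * ψ b

section Tagged

variable {M R : Type}

theorem withKet_eq_tagged (φ : QState M) (v : R → Bool) :
    withKet φ v = tagged (fun _ => v) φ := by
  rw [withKet_eq_glue]; rfl

theorem ket_sum_elim (a : M → Bool) (h : R → Bool) : ket (Sum.elim a h) = withKet (ket a) h := by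
  funext b
  have : b = Sum.elim a h ↔ (fun i => b (Sum.inl i)) = a ∧ (fun i => b (Sum.inr i)) = h := by
    constructor
    · rintro rfl; exact ⟨rfl, rfl⟩
    · rintro ⟨rfl, rfl⟩; funext w; rcases w with w | w <;> rfl
  by_cases h1 : (fun i => b (Sum.inl i)) = a <;> by_cases h2 : (fun i => b (Sum.inr i)) = h <;>
    simp [ket, withKet, this, h1, h2]

theorem shift_ket_zero (v : M → Bool) : shift v (ket fun _ => false) = ket v := by
  funext b
  have : (fun w => xor (b w) (v w)) = (fun _ => false) ↔ b = v := by
    simp [funext_iff]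
  by_cases h : b = v
  · simp [shift, ket, h]
  · simp only [shift, ket, if_neg h, if_neg (mt this.1 h)]

theorem proj_tagged (P : (M ⊕ R → Bool) → Prop) (κ : (M → Bool) → R → Bool) (ψ : QState M) :
    proj P (tagged κ ψ) = tagged κ (proj (fun b => P (Sum.elim b (κ b))) ψ) := by
  funext b
  by_cases hk : b ∘ Sum.inr = κ (b ∘ Sum.inl)
  · have : b = Sum.elim (b ∘ Sum.inl) (κ (b ∘ Sum.inl)) := by
      rw [← hk]; funext w; rcases w with w | w <;> rfl
    by_cases hp : P b
    · have hp' := hp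
      rw [this] at hp'
      simp [proj, tagged, glue, hp, hp']
    · have hp' := hp
      rw [this] at hp'
      simp [proj, tagged, glue, hp, hp']
  · simp [proj, tagged, glue, ket, hk]

variable [DecidableEq M] [DecidableEq R]

theorem run_inr_tagged (C : Circuit R) (κ : (M → Bool) → R → Bool) (ψ : QState M) :
    (C.relabel Sum.inr).run (tagged κ ψ) = glue fun r b => C.run (ket (κ b)) r * ψ b := by
  rw [tagged, run_inr_glue]
  congr 1
  funext r b
  have : (fun r' => ket (κ b) r' * ψ b) = ψ b • ket (κ b) := by
    funext r'; simp [mul_comm]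
  rw [this, Circuit.run_smul, Pi.smul_apply, smul_eq_mul, mul_comm]

theorem run_flips_tagged [Fintype R] (v : R → Bool) (ψ : QState M) :
    ((Circuit.flips v).relabel Sum.inr).run (tagged (fun _ _ => false) ψ) =
      tagged (fun _ => v) ψ := by
  rw [run_inr_tagged, Circuit.run_flips, shift_ket_zero]; rfl

theorem run_copy_tagged {k : ℕ} (u : Fin k → M) {v : Fin k → R} (hv : Function.Injective v)
    (κ : (M → Bool) → R → Bool) (ψ : QState M) :
    (Circuit.copy (fun i => Sum.inl (u i)) (fun i => Sum.inr (v i))).run (tagged κ ψ) =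
      tagged (fun b => Function.extend v (fun i => xor (κ b (v i)) (b (u i))) (κ b)) ψ := by
  rw [tagged, run_copy_inl_inr u hv, tagged]
  congr 1
  funext r b
  congr 1
  have : Function.extend v (fun i => xor (r (v i)) (b (u i))) r = κ b ↔
      r = Function.extend v (fun i => xor (κ b (v i)) (b (u i))) (κ b) := by
    constructor
    · intro h
      rw [← h]
      simp only [hv.extend_apply, Bool.xor_assoc, Bool.xor_self, Bool.xor_false]
      rw [Gate.extend_extend hv]
      exact (Gate.extend_comp_self hv r).symm
    · intro h
      rw [h]
      simp only [hv.extend_apply, Bool.xor_assoc, Bool.xor_self, Bool.xor_false]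
      rw [Gate.extend_extend hv]
      exact Gate.extend_comp_self hv (κ b)
  by_cases h : r = Function.extend v (fun i => xor (κ b (v i)) (b (u i))) (κ b)
  · rw [ket, if_pos (this.2 h), ket, if_pos h]
  · rw [ket, if_neg (mt this.1 h), ket, if_neg h]

end Tagged

/-! ### Efficient tests -/

/-- A functional on state vectors is realised with cost `s` if it is the probability that a circuit
with auxiliary qubits sets a certain output qubit; the cost is the number of qubits and gates. -/
def Realizes {M : Type} (T : QState M → ℝ) (s : ℕ) : Prop :=
  ∃ (N : Type) (_ : Fintype N) (_ : DecidableEq N) (e : M → N) (C : Circuit N) (o : N),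
    Function.Injective e ∧ Fintype.card N + C.length ≤ s ∧
      ∀ ψ, T ψ = prob (fun b => b o = true) (C.run (embed e ψ))

theorem Realizes.smul {M : Type} {T : QState M → ℝ} {s : ℕ} (hT : Realizes T s) (r : ℂ)
    (ψ : QState M) : T (r • ψ) = ‖r‖ ^ 2 * T ψ := by
  obtain ⟨N, _, _, e, D, o, he, hs, hT⟩ := hT
  rw [hT, hT, embed_smul, Circuit.run_smul, prob_smul]

theorem Realizes.map_zero {M : Type} {T : QState M → ℝ} {s : ℕ} (hT : Realizes T s) : T 0 = 0 := by
  simpa using hT.smul 0 0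

section Realizes

variable {M : Type}

theorem realizes_sqNorm [Fintype M] [DecidableEq M] :
    Realizes (sqNorm : QState M → ℝ) (Fintype.card M + 1 + 1) := by
  refine ⟨M ⊕ Unit, inferInstance, inferInstance, Sum.inl, [Gate.X (Sum.inr ())], Sum.inr (),
    Sum.inl_injective, by simp, fun ψ => ?_⟩
  have h := Circuit.run_map_X [(Sum.inr () : M ⊕ Unit)] (by simp) (embed Sum.inl ψ)
  simp only [List.map_cons, List.map_nil] at h
  rw [h, prob_shift, embed_inl, prob_withKet, ← prob_true]
  simp

theorem Realizes.comp_run [DecidableEq M] {T : QState M → ℝ} {s : ℕ} (hT : Realizes T s)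
    (C : Circuit M) :
    Realizes (fun ψ => T (C.run ψ)) (s + C.length) := by
  obtain ⟨N, _, _, e, D, o, he, hs, hT⟩ := hT
  refine ⟨N, inferInstance, inferInstance, e, C.relabel e ++ D, o, he, ?_, fun ψ => ?_⟩
  · rw [List.length_append, Circuit.length_relabel]; omega
  · rw [Circuit.run_append, run_relabel_embed he, ← hT]

/-- A test may measure some qubits and run a classical check on the outcome before it goes on. The
outcome is copied twice, since the circuit for the check may spoil its input. -/
theorem Realizes.sum_measure {T : QState M → ℝ} {s : ℕ} (hT : Realizes T s) {k : ℕ}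
    (ρ : Fin k → M) {V : Type} [Fintype V] [DecidableEq V] {ι : Fin k → V}
    (hι : Function.Injective ι) (v : V → Bool) (hv : ∀ i, v (ι i) = false) (D : Circuit V) (o : V)
    (check : Bits k → Bool)
    (hD : ∀ z, prob (fun b => b o = check z) (D.run (ket (Function.extend ι z v))) = 1) :
    Realizes (fun ψ => ∑ z : Bits k, if check z = true then T (proj (fun b => b ∘ ρ = z) ψ) else 0)
      (s + 2 * Fintype.card V + 4 * k + D.length + 3) := by
  obtain ⟨N, _, _, e, C, p, he, hs, hT⟩ := hT
  set G := V ⊕ (Fin k ⊕ Unit) with hG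
  set v0 : G → Bool := Sum.elim v fun _ => false with hv0
  refine ⟨N ⊕ G, inferInstance, inferInstance, fun i => Sum.inl (e i),
    (Circuit.flips v0).relabel Sum.inr ++
      (Circuit.copy (fun i => Sum.inl (e (ρ i))) (fun i => Sum.inr (Sum.inl (ι i))) ++
        (Circuit.copy (fun i => Sum.inl (e (ρ i))) (fun i => Sum.inr (Sum.inr (Sum.inl i))) ++
          (Circuit.relabel Sum.inr (D.relabel Sum.inl) ++ (C.relabel Sum.inl ++
            [Gate.CCNOT (Sum.inl p) (Sum.inr (Sum.inl o)) (Sum.inr (Sum.inr (Sum.inr ())))])))),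
    Sum.inr (Sum.inr (Sum.inr ())), fun i j h => he (Sum.inl_injective h), ?_, fun ψ => ?_⟩
  · have := Circuit.length_flips v0
    simp only [hG, Fintype.card_sum, Fintype.card_fin, Fintype.card_unit] at this
    simp only [List.length_append, Circuit.length_relabel, Circuit.length_copy, hG,
      Fintype.card_sum, Fintype.card_fin, Fintype.card_unit, List.length_singleton]
    omega
  set χ : Bits k → QState V := fun z => D.run (ket (Function.extend ι z v)) with hχ
  have htrue : ∀ z, prob (fun b => b o = true) (χ z) = if check z = true then 1 else 0 := by
    intro z
    have h1 := hD z
    rcases hz : check z with _ | _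
    · have h2 := prob_not (fun b : V → Bool => b o = check z) (χ z)
      rw [hz] at h2 h1
      rw [hχ, h1, Circuit.sqNorm_run, sqNorm_ket] at h2
      simp only [Bool.not_eq_false] at h2
      simp only [Bool.false_eq_true, if_false]
      linarith
    · rw [hz] at h1
      simpa using h1
  have hstate : Circuit.run (C.relabel Sum.inl)
      (Circuit.run (Circuit.relabel Sum.inr (D.relabel Sum.inl))
      (Circuit.run
        (Circuit.copy (fun i => Sum.inl (e (ρ i))) (fun i => Sum.inr (Sum.inr (Sum.inl i))))
        (Circuit.run (Circuit.copy (fun i => Sum.inl (e (ρ i))) (fun i => Sum.inr (Sum.inl (ι i))))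
          (Circuit.run ((Circuit.flips v0).relabel Sum.inr)
            (embed (fun i => (Sum.inl (e i) : N ⊕ G)) ψ))))) =
      glue fun g : G → Bool =>
        (χ (g ∘ Sum.inr ∘ Sum.inl) (g ∘ Sum.inl) *
          (if g (Sum.inr (Sum.inr ())) = false then 1 else 0)) •
        C.run (embed e (proj (fun b => b ∘ ρ = g ∘ Sum.inr ∘ Sum.inl) ψ)) := by
    have h0 : embed (fun i => (Sum.inl (e i) : N ⊕ G)) ψ =
        tagged (fun _ _ => false) (embed e ψ) := by
      rw [← withKet_eq_tagged, ← embed_inl, embed_embed Sum.inl_injective]; rfl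
    rw [h0, run_flips_tagged,
      run_copy_tagged (fun i => e (ρ i)) (v := fun i => (Sum.inl (ι i) : G))
        (fun i j h => hι (Sum.inl_injective h)),
      run_copy_tagged (fun i => e (ρ i)) (v := fun i => (Sum.inr (Sum.inl i) : G))
        (fun i j h => Sum.inl_injective (Sum.inr_injective h))]
    have hκ : (fun b : N → Bool =>
        Function.extend (fun i => (Sum.inr (Sum.inl i) : G))
          (fun i => xor (Function.extend (fun i => (Sum.inl (ι i) : G))
              (fun i => xor (v0 (Sum.inl (ι i))) (b (e (ρ i)))) v0 (Sum.inr (Sum.inl i)))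
            (b (e (ρ i))))
          (Function.extend (fun i => (Sum.inl (ι i) : G))
              (fun i => xor (v0 (Sum.inl (ι i))) (b (e (ρ i)))) v0)) =
        fun b => Sum.elim (Function.extend ι (fun i => b (e (ρ i))) v)
          (Sum.elim (fun i => b (e (ρ i))) fun _ => false) := by
      funext b
      have h1 : Function.extend (fun i => (Sum.inl (ι i) : G))
              (fun i => xor (v0 (Sum.inl (ι i))) (b (e (ρ i)))) v0 =
          Sum.elim (Function.extend ι (fun i => b (e (ρ i))) v) fun _ => false := by
        funext w
        rcases w with w | w
        · by_cases h : ∃ i, ι i = w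
          · obtain ⟨i, rfl⟩ := h
            rw [Function.Injective.extend_apply (f := fun i => (Sum.inl (ι i) : G))
              (fun i j h => hι (Sum.inl_injective h)), Sum.elim_inl, hι.extend_apply]
            simp [hv0, hv]
          · rw [Function.extend_apply' _ _ _ fun ⟨i, hi⟩ => h ⟨i, Sum.inl_injective hi⟩,
              Sum.elim_inl, Function.extend_apply' _ _ _ h]
            rfl
        · rw [Function.extend_apply' _ _ _ (by simp)]; rfl
      rw [h1]
      funext w
      rcases w with w | w | w
      · rw [Function.extend_apply' _ _ _ (by simp)]; rfl
      · rw [Function.Injective.extend_apply (f := fun i => (Sum.inr (Sum.inl i) : G))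
            (fun i j h => Sum.inl_injective (Sum.inr_injective h))]
        simp
      · rw [Function.extend_apply' _ _ _ (by simp)]; rfl
    rw [hκ, run_inr_tagged]
    have hF : (fun (g : G → Bool) (b : N → Bool) =>
        (D.relabel Sum.inl).run (ket (Sum.elim (Function.extend ι (fun i => b (e (ρ i))) v)
          (Sum.elim (fun i => b (e (ρ i))) fun _ => false))) g * embed e ψ b) =
        fun g => (χ (g ∘ Sum.inr ∘ Sum.inl) (g ∘ Sum.inl) *
          (if g (Sum.inr (Sum.inr ())) = false then 1 else 0)) •
          embed e (proj (fun b => b ∘ ρ = g ∘ Sum.inr ∘ Sum.inl) ψ) := by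
      funext g b
      rw [← proj_embed, ket_sum_elim, run_inl_withKet]
      simp only [withKet, ket_sum_elim, Pi.smul_apply, smul_eq_mul, proj, Function.comp_assoc]
      by_cases hz : b ∘ e ∘ ρ = g ∘ Sum.inr ∘ Sum.inl
      · have hz' : (fun i => g (Sum.inr (Sum.inl i))) = fun i => b (e (ρ i)) := hz.symm
        have hu : (fun i => g (Sum.inr (Sum.inr i))) = (fun _ : Unit => false) ↔
            g (Sum.inr (Sum.inr ())) = false :=
          ⟨fun h => congrFun h (), fun h => funext fun _ => h⟩
        rw [if_pos hz, ← hz, ket, if_pos hz']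
        by_cases hg : g (Sum.inr (Sum.inr ())) = false
        · rw [ket, if_pos (hu.2 hg), if_pos hg, mul_one, mul_one, mul_one]; rfl
        · rw [ket, if_neg (mt hu.1 hg), if_neg hg]; simp
      · have hz' : ¬ (fun i => g (Sum.inr (Sum.inl i))) = fun i => b (e (ρ i)) :=
          fun h => hz h.symm
        rw [if_neg hz, ket, if_neg hz']; simp
    rw [hF, run_inl_glue]
    simp only [Circuit.run_smul]
    rfl
  simp only [Circuit.run_append]
  rw [hstate, prob_CCNOT (by simp) (by simp), prob_glue]
  · simp only [Sum.elim_inl, Sum.elim_inr, prob_smul]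
    rw [sum_sum_arrow, sum_sum_arrow, sum_eq_single (fun _ : Unit => false)]
    · refine sum_congr rfl fun z _ => ?_
      have hsimp : ∀ a : V → Bool, prob (fun b : N → Bool => b p = true ∧
          Sum.elim a (Sum.elim z fun _ : Unit => false) (Sum.inl o) = true)
          (C.run (embed e (proj (fun b => b ∘ ρ = z) ψ))) =
          if a o = true then T (proj (fun b => b ∘ ρ = z) ψ) else 0 := by
        intro a
        rw [hT]
        by_cases ha : a o = true
        · simp [ha]
        · simp [ha, prob]
      have hcomp : ∀ a : V → Bool, (Sum.elim a (Sum.elim z fun _ : Unit => false) : G → Bool) ∘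
          Sum.inr ∘ Sum.inl = z := fun a => rfl
      have hcomp' : ∀ a : V → Bool, (Sum.elim a (Sum.elim z fun _ : Unit => false) : G → Bool) ∘
          Sum.inl = a := fun a => rfl
      simp only [hcomp, hcomp', hsimp, Sum.elim_inr, if_true, mul_one]
      have := htrue z
      rw [prob] at this
      have h3 : ∀ a : V → Bool, ‖χ z a‖ ^ 2 *
          (if a o = true then T (proj (fun b => b ∘ ρ = z) ψ) else 0) =
          (if a o = true then ‖χ z a‖ ^ 2 else 0) * T (proj (fun b => b ∘ ρ = z) ψ) := by
        intro a; split_ifs <;> simp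
      simp only [h3]
      rw [← sum_mul]
      have h4 : ∑ a : V → Bool, (if a o = true then ‖χ z a‖ ^ 2 else 0) =
          if check z = true then 1 else 0 := by
        rw [← this]; refine sum_congr rfl fun a _ => by split_ifs <;> rfl
      rw [h4]
      split_ifs <;> simp
    · intro u _ hu
      have : u () = true := by
        by_contra h
        exact hu (funext fun _ => by simpa using h)
      simp [this]
    · simp
  · intro b hb
    by_contra h
    apply hb
    simp [glue, h]

end Realizes

/-! ### The collapsing property against arbitrary efficient tests -/

namespace CollapsingAdversary

variable {P Q : Type} [Fintype P] [DecidableEq P] [Fintype Q] [DecidableEq Q]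

theorem sqNorm_mid (A : CollapsingAdversary P Q) : sqNorm A.mid = 1 := by
  rw [mid, Circuit.sqNorm_run, sqNorm_withKet]
  exact A.unit_state

theorem game1_nonneg (A : CollapsingAdversary P Q) (R : (P → Bool) → (Q → Bool) → Prop) :
    0 ≤ A.game1 R := sum_nonneg fun _ _ => sum_nonneg fun _ _ => prob_nonneg _ _

theorem game2_nonneg (A : CollapsingAdversary P Q) (R : (P → Bool) → (Q → Bool) → Prop) :
    0 ≤ A.game2 R := sum_nonneg fun _ _ => prob_nonneg _ _

theorem game1_le_one (A : CollapsingAdversary P Q) (R : (P → Bool) → (Q → Bool) → Prop) :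
    A.game1 R ≤ 1 := by
  rw [← A.sqNorm_mid]
  refine le_trans ?_ (sqNorm_proj_le (fun b => R (xOf b) (yOf b)) A.mid)
  rw [← sum_sqNorm_proj (fun b => (xOf b, yOf b)), Fintype.sum_prod_type]
  refine sum_le_sum fun x _ => sum_le_sum fun y _ => ?_
  refine (prob_le_sqNorm _ _).trans (le_of_eq ?_)
  rw [Circuit.sqNorm_run]
  simp only [Prod.mk.injEq]

theorem game2_le_one (A : CollapsingAdversary P Q) (R : (P → Bool) → (Q → Bool) → Prop) :
    A.game2 R ≤ 1 := by
  rw [← A.sqNorm_mid]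
  refine le_trans ?_ (sqNorm_proj_le (fun b => R (xOf b) (yOf b)) A.mid)
  rw [← sum_sqNorm_proj (fun b => yOf b)]
  refine sum_le_sum fun y _ => ?_
  refine (prob_le_sqNorm _ _).trans (le_of_eq ?_)
  rw [Circuit.sqNorm_run]

theorem abs_game1_sub_game2_le_one (A : CollapsingAdversary P Q)
    (R : (P → Bool) → (Q → Bool) → Prop) : |A.game1 R - A.game2 R| ≤ 1 := by
  rw [abs_le]
  constructor <;>
    linarith [A.game1_nonneg R, A.game2_nonneg R, A.game1_le_one R, A.game2_le_one R]

end CollapsingAdversary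

/-- The state of one qubit that is zero. -/
theorem isUnitVector_ket {W : Type} [Fintype W] [DecidableEq W] (v : W → Bool) :
    IsUnitVector (ket v) := sqNorm_ket v

theorem Negligible.of_abs_le {f g : ℕ → ℝ} (hg : Negligible g) (h : ∀ η, |f η| ≤ |g η|) :
    Negligible f :=
  SuperpolynomialDecay.trans_eventually_abs_le hg (Eventually.of_forall h)

/-- The collapsing property holds with one negligible function for all adversaries of a given
polynomial size: the advice may be chosen depending on the security parameter, so that a family of
adversaries may attain half of the supremum for every security parameter. -/
theorem SigmaProtocol.QuantumUniqueResponses.exists_uniform_bound {Pi : SigmaProtocol}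
    (h : Pi.QuantumUniqueResponses) (q : Polynomial ℕ) :
    ∃ κ : ℕ → ℝ, Negligible κ ∧ (∀ η, 0 ≤ κ η) ∧ ∀ η, ∀ x ∈ Pi.instances η,
      ∀ A : CollapsingAdversary (Fin (Pi.size η).resp)
        (Fin (Pi.size η).com ⊕ Fin (Pi.size η).chal), A.size ≤ q.eval η →
        |A.game1 (Pi.responseRel η x) - A.game2 (Pi.responseRel η x)| ≤ κ η := by
  classical
  let S : ℕ → Set ℝ := fun η => {r | ∃ x ∈ Pi.instances η,
    ∃ A : CollapsingAdversary (Fin (Pi.size η).resp) (Fin (Pi.size η).com ⊕ Fin (Pi.size η).chal),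
      A.size ≤ q.eval η ∧ |A.game1 (Pi.responseRel η x) - A.game2 (Pi.responseRel η x)| = r}
  have hS1 : ∀ η, ∀ r ∈ S η, r ≤ 1 := by
    rintro η r ⟨x, -, A, -, rfl⟩
    exact A.abs_game1_sub_game2_le_one _
  have hS0 : ∀ η, ∀ r ∈ S η, 0 ≤ r := by
    rintro η r ⟨x, -, A, -, rfl⟩
    exact abs_nonneg _
  have hbdd : ∀ η, BddAbove (S η) := fun η => ⟨1, hS1 η⟩
  have hsup : ∀ η, 0 ≤ sSup (S η) := fun η => Real.sSup_nonneg (hS0 η)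
  have hA : ∀ η, ∃ A : CollapsingAdversary (Fin (Pi.size η).resp)
      (Fin (Pi.size η).com ⊕ Fin (Pi.size η).chal), A.size ≤ (q + 1).eval η ∧
      (sSup (S η) = 0 ∨ ∃ x ∈ Pi.instances η, sSup (S η) ≤
        2 * |A.game1 (Pi.responseRel η x) - A.game2 (Pi.responseRel η x)|) := by
    intro η
    rcases (hsup η).eq_or_lt with h0 | h0
    · exact ⟨⟨1, ket fun _ => false, isUnitVector_ket _, [], [], Sum.inl 0⟩,
        by simp [CollapsingAdversary.size], Or.inl h0.symm⟩
    · have hne : (S η).Nonempty := by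
        by_contra hne
        rw [Set.not_nonempty_iff_eq_empty] at hne
        rw [hne, Real.sSup_empty] at h0
        exact lt_irrefl _ h0
      obtain ⟨r, ⟨x, hx, A, hA, rfl⟩, hr⟩ := exists_lt_of_lt_csSup hne (half_lt_self h0)
      refine ⟨A, hA.trans (by simp), Or.inr ⟨x, hx, ?_⟩⟩
      linarith
  choose A hA1 hA2 using hA
  obtain ⟨μ, hμ, hμA⟩ := h A ⟨q + 1, hA1⟩
  refine ⟨fun η => sSup (S η), ?_, hsup, fun η x hx A hA => ?_⟩
  · refine Negligible.of_abs_le (SuperpolynomialDecay.const_mul hμ 2) fun η => ?_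
    rw [abs_of_nonneg (hsup η), abs_mul, abs_two]
    rcases hA2 η with h0 | ⟨x, hx, hx2⟩
    · rw [h0]; positivity
    · have := hμA η x hx
      have := le_abs_self (μ η)
      linarith
  · exact le_csSup (hbdd η) ⟨x, hx, A, hA, rfl⟩

/-- Whether the response is measured after it was found acceptable makes no difference to an
efficient test. -/
theorem SigmaProtocol.abs_sum_measure_sub_le {Pi : SigmaProtocol} {η : ℕ}
    {x : Bits (Pi.size η).inst} {κ : ℝ} {s : ℕ}
    (hκ : ∀ A : CollapsingAdversary (Fin (Pi.size η).resp)
        (Fin (Pi.size η).com ⊕ Fin (Pi.size η).chal), A.size ≤ s →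
        |A.game1 (Pi.responseRel η x) - A.game2 (Pi.responseRel η x)| ≤ κ)
    {M : Type} [Fintype M] [DecidableEq M] {T : QState M → ℝ} {r : ℕ} (hT : Realizes T r)
    (hs : r + 3 * (Pi.size η).resp + (Pi.size η).com + (Pi.size η).chal ≤ s)
    (ρ : Fin (Pi.size η).resp → M) (a : Bits (Pi.size η).com) {c : Bits (Pi.size η).chal}
    (hc : c ∈ Pi.challenges η) (ψ : QState M) :
    |(∑ z, if Pi.verify η x a c z = true then T (proj (fun b => b ∘ ρ = z) ψ) else 0) -
      T (proj (fun b => Pi.verify η x a c (b ∘ ρ) = true) ψ)| ≤ κ * sqNorm ψ := by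
  -- by homogeneity it suffices to treat unit vectors
  wlog hψ : sqNorm ψ = 1 generalizing ψ
  · by_cases h0 : sqNorm ψ = 0
    · rw [sqNorm_eq_zero h0]
      simp [proj_zero, hT.map_zero, sqNorm]
    have hpos : 0 < sqNorm ψ := lt_of_le_of_ne (sqNorm_nonneg _) (Ne.symm h0)
    set l : ℝ := Real.sqrt (sqNorm ψ) with hl
    have hl0 : 0 < l := Real.sqrt_pos.2 hpos
    have hl2 : l ^ 2 = sqNorm ψ := Real.sq_sqrt hpos.le
    have hn : ‖(l : ℂ)‖ ^ 2 = sqNorm ψ := by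
      rw [Complex.norm_real, Real.norm_eq_abs, sq_abs, hl2]
    set φ : QState M := ((l⁻¹ : ℝ) : ℂ) • ψ with hφ
    have hψφ : ψ = (l : ℂ) • φ := by
      rw [hφ, smul_smul, ← Complex.ofReal_mul, mul_inv_cancel₀ hl0.ne', Complex.ofReal_one,
        one_smul]
    have hφ1 : sqNorm φ = 1 := by
      have h1 : sqNorm ψ = sqNorm ψ * sqNorm φ := by
        conv_lhs => rw [hψφ]
        rw [sqNorm_smul, hn]
      exact (mul_left_cancel₀ h0 (by rw [mul_one]; exact h1)).symm
    have key := this φ hφ1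
    rw [hφ1, mul_one] at key
    have hterm : ∀ P : (M → Bool) → Prop, T (proj P ψ) = sqNorm ψ * T (proj P φ) := by
      intro P
      conv_lhs => rw [hψφ]
      rw [proj_smul, hT.smul, hn]
    simp only [hterm]
    have hsum : (∑ z, if Pi.verify η x a c z = true then
        sqNorm ψ * T (proj (fun b => b ∘ ρ = z) φ) else 0) =
        sqNorm ψ * ∑ z, if Pi.verify η x a c z = true then
          T (proj (fun b => b ∘ ρ = z) φ) else 0 := by
      rw [mul_sum]; refine sum_congr rfl fun z _ => by split_ifs <;> simp
    rw [hsum, ← mul_sub, abs_mul, abs_of_pos hpos, mul_comm]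
    exact mul_le_mul_of_nonneg_right key hpos.le
  rw [hψ, mul_one]
  obtain ⟨N, _, _, e, C, o, he, hr, hT⟩ := hT
  set n := Fintype.card N with hn
  let f : M → Fin n := fun i => Fintype.equivFin N (e i)
  have hf : Function.Injective f := (Fintype.equivFin N).injective.comp he
  have hT' : ∀ φ, T φ = prob (fun b => b (Fintype.equivFin N o) = true)
      ((C.relabel (Fintype.equivFin N)).run (embed f φ)) := by
    intro φ
    have h1 : embed f φ = embed (Fintype.equivFin N) (embed e φ) :=
      (embed_embed (Fintype.equivFin N).injective e φ).symm
    rw [h1, run_relabel_embed (Fintype.equivFin N).injective, hT]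
    exact (prob_embed (Fintype.equivFin N).injective (fun b => b o = true) _).symm
  let P : Type := Fin (Pi.size η).resp
  let Q : Type := Fin (Pi.size η).com ⊕ Fin (Pi.size η).chal
  let y : Q → Bool := Sum.elim a c
  let v0 : P ⊕ Q → Bool := Sum.elim (fun _ => false) y
  let cp : Circuit (Fin n ⊕ (P ⊕ Q)) :=
    Circuit.copy (fun i => Sum.inl (f (ρ i))) (fun i => Sum.inr (Sum.inl i))
  have hinj : Function.Injective (Sum.inl : P → P ⊕ Q) := Sum.inl_injective
  let A : CollapsingAdversary P Q :=
    { n := n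
      state := embed f ψ
      unit_state := by
        have := sqNorm_embed hf ψ
        rw [hψ] at this
        exact this
      stage1 := (Circuit.flips v0).relabel Sum.inr ++ cp
      stage2 := cp ++ (C.relabel (Fintype.equivFin N)).relabel Sum.inl
      outBit := Sum.inl (Fintype.equivFin N o) }
  have hsize : A.size ≤ s := by
    have := Circuit.length_flips v0
    simp only [P, Q, Fintype.card_sum, Fintype.card_fin] at this
    simp only [CollapsingAdversary.size, A, cp, List.length_append, Circuit.length_relabel,
      Circuit.length_copy]
    omega
  let κz : (Fin n → Bool) → P ⊕ Q → Bool := fun b => Sum.elim (b ∘ f ∘ ρ) y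
  have hcopy1 : ∀ φ : QState (Fin n), cp.run (tagged (fun _ => v0) φ) = tagged κz φ := by
    intro φ
    rw [run_copy_tagged (fun i => f (ρ i)) hinj]
    congr 1
    funext b w
    rcases w with w | w
    · rw [hinj.extend_apply]; simp [v0, κz]
    · rw [Function.extend_apply' _ _ _ (by simp)]; rfl
  have hcopy2 : ∀ φ : QState (Fin n), cp.run (tagged κz φ) = withKet φ v0 := by
    intro φ
    rw [withKet_eq_tagged, run_copy_tagged (fun i => f (ρ i)) hinj]
    congr 1
    funext b w
    rcases w with w | w
    · rw [hinj.extend_apply]; simp [v0, κz]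
    · rw [Function.extend_apply' _ _ _ (by simp)]; rfl
  have hmid : A.mid = tagged κz (embed f ψ) := by
    rw [CollapsingAdversary.mid, Circuit.run_append, withKet_eq_tagged, run_flips_tagged, hcopy1]
  have hend : ∀ φ : QState M, prob (fun b => b A.outBit = true)
      (A.stage2.run (tagged κz (embed f φ))) = T φ := by
    intro φ
    rw [Circuit.run_append, hcopy2, run_inl_withKet, prob_withKet, hT']
    rfl
  have hproj : ∀ B : (P → Bool) → (Q → Bool) → Prop, ∀ φ : QState M,
      proj (fun b => B (CollapsingAdversary.xOf b) (CollapsingAdversary.yOf b))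
        (tagged κz (embed f φ)) = tagged κz (embed f (proj (fun b => B (b ∘ ρ) y) φ)) := by
    intro B φ
    rw [proj_tagged, ← proj_embed]; rfl
  have hrel : ∀ z : P → Bool, Pi.responseRel η x z y ↔ Pi.verify η x a c z = true := fun z =>
    ⟨fun h => h.2, fun h => ⟨hc, h⟩⟩
  have hg2 : A.game2 (Pi.responseRel η x) =
      T (proj (fun b => Pi.verify η x a c (b ∘ ρ) = true) ψ) := by
    rw [CollapsingAdversary.game2, hmid, hproj, sum_eq_single y]
    · rw [hproj (fun _ y' => y' = y), hend, proj_proj]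
      congr 1
      exact proj_congr (fun b => by simp [hrel]) ψ
    · intro y' _ hy'
      rw [hproj (fun _ y'' => y'' = y'), hend, proj_proj, proj_false (by simp [hy'.symm])]
      rw [hT']
      have : embed f (0 : QState M) = 0 := by funext b; simp [embed]
      rw [this, Circuit.run_zero, prob_zero]
    · simp
  have hg1 : A.game1 (Pi.responseRel η x) =
      ∑ z, if Pi.verify η x a c z = true then T (proj (fun b => b ∘ ρ = z) ψ) else 0 := by
    have hT0 : T 0 = 0 := by
      rw [hT']
      have : embed f (0 : QState M) = 0 := by funext b; simp [embed]
      rw [this, Circuit.run_zero, prob_zero]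
    rw [CollapsingAdversary.game1]
    refine sum_congr rfl fun z _ => ?_
    rw [hmid, hproj, sum_eq_single y]
    · rw [hproj (fun z' y' => z' = z ∧ y' = y), hend, proj_proj]
      by_cases hz : Pi.verify η x a c z = true
      · rw [if_pos hz]
        congr 1
        refine proj_congr (fun b => ?_) ψ
        rw [hrel]
        constructor
        · exact fun h => h.1.1
        · intro h; exact ⟨⟨h, rfl⟩, by rw [h]; exact hz⟩
      · rw [if_neg hz, proj_false, hT0]
        rintro b ⟨⟨h1, -⟩, h2⟩
        rw [hrel, h1] at h2
        exact hz h2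
    · intro y' _ hy'
      rw [hproj (fun z' y'' => z' = z ∧ y'' = y'), hend, proj_proj,
        proj_false (by simp [hy'.symm]), hT0]
    · simp
  rw [← hg1, ← hg2]
  exact hκ A hsize

/-! ### Repeated questioning of a prover -/

section Questioning

variable {M Ch : Type} {k : ℕ}

/-- Ask the challenge `c`, find the response `z` in the qubits `ρ`, and rewind. -/
noncomputable def answerStep [DecidableEq M] (U : Ch → Circuit M) (ρ : Fin k → M) (c : Ch)
    (z : Bits k) (ψ : QState M) : QState M :=
  (U c).inv.run (proj (fun b => b ∘ ρ = z) ((U c).run ψ))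

/-- Ask the challenge `c`, find that the predicate `P c` holds, and rewind. -/
noncomputable def acceptStep [DecidableEq M] (U : Ch → Circuit M)
    (P : Ch → (M → Bool) → Prop) (c : Ch) (ψ : QState M) : QState M :=
  (U c).inv.run (proj (P c) ((U c).run ψ))

/-- The state after the given challenges have been asked and the given responses were found. -/
noncomputable def answerPath [DecidableEq M] (U : Ch → Circuit M) (ρ : Fin k → M)
    (l : List (Ch × Bits k)) (ψ : QState M) : QState M :=
  l.foldl (fun φ p => answerStep U ρ p.1 p.2 φ) ψ

/-- The probability that all responses to the given challenges are acceptable if every response is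
measured. -/
noncomputable def measuredProb [Fintype M] [DecidableEq M] (U : Ch → Circuit M) (ρ : Fin k → M)
    (check : Ch → Bits k → Bool) : List Ch → QState M → ℝ
  | [], ψ => sqNorm ψ
  | c :: l, ψ => ∑ z : Bits k, if check c z = true then
      measuredProb U ρ check l (answerStep U ρ c z ψ) else 0

/-- The probability that all responses to the given challenges are acceptable if only their
acceptability is measured. -/
noncomputable def acceptedProb [Fintype M] [DecidableEq M] (U : Ch → Circuit M)
    (P : Ch → (M → Bool) → Prop) : List Ch → QState M → ℝ
  | [], ψ => sqNorm ψ
  | c :: l, ψ => acceptedProb U P l (acceptStep U P c ψ)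

theorem answerPath_ofFn_cons [DecidableEq M] (U : Ch → Circuit M) (ρ : Fin k → M) {t : ℕ}
    (c : Fin (t + 1) → Ch) (a : Bits k) (z : Fin t → Bits k) (ψ : QState M) :
    answerPath U ρ (List.ofFn fun j => (c j, (Fin.cons a z : Fin (t + 1) → Bits k) j)) ψ =
      answerPath U ρ (List.ofFn fun j => (c j.succ, z j)) (answerStep U ρ (c 0) a ψ) := by
  rw [List.ofFn_succ]
  simp [answerPath]

variable [Fintype M] [DecidableEq M]

theorem sum_sqNorm_answerStep (U : Ch → Circuit M) (ρ : Fin k → M) (c : Ch) (ψ : QState M) :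
    ∑ z, sqNorm (answerStep U ρ c z ψ) = sqNorm ψ := by
  simp only [answerStep, Circuit.sqNorm_run]
  rw [sum_sqNorm_proj (fun b => b ∘ ρ), Circuit.sqNorm_run]

theorem sqNorm_acceptStep_le (U : Ch → Circuit M) (P : Ch → (M → Bool) → Prop) (c : Ch)
    (ψ : QState M) : sqNorm (acceptStep U P c ψ) ≤ sqNorm ψ := by
  rw [acceptStep, Circuit.sqNorm_run]
  exact (sqNorm_proj_le _ _).trans (Circuit.sqNorm_run _ _).le

theorem sum_fin_succ_arrow {α : Type} [Fintype α] {t : ℕ} (f : (Fin (t + 1) → α) → ℝ) :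
    ∑ z, f z = ∑ a : α, ∑ z : Fin t → α, f (Fin.cons a z) := by
  rw [← Fintype.sum_prod_type', ← (Fin.consEquiv fun _ : Fin (t + 1) => α).sum_comp]
  rfl

theorem sum_sqNorm_answerPath (U : Ch → Circuit M) (ρ : Fin k → M) {t : ℕ} (c : Fin t → Ch)
    (ψ : QState M) :
    ∑ z : Fin t → Bits k, sqNorm (answerPath U ρ (List.ofFn fun j => (c j, z j)) ψ) =
      sqNorm ψ := by
  induction t generalizing ψ with
  | zero => simp [answerPath]
  | succ t ih =>
    rw [sum_fin_succ_arrow]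
    simp only [answerPath_ofFn_cons]
    rw [← sum_sqNorm_answerStep U ρ (c 0) ψ]
    exact sum_congr rfl fun a _ => ih (fun j => c j.succ) _

theorem measuredProb_ofFn (U : Ch → Circuit M) (ρ : Fin k → M) (check : Ch → Bits k → Bool) {t : ℕ}
    (c : Fin t → Ch) (ψ : QState M) :
    measuredProb U ρ check (List.ofFn c) ψ =
      ∑ z : Fin t → Bits k, if ∀ j, check (c j) (z j) = true then
        sqNorm (answerPath U ρ (List.ofFn fun j => (c j, z j)) ψ) else 0 := by
  induction t generalizing ψ with
  | zero => simp [answerPath, measuredProb]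
  | succ t ih =>
    rw [sum_fin_succ_arrow, List.ofFn_succ, measuredProb]
    refine sum_congr rfl fun a _ => ?_
    simp only [answerPath_ofFn_cons, Fin.forall_fin_succ, Fin.cons_zero, Fin.cons_succ]
    split_ifs with h
    · rw [ih]
      simp [h]
    · simp [h]

end Questioning

/-- The measured questioning of a prover is an efficient test. -/
theorem realizes_measuredProb {M Ch : Type} [Fintype M] [DecidableEq M] {k u B : ℕ}
    (U : Ch → Circuit M) (ρ : Fin k → M) (check : Ch → Bits k → Bool)
    (l : List Ch) (hU : ∀ c ∈ l, (U c).length ≤ u)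
    (hcheck : ∀ c ∈ l, ∃ (V : Type) (_ : Fintype V) (_ : DecidableEq V) (ι : Fin k → V)
      (v : V → Bool) (D : Circuit V) (o : V), Function.Injective ι ∧ (∀ i, v (ι i) = false) ∧
      2 * Fintype.card V + D.length ≤ B ∧
      ∀ z, prob (fun b => b o = check c z) (D.run (ket (Function.extend ι z v))) = 1) :
    ∃ s ≤ Fintype.card M + 2 + l.length * (2 * u + B + 4 * k + 3),
      Realizes (measuredProb U ρ check l) s := by
  induction l with
  | nil => exact ⟨_, by simp, realizes_sqNorm⟩
  | cons c l ih =>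
    obtain ⟨s, hs, h⟩ := ih (fun c hc => hU c (List.mem_cons_of_mem _ hc))
      (fun c hc => hcheck c (List.mem_cons_of_mem _ hc))
    obtain ⟨V, _, _, ι, v, D, o, hι, hv, hB, hD⟩ := hcheck c (List.mem_cons_self ..)
    have hu := hU c (List.mem_cons_self ..)
    refine ⟨_, ?_, ((h.comp_run (U c).inv).sum_measure ρ hι v hv D o (check c) hD).comp_run (U c)⟩
    rw [Circuit.length_inv, List.length_cons]
    nlinarith

/-- If acceptable responses may be measured without an efficient test noticing, the measured and the
unmeasured questioning of a prover succeed with about the same probability. -/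
theorem abs_measuredProb_sub_acceptedProb_le {M Ch : Type} [Fintype M] [DecidableEq M] {k : ℕ}
    (U : Ch → Circuit M) (ρ : Fin k → M) (check : Ch → Bits k → Bool) {κ : ℝ} (hκ : 0 ≤ κ)
    (l : List Ch)
    (h : ∀ l' c, (c :: l') <:+ l → ∀ ψ : QState M,
      |(∑ z, if check c z = true then
          measuredProb U ρ check l' ((U c).inv.run (proj (fun b => b ∘ ρ = z) ψ)) else 0) -
        measuredProb U ρ check l' ((U c).inv.run (proj (fun b => check c (b ∘ ρ) = true) ψ))| ≤
        κ * sqNorm ψ) (ψ : QState M) :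
    |measuredProb U ρ check l ψ - acceptedProb U (fun c b => check c (b ∘ ρ) = true) l ψ| ≤
      l.length * κ * sqNorm ψ := by
  induction l generalizing ψ with
  | nil => simp [measuredProb, acceptedProb]
  | cons c l ih =>
    have h1 := h l c List.suffix_rfl ((U c).run ψ)
    have h2 := ih (fun l' c' hl => h l' c' (hl.trans (List.suffix_cons c l)))
      (acceptStep U (fun c b => check c (b ∘ ρ) = true) c ψ)
    have h3 := sqNorm_acceptStep_le U (fun c b => check c (b ∘ ρ) = true) c ψ
    rw [Circuit.sqNorm_run] at h1
    have h4 : (l.length : ℝ) * κ * sqNorm (acceptStep U (fun c b => check c (b ∘ ρ) = true) c ψ) ≤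
        l.length * κ * sqNorm ψ := mul_le_mul_of_nonneg_left h3 (by positivity)
    rw [List.length_cons, measuredProb, acceptedProb]
    push_cast
    refine (abs_sub_le _ (measuredProb U ρ check l
      (acceptStep U (fun c b => check c (b ∘ ρ) = true) c ψ)) _).trans ?_
    have h1' : |(∑ z, if check c z = true then
        measuredProb U ρ check l (answerStep U ρ c z ψ) else 0) -
        measuredProb U ρ check l (acceptStep U (fun c b => check c (b ∘ ρ) = true) c ψ)| ≤
        κ * sqNorm ψ := h1
    linarith

/-! ### Repeated measurements of a mixture of projections -/

section Rewinding

open scoped InnerProductSpace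

variable {H : Type} [NormedAddCommGroup H] [InnerProductSpace ℂ H] {ι : Type} [Fintype ι]

/-- The average of the squared norm of `P i₁ (P i₂ (⋯ φ))` over sequences of `t` independent
indices. -/
noncomputable def seqAvg (w : ι → ℝ) (P : ι → H →ₗ[ℂ] H) : ℕ → H → ℝ
  | 0, φ => ‖φ‖ ^ 2
  | t + 1, φ => ∑ i, w i * seqAvg w P t (P i φ)

theorem norm_sq_pow_average_le_seqAvg {w : ι → ℝ} (hw0 : ∀ i, 0 ≤ w i) (hw1 : ∑ i, w i = 1)
    (P : ι → H →ₗ[ℂ] H) (t : ℕ) (φ : H) :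
    ‖((∑ i, (w i : ℂ) • P i) ^ t) φ‖ ^ 2 ≤ seqAvg w P t φ := by
  induction t generalizing φ with
  | zero => simp [seqAvg]
  | succ t ih =>
    set A := ∑ i, (w i : ℂ) • P i with hA
    have h1 : (A ^ (t + 1)) φ = ∑ i, (w i : ℂ) • (A ^ t) (P i φ) := by
      have : A φ = ∑ i, (w i : ℂ) • P i φ := by simp [hA, LinearMap.sum_apply]
      rw [pow_succ, Module.End.mul_apply, this, map_sum]
      simp only [map_smul]
    have h2 : ‖∑ i, (w i : ℂ) • (A ^ t) (P i φ)‖ ≤ ∑ i, w i * ‖(A ^ t) (P i φ)‖ := by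
      refine (norm_sum_le _ _).trans (le_of_eq (sum_congr rfl fun i _ => ?_))
      rw [norm_smul, Complex.norm_real, Real.norm_of_nonneg (hw0 i)]
    rw [h1, seqAvg]
    calc _ ≤ (∑ i, w i * ‖(A ^ t) (P i φ)‖) ^ 2 := pow_le_pow_left₀ (norm_nonneg _) h2 2
      _ ≤ ∑ i, w i * ‖(A ^ t) (P i φ)‖ ^ 2 :=
          Real.pow_arith_mean_le_arith_mean_pow _ _ _ (fun i _ => hw0 i) hw1
            (fun i _ => norm_nonneg _) 2
      _ ≤ _ := sum_le_sum fun i _ => mul_le_mul_of_nonneg_left (ih _) (hw0 i)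

/-- The norms of the iterates of a symmetric operator form a log-convex sequence. -/
theorem norm_pow_succ_ge {A : H →ₗ[ℂ] H} (hA : A.IsSymmetric) {φ : H} (hφ : ‖φ‖ ≤ 1) (n : ℕ) :
    ‖A φ‖ * ‖(A ^ n) φ‖ ≤ ‖(A ^ (n + 1)) φ‖ := by
  induction n with
  | zero =>
    simp only [pow_zero, Module.End.one_apply, zero_add, pow_one]
    exact mul_le_of_le_one_right (norm_nonneg _) hφ
  | succ n ih =>
    have h1 : ‖(A ^ (n + 1)) φ‖ ^ 2 ≤ ‖(A ^ n) φ‖ * ‖(A ^ (n + 1 + 1)) φ‖ := by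
      have : (⟪(A ^ (n + 1)) φ, (A ^ (n + 1)) φ⟫_ℂ) = ⟪(A ^ n) φ, (A ^ (n + 1 + 1)) φ⟫_ℂ := by
        rw [pow_succ' A (n + 1), Module.End.mul_apply, ← hA, ← Module.End.mul_apply, ← pow_succ']
      rw [← inner_self_eq_norm_sq (𝕜 := ℂ), this]
      exact (Complex.re_le_norm _).trans (norm_inner_le_norm _ _)
    rcases (norm_nonneg ((A ^ n) φ)).eq_or_lt with h0 | h0
    · have h2 : (A ^ (n + 1)) φ = 0 := by
        rw [pow_succ', Module.End.mul_apply, norm_eq_zero.1 h0.symm, map_zero]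
      rw [h2]; simp
    · have h2 : ‖(A ^ n) φ‖ * (‖A φ‖ * ‖(A ^ (n + 1)) φ‖) ≤
          ‖(A ^ n) φ‖ * ‖(A ^ (n + 1 + 1)) φ‖ := by
        refine le_trans ?_ h1
        rw [pow_two]
        calc _ = (‖A φ‖ * ‖(A ^ n) φ‖) * ‖(A ^ (n + 1)) φ‖ := by ring
          _ ≤ _ := mul_le_mul_of_nonneg_right ih (norm_nonneg _)
      exact le_of_mul_le_mul_left h2 h0

/-- If a random projection succeeds with probability `s`, then a sequence of `t` independent random
projections succeeds with probability at least `s ^ (2 t + 1)`. -/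
theorem pow_le_seqAvg {w : ι → ℝ} (hw0 : ∀ i, 0 ≤ w i) (hw1 : ∑ i, w i = 1)
    {P : ι → H →ₗ[ℂ] H} (hP : ∀ i, (P i).IsSymmetric)
    (hP0 : ∀ i φ, 0 ≤ (⟪φ, P i φ⟫_ℂ).re) (hP1 : ∀ i φ, (⟪φ, P i φ⟫_ℂ).re ≤ ‖φ‖ ^ 2)
    {φ : H} (hφ : ‖φ‖ ≤ 1) (t : ℕ) :
    (∑ i, w i * (⟪φ, P i φ⟫_ℂ).re) ^ (2 * t + 1) ≤ seqAvg w P t φ := by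
  refine le_trans ?_ (norm_sq_pow_average_le_seqAvg hw0 hw1 P t φ)
  set A := ∑ i, (w i : ℂ) • P i with hA
  have hsymm : A.IsSymmetric := by
    intro x y
    simp only [hA, LinearMap.sum_apply, LinearMap.smul_apply, sum_inner, inner_sum,
      inner_smul_left, inner_smul_right, Complex.conj_ofReal]
    exact sum_congr rfl fun i _ => by rw [hP i x y]
  set s := ∑ i, w i * (⟪φ, P i φ⟫_ℂ).re with hs
  have hs0 : 0 ≤ s := sum_nonneg fun i _ => mul_nonneg (hw0 i) (hP0 i φ)
  have hsφ : s ≤ ‖φ‖ ^ 2 := by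
    calc s ≤ ∑ i, w i * ‖φ‖ ^ 2 :=
          sum_le_sum fun i _ => mul_le_mul_of_nonneg_left (hP1 i φ) (hw0 i)
      _ = ‖φ‖ ^ 2 := by rw [← sum_mul, hw1, one_mul]
  have hs1 : s ≤ 1 := hsφ.trans (pow_le_one₀ (norm_nonneg _) hφ)
  have hsA : s = (⟪φ, A φ⟫_ℂ).re := by
    rw [hs, hA, LinearMap.sum_apply, inner_sum, Complex.re_sum]
    simp only [LinearMap.smul_apply, inner_smul_right, Complex.re_ofReal_mul]
  have hAφ : s ≤ ‖A φ‖ := by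
    rw [hsA]
    refine (Complex.re_le_norm _).trans ((norm_inner_le_norm _ _).trans ?_)
    exact mul_le_of_le_one_left (norm_nonneg _) hφ
  rcases Nat.eq_zero_or_pos t with rfl | ht
  · simpa using hsφ
  have hpow : ∀ n, s ^ (n + 1) ≤ ‖(A ^ (n + 1)) φ‖ := by
    intro n
    induction n with
    | zero => simpa using hAφ
    | succ n ih =>
      refine le_trans ?_ (norm_pow_succ_ge hsymm hφ (n + 1))
      rw [pow_succ']
      exact mul_le_mul hAφ ih (pow_nonneg hs0 _) (norm_nonneg _)
  obtain ⟨n, rfl⟩ := Nat.exists_eq_add_of_lt ht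
  rw [zero_add]
  calc s ^ (2 * (n + 1) + 1) ≤ s ^ (2 * (n + 1)) := pow_le_pow_of_le_one hs0 hs1 (Nat.le_succ _)
    _ = (s ^ (n + 1)) ^ 2 := by rw [← pow_mul, mul_comm]
    _ ≤ _ := pow_le_pow_left₀ (pow_nonneg hs0 _) (hpow n) 2

end Rewinding

/-! ### Repeated questioning succeeds with polynomially related probability -/

section Accepted

open scoped InnerProductSpace

variable {M : Type} [Fintype M] [DecidableEq M]

theorem norm_toLp_sq (ψ : QState M) :
    ‖(WithLp.toLp 2 ψ : EuclideanSpace ℂ (M → Bool))‖ ^ 2 = sqNorm ψ := by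
  rw [EuclideanSpace.norm_sq_eq]; rfl

/-- A circuit as a linear isometry. -/
noncomputable def Circuit.toIsometry (C : Circuit M) :
    EuclideanSpace ℂ (M → Bool) →ₗᵢ[ℂ] EuclideanSpace ℂ (M → Bool) where
  toFun ψ := WithLp.toLp 2 (C.run ψ.ofLp)
  map_add' ψ φ := by rw [WithLp.ofLp_add, Circuit.run_add, WithLp.toLp_add]
  map_smul' s ψ := by rw [WithLp.ofLp_smul, Circuit.run_smul, WithLp.toLp_smul]; rfl
  norm_map' ψ := by
    have h : ‖(WithLp.toLp 2 (C.run ψ.ofLp) : EuclideanSpace ℂ (M → Bool))‖ ^ 2 = ‖ψ‖ ^ 2 := by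
      rw [norm_toLp_sq, Circuit.sqNorm_run, ← norm_toLp_sq]
    exact (pow_left_inj₀ (norm_nonneg _) (norm_nonneg _) two_ne_zero).1 h

/-- The projection on the span of the basis vectors in `P`, as a linear map. -/
noncomputable def projLinear (P : (M → Bool) → Prop) :
    EuclideanSpace ℂ (M → Bool) →ₗ[ℂ] EuclideanSpace ℂ (M → Bool) where
  toFun ψ := WithLp.toLp 2 (proj P ψ.ofLp)
  map_add' ψ φ := by
    ext b; by_cases h : P b <;> simp [proj, h]
  map_smul' s ψ := by
    ext b; by_cases h : P b <;> simp [proj, h]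

theorem projLinear_isSymmetric (P : (M → Bool) → Prop) : (projLinear P).IsSymmetric := by
  intro x y
  simp only [PiLp.inner_apply, projLinear]
  refine sum_congr rfl fun b _ => ?_
  by_cases h : P b <;> simp [proj, h]

theorem re_inner_projLinear (P : (M → Bool) → Prop) (x : EuclideanSpace ℂ (M → Bool)) :
    (⟪x, projLinear P x⟫_ℂ).re = prob P x.ofLp := by
  simp only [PiLp.inner_apply, projLinear, Complex.re_sum, prob]
  refine sum_congr rfl fun b _ => ?_
  by_cases h : P b
  · have := inner_self_eq_norm_sq (𝕜 := ℂ) (x.ofLp b)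
    simp only [LinearMap.coe_mk, AddHom.coe_mk, proj, h, if_true]
    exact this
  · simp [proj, h]

/-- If the answer to a random challenge is acceptable with probability `s`, then, when the prover
is asked `t` independent challenges with rewinding, all answers are acceptable with probability at
least `s ^ (2 t + 1)`. -/
theorem pow_le_sum_acceptedProb {Ch : Type} [Fintype Ch] {w : Ch → ℝ} (hw0 : ∀ c, 0 ≤ w c)
    (hw1 : ∑ c, w c = 1) (U : Ch → Circuit M) (P : Ch → (M → Bool) → Prop) {φ : QState M}
    (hφ : sqNorm φ ≤ 1) (t : ℕ) :
    (∑ c, w c * prob (P c) ((U c).run φ)) ^ (2 * t + 1) ≤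
      ∑ c : Fin t → Ch, (∏ j, w (c j)) * acceptedProb U P (List.ofFn c) φ := by
  let A : Ch → EuclideanSpace ℂ (M → Bool) →ₗ[ℂ] EuclideanSpace ℂ (M → Bool) := fun c =>
    (U c).inv.toIsometry.toLinearMap ∘ₗ projLinear (P c) ∘ₗ (U c).toIsometry.toLinearMap
  have hrinv : ∀ c x, (U c).toIsometry ((U c).inv.toIsometry x) = x := fun c x => by
    simp [Circuit.toIsometry, Circuit.run_run_inv]
  have hinner : ∀ c x y, ⟪x, A c y⟫_ℂ =
      ⟪(U c).toIsometry x, projLinear (P c) ((U c).toIsometry y)⟫_ℂ := by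
    intro c x y
    rw [← (U c).toIsometry.inner_map_map x (A c y)]
    exact congrArg _ (hrinv c _)
  have hinner' : ∀ c x y, ⟪A c x, y⟫_ℂ =
      ⟪projLinear (P c) ((U c).toIsometry x), (U c).toIsometry y⟫_ℂ := by
    intro c x y
    rw [← (U c).toIsometry.inner_map_map (A c x) y]
    exact congrArg (fun v => ⟪v, (U c).toIsometry y⟫_ℂ) (hrinv c _)
  have hre : ∀ c x, (⟪x, A c x⟫_ℂ).re = prob (P c) ((U c).run x.ofLp) := by
    intro c x
    rw [hinner, re_inner_projLinear]; rfl
  have hseq : ∀ (t : ℕ) (ψ : QState M), seqAvg w A t (WithLp.toLp 2 ψ) =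
      ∑ c : Fin t → Ch, (∏ j, w (c j)) * acceptedProb U P (List.ofFn c) ψ := by
    intro t
    induction t with
    | zero => intro ψ; simp [seqAvg, acceptedProb, norm_toLp_sq]
    | succ t ih =>
      intro ψ
      rw [sum_fin_succ_arrow, seqAvg]
      refine sum_congr rfl fun c _ => ?_
      have : A c (WithLp.toLp 2 ψ) = WithLp.toLp 2 (acceptStep U P c ψ) := rfl
      rw [this, ih, mul_sum]
      refine sum_congr rfl fun c' _ => ?_
      rw [Fin.prod_univ_succ, List.ofFn_succ, acceptedProb]
      simp [mul_assoc]
  have hnorm : ‖(WithLp.toLp 2 φ : EuclideanSpace ℂ (M → Bool))‖ ≤ 1 := by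
    rw [← norm_toLp_sq] at hφ
    nlinarith [norm_nonneg (WithLp.toLp 2 φ : EuclideanSpace ℂ (M → Bool))]
  have key := pow_le_seqAvg hw0 hw1 (P := A)
    (fun c x y => by rw [hinner, hinner']; exact projLinear_isSymmetric (P c) _ _)
    (fun c x => by rw [hre]; exact prob_nonneg _ _)
    (fun c x => by
      rw [hre]
      refine (prob_le_sqNorm _ _).trans (le_of_eq ?_)
      rw [Circuit.sqNorm_run, ← norm_toLp_sq])
    hnorm t
  rw [hseq] at key
  simpa only [hre] using key

end Accepted

/-! ### The success probability of rewinding, for a given distribution of challenges -/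

/-- Products of distributions with distance `δ` have distance at most `t δ`. -/
theorem sum_abs_prod_sub_prod_le {α : Type} [Fintype α] {D w : α → ℝ} (hD : ∀ a, 0 ≤ D a)
    (hD1 : ∑ a, D a = 1) (hw : ∀ a, 0 ≤ w a) (hw1 : ∑ a, w a = 1) (t : ℕ) :
    ∑ c : Fin t → α, |∏ j, D (c j) - ∏ j, w (c j)| ≤ t * ∑ a, |D a - w a| := by
  induction t with
  | zero => simp
  | succ t ih =>
    have hprod : ∀ n : ℕ, ∑ c : Fin n → α, ∏ j, w (c j) = 1 := fun n => by
      rw [← Fintype.prod_sum]; simp [hw1]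
    rw [sum_fin_succ_arrow]
    calc _ ≤ ∑ a, ∑ c : Fin t → α,
          (D a * |∏ j, D (c j) - ∏ j, w (c j)| + |D a - w a| * ∏ j, w (c j)) := by
          refine sum_le_sum fun a _ => sum_le_sum fun c _ => ?_
          simp only [Fin.prod_univ_succ, Fin.cons_zero, Fin.cons_succ]
          have h1 : D a * ∏ j, D (c j) - w a * ∏ j, w (c j) =
              D a * (∏ j, D (c j) - ∏ j, w (c j)) + (D a - w a) * ∏ j, w (c j) := by ring
          rw [h1]
          refine (abs_add_le _ _).trans ?_
          rw [abs_mul, abs_mul, abs_of_nonneg (hD a),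
            abs_of_nonneg (prod_nonneg fun j _ => hw (c j))]
      _ = ∑ c : Fin t → α, |∏ j, D (c j) - ∏ j, w (c j)| + ∑ a, |D a - w a| := by
          simp only [sum_add_distrib, ← mul_sum, hprod, mul_one, ← sum_mul, hD1, one_mul]
      _ ≤ _ := by push_cast; linarith

section Labels

variable {M Ch Λ : Type} [Fintype M] [DecidableEq M] [Fintype Λ] {k : ℕ}

theorem proj_inv_comm {M : Type} [DecidableEq M] {C : Circuit M} {P : (M → Bool) → Prop}
    (h : ∀ ψ, C.run (proj P ψ) = proj P (C.run ψ)) (ψ : QState M) :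
    C.inv.run (proj P ψ) = proj P (C.inv.run ψ) := by
  rw [← Circuit.run_inv_run C (proj P (C.inv.run ψ)), h, Circuit.run_run_inv]

theorem proj_comm {W : Type} (P Q : (W → Bool) → Prop) (ψ : QState W) :
    proj P (proj Q ψ) = proj Q (proj P ψ) := by
  rw [proj_proj, proj_proj]; exact proj_congr (fun b => and_comm) ψ

theorem answerPath_proj {M Ch Λ : Type} [DecidableEq M] {k : ℕ} {U : Ch → Circuit M}
    {ℓ : (M → Bool) → Λ}
    (hU : ∀ c l ψ, (U c).run (proj (fun b => ℓ b = l) ψ) = proj (fun b => ℓ b = l) ((U c).run ψ))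
    (ρ : Fin k → M) (l : Λ) (p : List (Ch × Bits k)) (ψ : QState M) :
    answerPath U ρ p (proj (fun b => ℓ b = l) ψ) =
      proj (fun b => ℓ b = l) (answerPath U ρ p ψ) := by
  induction p generalizing ψ with
  | nil => rfl
  | cons a p ih =>
    have : answerStep U ρ a.1 a.2 (proj (fun b => ℓ b = l) ψ) =
        proj (fun b => ℓ b = l) (answerStep U ρ a.1 a.2 ψ) := by
      rw [answerStep, hU, proj_comm, proj_inv_comm (hU a.1 l)]; rfl
    show answerPath U ρ p (answerStep U ρ a.1 a.2 _) = _
    rw [this, ih]; rfl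

theorem acceptedProb_eq_sum_labels {U : Ch → Circuit M} {ℓ : (M → Bool) → Λ}
    (hU : ∀ c l ψ, (U c).run (proj (fun b => ℓ b = l) ψ) = proj (fun b => ℓ b = l) ((U c).run ψ))
    (ρ : Fin k → M) (check : Λ → Ch → Bits k → Bool)
    (p : List Ch) (ψ : QState M) :
    acceptedProb U (fun c b => check (ℓ b) c (b ∘ ρ) = true) p ψ =
      ∑ l, acceptedProb U (fun c b => check l c (b ∘ ρ) = true) p
        (proj (fun b => ℓ b = l) ψ) := by
  induction p generalizing ψ with
  | nil => exact (sum_sqNorm_proj ℓ ψ).symm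
  | cons c p ih =>
    simp only [acceptedProb]
    rw [ih]
    refine sum_congr rfl fun l _ => ?_
    congr 1
    rw [acceptStep, acceptStep, ← proj_inv_comm (hU c l), hU, proj_proj, proj_proj]
    congr 1
    refine proj_congr (fun b => ?_) _
    constructor
    · rintro ⟨h1, h2⟩; exact ⟨by rwa [h1] at h2, h1⟩
    · rintro ⟨h1, h2⟩; exact ⟨h2, by rwa [h2]⟩

theorem acceptedProb_zero {M Ch : Type} [Fintype M] [DecidableEq M] (U : Ch → Circuit M)
    (P : Ch → (M → Bool) → Prop) (p : List Ch) : acceptedProb U P p 0 = 0 := by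
  induction p with
  | nil => simp [acceptedProb, sqNorm]
  | cons c p ih =>
    rw [acceptedProb, acceptStep, Circuit.run_zero, proj_zero, Circuit.run_zero, ih]

theorem sum_mul_norm_sq_eq_sum_labels (ℓ : (M → Bool) → Λ) (f : Λ → ℝ) (ψ : QState M) :
    ∑ b, f (ℓ b) * ‖ψ b‖ ^ 2 = ∑ l, f l * sqNorm (proj (fun b => ℓ b = l) ψ) := by
  classical
  simp only [sqNorm, mul_sum]
  rw [sum_comm]
  refine sum_congr rfl fun b _ => ?_
  rw [sum_eq_single (ℓ b)]
  · simp [proj]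
  · intro a _ ha
    simp [proj, ha.symm]
  · simp

open scoped Classical in
/-- A lower bound for the probability that the rewinding extractor finds accepted responses to `t`
random challenges from which a witness can be computed. The first message (and the instance) is the
label `ℓ`, and `fail l c z` is the probability that no witness is found from the challenges `c` and
the responses `z`. -/
theorem pow_sub_le_sum_answerPath [Fintype Ch] {U : Ch → Circuit M} {ℓ : (M → Bool) → Λ}
    (hU : ∀ c l ψ, (U c).run (proj (fun b => ℓ b = l) ψ) = proj (fun b => ℓ b = l) ((U c).run ψ))
    {w : Ch → ℝ} (hw0 : ∀ c, 0 ≤ w c)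
    (hw1 : ∑ c, w c = 1) (ρ : Fin k → M) (check : Λ → Ch → Bits k → Bool) {t : ℕ}
    {fail : Λ → (Fin t → Ch) → (Fin t → Bits k) → ℝ}
    (hfail1 : ∀ l c z, fail l c z ≤ 1) (I : Set Λ) {κ μ : ℝ}
    (hκ : ∀ l ∈ I, ∀ c : Fin t → Ch, (∀ j, w (c j) ≠ 0) → ∀ ψ,
      |measuredProb U ρ (check l) (List.ofFn c) ψ -
        acceptedProb U (fun c b => check l c (b ∘ ρ) = true) (List.ofFn c) ψ| ≤ κ * sqNorm ψ)
    (hκ0 : 0 ≤ κ) (hμ0 : 0 ≤ μ)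
    (hμ : ∀ l ∈ I, ∀ ζ : (Fin t → Ch) → Fin t → Bits k, ∑ c : Fin t → Ch,
      (∏ j, w (c j)) * (if ∀ j, check l (c j) (ζ c j) = true then fail l c (ζ c) else 0) ≤ μ)
    {φ : QState M} (hφ : sqNorm φ = 1) :
    (∑ c, w c * prob (fun b => ℓ b ∈ I ∧ check (ℓ b) c (b ∘ ρ) = true) ((U c).run φ)) ^ (2 * t + 1)
        - κ - μ ≤
      ∑ c : Fin t → Ch, (∏ j, w (c j)) * ∑ z : Fin t → Bits k, ∑ b,
        (if ℓ b ∈ I then 1 - fail (ℓ b) c z else 0) *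
          ‖answerPath U ρ (List.ofFn fun j => (c j, z j)) φ b‖ ^ 2 := by
  have hprod0 : ∀ c : Fin t → Ch, 0 ≤ ∏ j, w (c j) := fun c => prod_nonneg fun j _ => hw0 (c j)
  have hprod1 : ∑ c : Fin t → Ch, ∏ j, w (c j) = 1 := by
    rw [← Fintype.prod_sum]; simp [hw1]
  set N : Λ → ℝ := fun l => sqNorm (proj (fun b => ℓ b = l) φ) with hN
  have hN0 : ∀ l, 0 ≤ N l := fun l => sqNorm_nonneg _
  have hN1 : ∑ l, N l = 1 := by rw [hN, sum_sqNorm_proj, hφ]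
  set p : (Fin t → Ch) → (Fin t → Bits k) → Λ → ℝ := fun c z l =>
    sqNorm (answerPath U ρ (List.ofFn fun j => (c j, z j)) (proj (fun b => ℓ b = l) φ)) with hp
  have hp0 : ∀ c z l, 0 ≤ p c z l := fun c z l => sqNorm_nonneg _
  have hpsum : ∀ c l, ∑ z, p c z l = N l := fun c l => sum_sqNorm_answerPath U ρ c _
  set IF : Finset Λ := univ.filter fun l => l ∈ I with hIF
  have hIFmem : ∀ l ∈ IF, l ∈ I := fun l hl => (mem_filter.1 hl).2
  have hNI : ∑ l ∈ IF, N l ≤ 1 := by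
    rw [← hN1]; exact sum_le_sum_of_subset_of_nonneg (subset_univ _) fun l _ _ => hN0 l
  -- the unmeasured questioning, label by label
  have hideal : (∑ c, w c * prob (fun b => ℓ b ∈ I ∧ check (ℓ b) c (b ∘ ρ) = true)
      ((U c).run φ)) ^ (2 * t + 1) ≤ ∑ c : Fin t → Ch, (∏ j, w (c j)) * ∑ l ∈ IF,
        acceptedProb U (fun c b => check l c (b ∘ ρ) = true) (List.ofFn c)
          (proj (fun b => ℓ b = l) φ) := by
    set φI := proj (fun b => ℓ b ∈ I) φ with hφI
    have hφI1 : sqNorm φI ≤ 1 := by rw [← hφ]; exact sqNorm_proj_le _ _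
    have hlab : ∀ l, proj (fun b => ℓ b = l) φI =
        if l ∈ I then proj (fun b => ℓ b = l) φ else 0 := by
      intro l
      rw [hφI, proj_proj]
      split_ifs with hl
      · exact proj_congr (fun b => ⟨fun h => h.1, fun h => ⟨h, by rwa [h]⟩⟩) φ
      · exact proj_false (fun b (h : ℓ b = l ∧ ℓ b ∈ I) => hl (h.1 ▸ h.2)) φ
    have hUI : ∀ c, (U c).run φI = proj (fun b => ℓ b ∈ I) ((U c).run φ) := by
      intro c
      have hdec : ∀ ψ : QState M, proj (fun b => ℓ b ∈ I) ψ =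
          ∑ l ∈ IF, proj (fun b => ℓ b = l) ψ := by
        intro ψ
        funext b
        rw [Finset.sum_apply]
        by_cases hb : ℓ b ∈ I
        · rw [sum_eq_single (ℓ b)]
          · simp [proj, hb]
          · intro l _ hl; simp [proj, hl.symm]
          · intro h; exact absurd (mem_filter.2 ⟨mem_univ _, hb⟩) h
        · rw [sum_eq_zero]
          · simp [proj, hb]
          · intro l hl
            have : ℓ b ≠ l := fun h => hb (h ▸ hIFmem l hl)
            simp [proj, this]
      have hrunsum : ∀ (s : Finset Λ) (f : Λ → QState M),
          (U c).run (∑ l ∈ s, f l) = ∑ l ∈ s, (U c).run (f l) := by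
        intro s f
        induction s using Finset.induction_on with
        | empty => simp
        | insert a s ha ih => rw [sum_insert ha, sum_insert ha, Circuit.run_add, ih]
      rw [hφI, hdec, hdec, hrunsum]
      exact sum_congr rfl fun l _ => hU c l φ
    have key := pow_le_sum_acceptedProb hw0 hw1 U
      (fun c b => check (ℓ b) c (b ∘ ρ) = true) hφI1 t
    have hs : ∀ c, prob (fun b => check (ℓ b) c (b ∘ ρ) = true) ((U c).run φI) =
        prob (fun b => ℓ b ∈ I ∧ check (ℓ b) c (b ∘ ρ) = true) ((U c).run φ) := by
      intro c
      rw [hUI, prob_eq_sqNorm_proj, proj_proj, prob_eq_sqNorm_proj]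
      congr 1
      exact proj_congr (fun b => and_comm) _
    simp only [hs] at key
    refine key.trans (le_of_eq (sum_congr rfl fun c _ => ?_))
    congr 1
    rw [acceptedProb_eq_sum_labels hU, hIF, sum_filter]
    refine sum_congr rfl fun l _ => ?_
    rw [hlab]
    split_ifs
    · rfl
    · exact acceptedProb_zero _ _ _
  -- the responses that are not useful
  have hbad : ∀ l ∈ IF, ∑ c : Fin t → Ch, (∏ j, w (c j)) *
      ∑ z : Fin t → Bits k, (if ∀ j, check l (c j) (z j) = true then fail l c z else 0) * p c z l ≤
        μ * N l := by
    intro l hl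
    have hmax : ∀ c : Fin t → Ch, ∃ ζ : Fin t → Bits k, ∀ z : Fin t → Bits k,
        (if ∀ j, check l (c j) (z j) = true then fail l c z else 0) ≤
          if ∀ j, check l (c j) (ζ j) = true then fail l c ζ else 0 := fun c =>
      Finite.exists_max fun z : Fin t → Bits k =>
        if ∀ j, check l (c j) (z j) = true then fail l c z else 0
    choose ζ hζ using hmax
    refine le_trans ?_ (mul_le_mul_of_nonneg_right (hμ l (hIFmem l hl) ζ) (hN0 l))
    rw [sum_mul]
    refine sum_le_sum fun c _ => ?_
    rw [mul_assoc]
    refine mul_le_mul_of_nonneg_left ?_ (hprod0 c)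
    rw [← hpsum c l, mul_sum]
    exact sum_le_sum fun z _ => mul_le_mul_of_nonneg_right (hζ c z) (hp0 c z l)
  -- the useful responses
  have hgood : ∀ c : Fin t → Ch, (∏ j, w (c j)) * (∑ l ∈ IF,
        (acceptedProb U (fun c b => check l c (b ∘ ρ) = true) (List.ofFn c)
          (proj (fun b => ℓ b = l) φ) - κ * N l -
        ∑ z : Fin t → Bits k,
          (if ∀ j, check l (c j) (z j) = true then fail l c z else 0) * p c z l)) ≤
      (∏ j, w (c j)) * ∑ z : Fin t → Bits k, ∑ b,
        (if ℓ b ∈ I then 1 - fail (ℓ b) c z else 0) *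
          ‖answerPath U ρ (List.ofFn fun j => (c j, z j)) φ b‖ ^ 2 := by
    intro c
    by_cases hc : ∀ j, w (c j) ≠ 0
    swap
    · push Not at hc
      obtain ⟨j, hj⟩ := hc
      rw [prod_eq_zero (mem_univ j) hj]; simp
    refine mul_le_mul_of_nonneg_left ?_ (hprod0 c)
    have hrw : ∀ z : Fin t → Bits k, ∑ b, (if ℓ b ∈ I then 1 - fail (ℓ b) c z else 0) *
          ‖answerPath U ρ (List.ofFn fun j => (c j, z j)) φ b‖ ^ 2 =
        ∑ l ∈ IF, (1 - fail l c z) * p c z l := by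
      intro z
      rw [sum_mul_norm_sq_eq_sum_labels ℓ fun l => if l ∈ I then 1 - fail l c z else 0,
        hIF, sum_filter]
      refine sum_congr rfl fun l _ => ?_
      rw [← answerPath_proj hU]
      split_ifs <;> simp [hp]
    simp only [hrw]
    rw [sum_comm]
    refine sum_le_sum fun l hl => ?_
    have h1 := hκ l (hIFmem l hl) c hc (proj (fun b => ℓ b = l) φ)
    rw [measuredProb_ofFn, abs_le] at h1
    have h2 : ∑ z : Fin t → Bits k, ((if ∀ j, check l (c j) (z j) = true then p c z l else 0) -
          (if ∀ j, check l (c j) (z j) = true then fail l c z else 0) * p c z l) ≤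
        ∑ z : Fin t → Bits k, (1 - fail l c z) * p c z l := by
      refine sum_le_sum fun z _ => ?_
      have := hp0 c z l
      have := hfail1 l c z
      split_ifs
      · linarith
      · rw [zero_mul, sub_zero]
        exact mul_nonneg (by linarith) (hp0 c z l)
    rw [sum_sub_distrib] at h2
    have h3 := h1.2
    linarith [h1.1]
  refine le_trans ?_ (sum_le_sum fun c _ => hgood c)
  simp only [sum_sub_distrib, mul_sub]
  have hbad' : ∑ c : Fin t → Ch, (∏ j, w (c j)) * ∑ l ∈ IF, ∑ z : Fin t → Bits k,
      (if ∀ j, check l (c j) (z j) = true then fail l c z else 0) * p c z l ≤ μ := by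
    simp only [mul_sum (s := IF)]
    rw [sum_comm]
    calc _ ≤ ∑ l ∈ IF, μ * N l := sum_le_sum hbad
      _ = μ * ∑ l ∈ IF, N l := by rw [mul_sum]
      _ ≤ μ := mul_le_of_le_one_right hμ0 hNI
  have hκ' : ∑ c : Fin t → Ch, (∏ j, w (c j)) * ∑ l ∈ IF, κ * N l ≤ κ := by
    rw [← sum_mul, hprod1, one_mul, ← mul_sum]
    exact mul_le_of_le_one_right hκ0 hNI
  linarith

end Labels

/-! ### Questioning a malicious prover -/

theorem card_wire_le (t s : ℕ) (L : Sizes) (m : ℕ) :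
    Fintype.card (Wire t s L m) ≤
      Fintype.card (Reg t s) * (L.inst + L.wit + L.com + L.chal + L.resp + m) := by
  rw [Fintype.card_sigma, ← smul_eq_mul, ← Finset.card_univ]
  refine sum_le_card_nsmul _ _ _ fun r _ => ?_
  rw [Fintype.card_fin]
  cases r <;> simp only [regLen] <;> omega

section RegisterWires

variable {t s : ℕ} {L : Sizes} {m : ℕ}

/-- The qubits of the single registers. -/
def instWire (i : Fin L.inst) : Wire t s L m := ⟨.inst, i⟩

def witWire (i : Fin L.wit) : Wire t s L m := ⟨.wit, i⟩

def comWire (i : Fin L.com) : Wire t s L m := ⟨.com, i⟩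

def chalWire (j : Fin t) (i : Fin L.chal) : Wire t s L m := ⟨.chal j, i⟩

def respWire (j : Fin t) (i : Fin L.resp) : Wire t s L m := ⟨.resp j, i⟩

theorem instWire_injective : Function.Injective (instWire : Fin L.inst → Wire t s L m) :=
  fun _ _ h => eq_of_heq (Sigma.mk.inj_iff.1 h).2

theorem witWire_injective : Function.Injective (witWire : Fin L.wit → Wire t s L m) :=
  fun _ _ h => eq_of_heq (Sigma.mk.inj_iff.1 h).2

theorem comWire_injective : Function.Injective (comWire : Fin L.com → Wire t s L m) :=
  fun _ _ h => eq_of_heq (Sigma.mk.inj_iff.1 h).2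

theorem chalWire_injective (j : Fin t) :
    Function.Injective (chalWire j : Fin L.chal → Wire t s L m) :=
  fun _ _ h => eq_of_heq (Sigma.mk.inj_iff.1 h).2

theorem respWire_injective (j : Fin t) :
    Function.Injective (respWire j : Fin L.resp → Wire t s L m) :=
  fun _ _ h => eq_of_heq (Sigma.mk.inj_iff.1 h).2

end RegisterWires

theorem extend_respWire_loaded {s : ℕ} {L : Sizes} {m : ℕ} (x : Bits L.inst) (a : Bits L.com)
    (c : Fin 1 → Bits L.chal) (z : Bits L.resp) :
    Function.extend (respWire 0) z (loaded x a c fun _ _ => false) =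
      (loaded x a c fun _ => z : Wire 1 s L m → Bool) := by
  funext w
  by_cases hr : ∃ i, respWire 0 i = w
  · obtain ⟨i, rfl⟩ := hr
    exact (respWire_injective 0).extend_apply _ _ _
  · rw [Function.extend_apply' _ _ _ hr]
    rcases w with ⟨r, i⟩
    cases r with
    | resp j => exact absurd ⟨i, by rw [Subsingleton.elim j 0]; rfl⟩ hr
    | _ => rfl

/-- The first message together with the instance. -/
def firstMessage {L : Sizes} {n : ℕ} (b : ProverWire L n → Bool) : Bits L.inst × Bits L.com :=
  (instOf (b ∘ Sum.inr), comOf (b ∘ Sum.inr))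

/-- The qubits of the response register of a prover. -/
def proverResp {L : Sizes} {n : ℕ} (i : Fin L.resp) : ProverWire L n := Sum.inr (respWire 0 i)

/-- The qubits of the challenge register of a prover. -/
def proverChal {L : Sizes} {n : ℕ} (i : Fin L.chal) : ProverWire L n := Sum.inr (chalWire 0 i)

/-- The challenge `c` in the challenge register. -/
def chalMask {L : Sizes} {n : ℕ} (c : Bits L.chal) : ProverWire L n → Bool
  | Sum.inr ⟨.chal _, i⟩ => c i
  | _ => false

theorem sendChallenge_eq_shift {L : Sizes} {n : ℕ} (c : Bits L.chal)
    (ψ : QState (ProverWire L n)) : sendChallenge c ψ = shift (chalMask c) ψ := by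
  funext b
  simp only [sendChallenge, shift]
  congr 1
  funext w
  rcases w with w | ⟨r, i⟩
  · simp [chalMask]
  · cases r <;> simp [chalMask]

namespace MaliciousProver

variable {S : Set (Reg 1 0)} {L : Sizes}

/-- The circuit that hands over the challenge `c` and runs the second stage. -/
noncomputable def ask (A : MaliciousProver S L) (c : Bits L.chal) : Circuit (ProverWire L A.n) :=
  Circuit.flips (chalMask c) ++ A.stage2

theorem run_ask (A : MaliciousProver S L) (c : Bits L.chal) (ψ : QState (ProverWire L A.n)) :
    (A.ask c).run ψ = A.stage2.run (sendChallenge c ψ) := by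
  rw [ask, Circuit.run_append, Circuit.run_flips, sendChallenge_eq_shift]

theorem run_ask_inv (A : MaliciousProver S L) (c : Bits L.chal) (ψ : QState (ProverWire L A.n)) :
    (A.ask c).inv.run ψ = shift (chalMask c) (A.stage2.inv.run ψ) := by
  have h : ψ = (A.ask c).run (shift (chalMask c) (A.stage2.inv.run ψ)) := by
    rw [run_ask, sendChallenge_eq_shift, shift_shift, Circuit.run_run_inv]
  conv_lhs => rw [h]
  rw [Circuit.run_inv_run]

theorem length_ask_le (A : MaliciousProver S L) (c : Bits L.chal) :
    (A.ask c).length ≤ Fintype.card (ProverWire L A.n) + A.stage2.length := by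
  rw [ask, List.length_append]
  exact Nat.add_le_add_right (Circuit.length_flips _) _

theorem ask_within (A : MaliciousProver S L) (c : Bits L.chal) :
    (A.ask c).Within (Accessible {Reg.chal 0, Reg.resp 0}) := by
  intro g hg
  rcases List.mem_append.1 hg with hg | hg
  · simp only [Circuit.flips, List.mem_map, Finset.mem_toList, mem_filter, mem_univ,
      true_and] at hg
    obtain ⟨w, hw, rfl⟩ := hg
    intro w' hw'
    simp only [Gate.wires, List.mem_singleton] at hw'
    subst hw'
    rcases w' with w | ⟨r, i⟩
    · trivial
    · cases r <;> simp only [chalMask, Bool.false_eq_true] at hw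
      rename_i j
      exact Or.inl (by rw [Subsingleton.elim j 0])
  · exact A.stage2_within g hg

theorem firstMessage_update {n : ℕ} {w : ProverWire L n}
    (hw : Accessible {Reg.chal 0, Reg.resp 0} w) (b : ProverWire L n → Bool) (x : Bool) :
    firstMessage (Function.update b w x) = firstMessage b := by
  have h : ∀ r : Reg 1 0, r = .inst ∨ r = .com → ∀ i, Function.update b w x (Sum.inr ⟨r, i⟩) =
      b (Sum.inr ⟨r, i⟩) := by
    intro r hr i
    apply Function.update_of_ne
    rintro rfl
    rcases hr with rfl | rfl <;> simp [Accessible] at hw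
  simp only [firstMessage, Prod.mk.injEq]
  exact ⟨funext fun i => h .inst (Or.inl rfl) i, funext fun i => h .com (Or.inr rfl) i⟩

theorem run_ask_proj (A : MaliciousProver S L) (c : Bits L.chal) (l : Bits L.inst × Bits L.com)
    (ψ : QState (ProverWire L A.n)) :
    (A.ask c).run (proj (fun b => firstMessage b = l) ψ) =
      proj (fun b => firstMessage b = l) ((A.ask c).run ψ) :=
  Circuit.run_proj_comm (A.ask_within c) _
    (fun b w x hw => by rw [firstMessage_update hw]) ψ

end MaliciousProver

namespace SigmaProtocol

variable {Pi : SigmaProtocol}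

/-- The collapsing property turns into indistinguishability of the measured and the unmeasured
questioning, uniformly for all provers of a given polynomial size. -/
theorem QuantumUniqueResponses.exists_questioning_bound (hresp : Pi.QuantumUniqueResponses)
    (hV : Pi.EfficientVerifier) (t : ℕ) (q : Polynomial ℕ) :
    ∃ κ : ℕ → ℝ, Negligible κ ∧ (∀ η, 0 ≤ κ η) ∧ ∀ η, ∀ x ∈ Pi.instances η,
      ∀ (S : Set (Reg 1 0)) (A : MaliciousProver S (Pi.size η)), A.size ≤ q.eval η →
      ∀ (a : Bits (Pi.size η).com) (c : Fin t → Bits (Pi.size η).chal),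
        (∀ j, c j ∈ Pi.challenges η) → ∀ ψ,
        |measuredProb A.ask proverResp (Pi.verify η x a) (List.ofFn c) ψ -
          acceptedProb A.ask (fun c b => Pi.verify η x a c (b ∘ proverResp) = true)
            (List.ofFn c) ψ| ≤ κ η * sqNorm ψ := by
  obtain ⟨qs, hqs⟩ := hV.polySize
  obtain ⟨qv, hqv⟩ := hV.polyVerifiable
  set r0 : Polynomial ℕ := Polynomial.C (Fintype.card (Reg 1 0)) with hr0
  set r1 : Polynomial ℕ := Polynomial.C (Fintype.card (Reg 1 1)) with hr1
  -- bounds for the number of qubits of the prover, the length of `ask`, and the verification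
  set m : Polynomial ℕ := q + r0 * qs with hm
  set B : Polynomial ℕ := 2 * (r1 * (qs + qv)) + qv with hB
  obtain ⟨κ, hκ, hκ0, hκA⟩ := hresp.exists_uniform_bound
    (m + 2 + Polynomial.C t * (2 * (m + q) + B + 4 * qs + 3) + (m + q) + 3 * qs)
  refine ⟨fun η => t * κ η, SuperpolynomialDecay.const_mul hκ t,
    fun η => mul_nonneg (Nat.cast_nonneg _) (hκ0 η), ?_⟩
  intro η x hx S A hA a c hc ψ
  have hsize := hqs η
  have hM : Fintype.card (ProverWire (Pi.size η) A.n) ≤ m.eval η := by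
    have h1 := card_wire_le 1 0 (Pi.size η) 0
    have h2 : Fintype.card (Reg 1 0) * ((Pi.size η).inst + (Pi.size η).wit + (Pi.size η).com +
      (Pi.size η).chal + (Pi.size η).resp + 0) ≤ Fintype.card (Reg 1 0) * qs.eval η :=
      Nat.mul_le_mul_left _ hsize
    have h3 : A.n ≤ A.size := by rw [MaliciousProver.size]; omega
    rw [Fintype.card_sum, Fintype.card_fin]
    simp only [hm, hr0, Polynomial.eval_add, Polynomial.eval_mul, Polynomial.eval_C]
    omega
  have hask : ∀ c, (A.ask c).length ≤ (m + q).eval η := by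
    intro c
    have h1 := A.length_ask_le c
    have h2 : A.stage2.length ≤ A.size := by rw [MaliciousProver.size]; omega
    rw [Polynomial.eval_add]
    omega
  have hcheck : ∀ c ∈ Pi.challenges η, ∃ (V : Type) (_ : Fintype V) (_ : DecidableEq V)
      (ι : Fin (Pi.size η).resp → V) (v : V → Bool) (D : Circuit V) (o : V),
      Function.Injective ι ∧ (∀ i, v (ι i) = false) ∧
      2 * Fintype.card V + D.length ≤ B.eval η ∧
      ∀ z, prob (fun b => b o = Pi.verify η x a c z)
        (D.run (ket (Function.extend ι z v))) = 1 := by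
    intro c hc
    obtain ⟨k, D, o, hk, hD⟩ := hqv η
    refine ⟨Wire 1 1 (Pi.size η) k, inferInstance, inferInstance, respWire 0,
      loaded x a (fun _ => c) (fun _ _ => false), D, o, respWire_injective 0, fun i => rfl, ?_,
      fun z => ?_⟩
    · have h1 := card_wire_le 1 1 (Pi.size η) k
      have h2 : Fintype.card (Reg 1 1) * ((Pi.size η).inst + (Pi.size η).wit + (Pi.size η).com +
        (Pi.size η).chal + (Pi.size η).resp + k) ≤
          Fintype.card (Reg 1 1) * (qs.eval η + qv.eval η) :=
        Nat.mul_le_mul_left _ (by omega)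
      simp only [hB, hr1, Polynomial.eval_add, Polynomial.eval_mul, Polynomial.eval_C,
        Polynomial.eval_ofNat]
      omega
    · rw [extend_respWire_loaded]
      exact hD x hx a c hc z
  have key := abs_measuredProb_sub_acceptedProb_le A.ask proverResp (Pi.verify η x a) (hκ0 η)
    (List.ofFn c) (fun l' c' hl ψ' => ?_) ψ
  · rw [List.length_ofFn] at key
    exact key
  · have hmem : ∀ d ∈ c' :: l', d ∈ Pi.challenges η := by
      intro d hd
      obtain ⟨j, rfl⟩ := (List.mem_ofFn' c d).1 (hl.subset hd)
      exact hc j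
    have hlen : l'.length ≤ t := by
      have := hl.length_le
      rw [List.length_ofFn, List.length_cons] at this
      omega
    obtain ⟨s, hs, hT⟩ := realizes_measuredProb A.ask proverResp (Pi.verify η x a) l'
      (fun c _ => hask c) (fun d hd => hcheck d (hmem d (List.mem_cons_of_mem _ hd)))
    refine abs_sum_measure_sub_le (hκA η x hx) (hT.comp_run (A.ask c').inv) ?_ proverResp a
      (hmem c' (List.mem_cons_self ..)) ψ'
    rw [Circuit.length_inv]
    have h1 := hask c'
    have h2 : l'.length * (2 * (m + q).eval η + B.eval η + 4 * (Pi.size η).resp + 3) ≤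
        t * (2 * (m + q).eval η + B.eval η + 4 * qs.eval η + 3) :=
      Nat.mul_le_mul hlen (by omega)
    simp only [Polynomial.eval_ofNat, Polynomial.eval_add, Polynomial.eval_mul,
      Polynomial.eval_C] at h1 h2 hs hM ⊢
    omega

/-- The uniform distribution on the challenges. -/
noncomputable def challengeWeight (Pi : SigmaProtocol) (η : ℕ) (c : Bits (Pi.size η).chal) : ℝ :=
  open scoped Classical in if c ∈ Pi.challenges η then 1 / ((Pi.challenges η).card : ℝ) else 0

theorem challengeWeight_nonneg (η : ℕ) (c : Bits (Pi.size η).chal) :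
    0 ≤ Pi.challengeWeight η c := by
  rw [challengeWeight]; split_ifs <;> positivity

theorem sum_challengeWeight_mul (η : ℕ) (f : Bits (Pi.size η).chal → ℝ) :
    ∑ c, Pi.challengeWeight η c * f c = (∑ c ∈ Pi.challenges η, f c) / (Pi.challenges η).card := by
  classical
  simp only [challengeWeight, ite_mul, zero_mul, sum_ite_mem, univ_inter]
  rw [← mul_sum]; ring

theorem sum_challengeWeight (η : ℕ) : ∑ c, Pi.challengeWeight η c = 1 := by
  have h := sum_challengeWeight_mul (Pi := Pi) η fun _ => 1
  have hc : ((Pi.challenges η).card : ℝ) ≠ 0 := by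
    exact_mod_cast (Pi.challenges_nonempty η).card_ne_zero
  simpa [hc] using h

theorem sum_prod_challengeWeight_mul (η t : ℕ) (f : (Fin t → Bits (Pi.size η).chal) → ℝ) :
    ∑ c : Fin t → Bits (Pi.size η).chal, (∏ j, Pi.challengeWeight η (c j)) * f c =
      (∑ c ∈ Fintype.piFinset (fun _ : Fin t => Pi.challenges η), f c) /
        ((Pi.challenges η).card : ℝ) ^ t := by
  classical
  have h : ∀ c : Fin t → Bits (Pi.size η).chal, ∏ j, Pi.challengeWeight η (c j) =
      if c ∈ Fintype.piFinset (fun _ : Fin t => Pi.challenges η) then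
        1 / ((Pi.challenges η).card : ℝ) ^ t else 0 := by
    intro c
    by_cases hc : ∀ j, c j ∈ Pi.challenges η
    · rw [if_pos (Fintype.mem_piFinset.2 hc)]
      simp [challengeWeight, hc]
    · rw [if_neg (mt Fintype.mem_piFinset.1 hc)]
      push Not at hc
      obtain ⟨j, hj⟩ := hc
      exact prod_eq_zero (mem_univ j) (by rw [challengeWeight, if_neg hj])
  simp only [h, ite_mul, zero_mul, sum_ite_mem, univ_inter]
  rw [← mul_sum]; ring

theorem failProb_le_one {t : ℕ} (E : QAlg Empty t) (η : ℕ) (x : Bits (Pi.size η).inst)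
    (a : Bits (Pi.size η).com) (c : Fin t → Bits (Pi.size η).chal)
    (z : Fin t → Bits (Pi.size η).resp) : Pi.failProb E η x a c z ≤ 1 := by
  refine (prob_le_sqNorm _ _).trans (le_of_eq ?_)
  rw [Circuit.sqNorm_run, sqNorm_ket]

theorem failProb_nonneg {t : ℕ} (E : QAlg Empty t) (η : ℕ) (x : Bits (Pi.size η).inst)
    (a : Bits (Pi.size η).com) (c : Fin t → Bits (Pi.size η).chal)
    (z : Fin t → Bits (Pi.size η).resp) : 0 ≤ Pi.failProb E η x a c z := prob_nonneg _ _

open scoped Classical in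
/-- The probability that the rewinding extractor succeeds if its first state is `φ` and it asks
the challenges `c`: all possible responses `z` and first messages are summed over. -/
noncomputable def rewindingProb (Pi : SigmaProtocol) {t : ℕ} (E : QAlg Empty t) (η : ℕ)
    {S : Set (Reg 1 0)} (A : MaliciousProver S (Pi.size η)) (I : Set (Bits (Pi.size η).inst))
    (φ : QState (ProverWire (Pi.size η) A.n)) (c : Fin t → Bits (Pi.size η).chal) : ℝ :=
  ∑ z : Fin t → Bits (Pi.size η).resp, ∑ b,
    (if (firstMessage b).1 ∈ I then
      1 - Pi.failProb E η (firstMessage b).1 (firstMessage b).2 c z else 0) *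
      ‖answerPath A.ask proverResp (List.ofFn fun j => (c j, z j)) φ b‖ ^ 2

theorem rewindingProb_nonneg {t : ℕ} (E : QAlg Empty t) (η : ℕ)
    {S : Set (Reg 1 0)} (A : MaliciousProver S (Pi.size η)) (I : Set (Bits (Pi.size η).inst))
    (φ : QState (ProverWire (Pi.size η) A.n)) (c : Fin t → Bits (Pi.size η).chal) :
    0 ≤ Pi.rewindingProb E η A I φ c := by
  refine sum_nonneg fun z _ => sum_nonneg fun b _ => mul_nonneg ?_ (by positivity)
  have := Pi.failProb_le_one E η (firstMessage b).1 (firstMessage b).2 c z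
  split_ifs <;> linarith

theorem rewindingProb_le {t : ℕ} (E : QAlg Empty t) (η : ℕ)
    {S : Set (Reg 1 0)} (A : MaliciousProver S (Pi.size η)) (I : Set (Bits (Pi.size η).inst))
    (φ : QState (ProverWire (Pi.size η) A.n)) (c : Fin t → Bits (Pi.size η).chal) :
    Pi.rewindingProb E η A I φ c ≤ sqNorm φ := by
  rw [← sum_sqNorm_answerPath A.ask proverResp c φ]
  refine sum_le_sum fun z _ => sum_le_sum fun b _ => mul_le_of_le_one_left (by positivity) ?_
  have := Pi.failProb_nonneg E η (firstMessage b).1 (firstMessage b).2 c z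
  split_ifs <;> linarith

/-- Rewinding with nearly uniform challenges extracts a witness with a probability that is
polynomially related to the success probability of the prover. -/
theorem TSound.exists_rewinding_bound (hV : Pi.EfficientVerifier)
    (hresp : Pi.QuantumUniqueResponses) {t : ℕ} {E : QAlg Empty t} {μ : ℕ → ℝ}
    (hμ : Negligible μ)
    (hE : ∀ η, ∀ x ∈ Pi.instances η, ∀ a : Bits (Pi.size η).com,
      ∀ ζ : (Fin t → Bits (Pi.size η).chal) → Fin t → Bits (Pi.size η).resp,
        (∑ c ∈ Fintype.piFinset (fun _ : Fin t => Pi.challenges η),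
          open scoped Classical in
          if Pi.AllAccepted η x a c (ζ c) then Pi.failProb E η x a c (ζ c) else 0) /
            ((Pi.challenges η).card : ℝ) ^ t ≤ μ η)
    {D : (η : ℕ) → Bits (Pi.size η).chal → ℝ} (hD0 : ∀ η c, 0 ≤ D η c)
    (hD1 : ∀ η, ∑ c, D η c = 1)
    (hD : Negligible fun η => ∑ c, |D η c - Pi.challengeWeight η c|) (q : Polynomial ℕ) :
    ∃ κ : ℕ → ℝ, Negligible κ ∧ ∀ η (S : Set (Reg 1 0)) (A : MaliciousProver S (Pi.size η)),
      A.size ≤ q.eval η → ∀ I ⊆ Pi.instances η, ∀ φ, sqNorm φ = 1 →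
      ((∑ c ∈ Pi.challenges η, prob (fun b => (firstMessage b).1 ∈ I ∧
          Pi.verify η (firstMessage b).1 (firstMessage b).2 c (b ∘ proverResp) = true)
          ((A.ask c).run φ)) / (Pi.challenges η).card) ^ (2 * t + 1) - κ η ≤
        ∑ c : Fin t → Bits (Pi.size η).chal, (∏ j, D η (c j)) * Pi.rewindingProb E η A I φ c := by
  classical
  obtain ⟨κ, hκ, hκ0, hκA⟩ := hresp.exists_questioning_bound hV t q
  have hμabs : Negligible fun η => |μ η| := hμ.of_abs_le fun η => (abs_abs _).le
  refine ⟨fun η => κ η + |μ η| + t * ∑ c, |D η c - Pi.challengeWeight η c|,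
    (SuperpolynomialDecay.add (SuperpolynomialDecay.add hκ hμabs)
      (SuperpolynomialDecay.const_mul hD t)), ?_⟩
  intro η S A hA I hI φ hφ
  have key := pow_sub_le_sum_answerPath (U := A.ask) (ℓ := firstMessage) A.run_ask_proj
    (Pi.challengeWeight_nonneg η) (Pi.sum_challengeWeight η) proverResp
    (fun l => Pi.verify η l.1 l.2) (t := t) (fail := fun l c z => Pi.failProb E η l.1 l.2 c z)
    (fun l c z => Pi.failProb_le_one E η l.1 l.2 c z) {l | l.1 ∈ I} (κ := κ η) (μ := |μ η|)
    (fun l hl c hc ψ => hκA η l.1 (hI hl) S A hA l.2 c (fun j => by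
      by_contra h
      exact hc j (by rw [challengeWeight, if_neg h])) ψ)
    (hκ0 η) (abs_nonneg _)
    (fun l hl ζ => by
      rw [sum_prod_challengeWeight_mul]
      refine le_trans (le_of_eq ?_) ((hE η l.1 (hI hl) l.2 ζ).trans (le_abs_self _))
      refine congrArg (· / _) (sum_congr rfl fun c _ => ?_)
      by_cases h : Pi.AllAccepted η l.1 l.2 c (ζ c)
      · rw [if_pos h]; exact if_pos h
      · rw [if_neg h]; exact if_neg h) hφ
  rw [sum_challengeWeight_mul] at key
  have hswap : ∑ c : Fin t → Bits (Pi.size η).chal, (∏ j, Pi.challengeWeight η (c j)) *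
      Pi.rewindingProb E η A I φ c - ∑ c : Fin t → Bits (Pi.size η).chal, (∏ j, D η (c j)) *
      Pi.rewindingProb E η A I φ c ≤ t * ∑ c, |D η c - Pi.challengeWeight η c| := by
    refine le_trans ?_ (sum_abs_prod_sub_prod_le (hD0 η) (hD1 η) (Pi.challengeWeight_nonneg η)
      (Pi.sum_challengeWeight η) t)
    rw [← sum_sub_distrib]
    refine sum_le_sum fun c _ => ?_
    rw [← sub_mul, abs_sub_comm]
    refine (le_abs_self _).trans ?_
    rw [abs_mul]
    refine mul_le_of_le_one_right (abs_nonneg _) ?_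
    rw [abs_of_nonneg (Pi.rewindingProb_nonneg E η A I φ c), ← hφ]
    exact Pi.rewindingProb_le E η A I φ c
  have key' : _ ≤ ∑ c : Fin t → Bits (Pi.size η).chal, (∏ j, Pi.challengeWeight η (c j)) *
      Pi.rewindingProb E η A I φ c := key
  simp only [Set.mem_ofPred_eq] at key'
  linarith

end SigmaProtocol

/-! ### The circuit of the extractor -/

section ExtractorCircuit

variable {t : ℕ} {L : Sizes} {n : ℕ}

/-- The qubits that record the responses, and those of `t` copies of the sampler of challenges. -/
abbrev RecordWire (t : ℕ) (L : Sizes) (DW : Type) : Type := (Fin t × Fin L.resp) ⊕ (Fin t × DW)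

/-- The `j`-th recorded response. -/
def recordedResp {DW : Type} (r : RecordWire t L DW → Bool) (j : Fin t) : Bits L.resp :=
  fun i => r (Sum.inl (j, i))

/-- The `j`-th sampled challenge. -/
def sampledChal {s m : ℕ} (r : RecordWire t L (Wire 1 s L m) → Bool) (j : Fin t) : Bits L.chal :=
  fun i => r (Sum.inr (j, chalWire 0 i))

/-- Run `t` copies of the sampler. -/
def samplingCircuit {M DW : Type} (t : ℕ) (L : Sizes) (D : Circuit DW) :
    Circuit (M ⊕ RecordWire t L DW) :=
  (List.finRange t).flatMap fun j => D.relabel fun w => Sum.inr (Sum.inr (j, w))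

/-- Ask the `j`-th sampled challenge, record the response, and rewind. -/
def rewindingStep {s m : ℕ} (C : Circuit (ProverWire L n)) (j : Fin t) :
    Circuit (ProverWire L n ⊕ RecordWire t L (Wire 1 s L m)) :=
  Circuit.copy (fun i => Sum.inr (Sum.inr (j, chalWire 0 i))) (fun i => Sum.inl (proverChal i)) ++
  (C.relabel Sum.inl ++
  (Circuit.copy (fun i => Sum.inl (proverResp i)) (fun i => Sum.inr (Sum.inl (j, i))) ++
  (C.inv.relabel Sum.inl ++
  Circuit.copy (fun i => Sum.inr (Sum.inr (j, chalWire 0 i))) (fun i => Sum.inl (proverChal i)))))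

theorem run_samplingCircuit {M DW : Type} [DecidableEq M] [DecidableEq DW] (D : Circuit DW)
    (φ : QState M) :
    (samplingCircuit t L D).run (withKet φ fun _ => false) =
      glue fun r : RecordWire t L DW → Bool =>
        (ket (fun _ => false) (fun i => r (Sum.inl i)) *
          ∏ j, D.run (ket fun _ => false) (fun w => r (Sum.inr (j, w)))) • φ := by
  classical
  have key : ∀ l : List (Fin t), l.Nodup →
      Circuit.run (l.flatMap fun j => D.relabel fun w => Sum.inr (Sum.inr (j, w)))
        (withKet φ fun _ => false) = glue fun r : RecordWire t L DW → Bool =>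
        (ket (fun _ => false) (fun i => r (Sum.inl i)) *
          ∏ j, (if j ∈ l then D.run (ket fun _ => false) else ket fun _ => false)
            (fun w => r (Sum.inr (j, w)))) • φ := by
    intro l
    induction l using List.reverseRecOn with
    | nil =>
      intro _
      rw [List.flatMap_nil, Circuit.run_nil, withKet_eq_glue]
      congr 1
      funext r
      congr 1
      simp only [List.not_mem_nil, if_false]
      by_cases hr : r = fun _ => false
      · subst hr; simp [ket]
      · rw [ket, if_neg hr]
        by_cases h1 : (fun i => r (Sum.inl i)) = fun _ => false
        · have : ∃ j w, r (Sum.inr (j, w)) ≠ false := by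
            by_contra h2
            push Not at h2
            apply hr
            funext i
            rcases i with i | ⟨j, w⟩
            · exact congrFun h1 i
            · exact h2 j w
          obtain ⟨j, w, hjw⟩ := this
          rw [prod_eq_zero (mem_univ j), mul_zero]
          rw [ket, if_neg]
          intro h2
          exact hjw (congrFun h2 w)
        · rw [ket, if_neg h1, zero_mul]
    | append_singleton l j ih =>
      intro hl
      have hj : j ∉ l := fun h => by
        have := List.nodup_append.1 hl
        exact this.2.2 j h j (List.mem_singleton_self j) rfl
      rw [List.flatMap_append, Circuit.run_append, ih (List.nodup_append.1 hl).1]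
      simp only [List.flatMap_cons, List.flatMap_nil, List.append_nil]
      have hinj : Function.Injective
          (fun w : DW => (Sum.inr (Sum.inr (j, w)) : M ⊕ RecordWire t L DW)) := by
        intro w w' h
        simpa using h
      funext b
      rw [Circuit.run_relabel hinj]
      set r := b ∘ Sum.inr with hr
      -- the part of the amplitude that does not depend on the `j`-th sampler
      set A : ℂ := ket (fun _ => false) (fun i => r (Sum.inl i)) *
        (∏ j' ∈ univ.erase j, (if j' ∈ l then D.run (ket fun _ => false) else ket fun _ => false)
            (fun w => r (Sum.inr (j', w)))) * φ (b ∘ Sum.inl) with hA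
      have h1 : (fun v => (glue fun r : RecordWire t L DW → Bool =>
          (ket (fun _ => false) (fun i => r (Sum.inl i)) *
          ∏ j, (if j ∈ l then D.run (ket fun _ => false) else ket fun _ => false)
            (fun w => r (Sum.inr (j, w)))) • φ)
            (Function.extend
              (fun w : DW => (Sum.inr (Sum.inr (j, w)) : M ⊕ RecordWire t L DW)) v b))
          = A • ket fun _ => false := by
        funext v
        set b' := Function.extend (fun w : DW => (Sum.inr (Sum.inr (j, w)) : M ⊕ RecordWire t L DW))
          v b with hb'
        have e1 : b' ∘ Sum.inl = b ∘ Sum.inl := by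
          funext w; exact Function.extend_apply' _ _ _ (by simp)
        have e2 : (fun i => b' (Sum.inr (Sum.inl i))) = fun i => r (Sum.inl i) := by
          funext w; exact Function.extend_apply' _ _ _ (by simp)
        have e3 : ∀ j', j' ≠ j → (fun w => b' (Sum.inr (Sum.inr (j', w)))) =
            fun w => r (Sum.inr (j', w)) := by
          intro j' hj'
          funext w
          exact Function.extend_apply' _ _ _ (by rintro ⟨a, ha⟩; simp at ha; exact hj' ha.1.symm)
        have e4 : (fun w => b' (Sum.inr (Sum.inr (j, w)))) = v := by
          funext w; exact hinj.extend_apply _ _ _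
        simp only [glue, Pi.smul_apply, smul_eq_mul, Function.comp_apply, e1, e2, hA]
        rw [← mul_prod_erase univ _ (mem_univ j), e4, if_neg hj]
        rw [prod_congr rfl fun j' hj' => by rw [e3 j' (ne_of_mem_erase hj')]]
        ring
      rw [h1, Circuit.run_smul]
      simp only [glue, Pi.smul_apply, smul_eq_mul, hA]
      rw [← mul_prod_erase univ _ (mem_univ j), if_pos (by simp)]
      have hprod : ∏ j' ∈ univ.erase j, (if j' ∈ l ++ [j] then D.run (ket fun _ => false)
          else ket fun _ => false) (fun w => r (Sum.inr (j', w))) =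
          ∏ j' ∈ univ.erase j, (if j' ∈ l then D.run (ket fun _ => false)
          else ket fun _ => false) (fun w => r (Sum.inr (j', w))) := by
        refine prod_congr rfl fun j' hj' => ?_
        have : j' ∈ l ++ [j] ↔ j' ∈ l := by simp [ne_of_mem_erase hj']
        by_cases h : j' ∈ l
        · rw [if_pos h, if_pos (this.2 h)]
        · rw [if_neg h, if_neg (mt this.1 h)]
      rw [hprod]
      simp only [hr, Function.comp_def]
      ring
  have h := key (List.finRange t) (List.nodup_finRange t)
  simpa [samplingCircuit] using h

theorem extend_proverChal (c : Bits L.chal) :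
    Function.extend (proverChal : Fin L.chal → ProverWire L n) c (fun _ => false) =
      chalMask c := by
  have hinj : Function.Injective (proverChal : Fin L.chal → ProverWire L n) := fun i j h =>
    chalWire_injective 0 (Sum.inr_injective h)
  funext w
  by_cases h : ∃ i, proverChal i = w
  · obtain ⟨i, rfl⟩ := h
    rw [hinj.extend_apply]; rfl
  · rw [Function.extend_apply' _ _ _ h]
    rcases w with w | ⟨r, i⟩
    · rfl
    · cases r with
      | chal j => exact absurd ⟨i, by rw [Subsingleton.elim j 0]; rfl⟩ h
      | _ => rfl

theorem run_rewindingSteps {S : Set (Reg 1 0)} {s m : ℕ} (A : MaliciousProver S L)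
    (δ : (RecordWire t L (Wire 1 s L m) → Bool) → ℂ)
    (hδ : ∀ r r', (∀ w, r (Sum.inr w) = r' (Sum.inr w)) → δ r = δ r')
    (φ : QState (ProverWire L A.n)) :
    Circuit.run ((List.finRange t).flatMap fun j => rewindingStep A.stage2 j)
      (glue fun r => (ket (fun _ => false) (fun i => r (Sum.inl i)) * δ r) • φ) =
    glue fun r => δ r • answerPath A.ask proverResp
      (List.ofFn fun j => (sampledChal r j, recordedResp r j)) φ := by
  classical
  have key : ∀ l : List (Fin t), l.Nodup →
      Circuit.run (l.flatMap fun j => rewindingStep A.stage2 j)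
        (glue fun r => (ket (fun _ => false) (fun i => r (Sum.inl i)) * δ r) • φ) =
      glue fun r => if ∀ j, j ∉ l → recordedResp r j = fun _ => false then
        δ r • answerPath A.ask proverResp
          (l.map fun j => (sampledChal r j, recordedResp r j)) φ else 0 := by
    intro l
    induction l using List.reverseRecOn with
    | nil =>
      intro _
      rw [List.flatMap_nil, Circuit.run_nil]
      congr 1
      funext r
      have : (∀ j, j ∉ ([] : List (Fin t)) → recordedResp r j = fun _ => false) ↔
          (fun i => r (Sum.inl i)) = fun _ => false := by
        constructor
        · intro h; funext ⟨j, i⟩; exact congrFun (h j (by simp)) i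
        · intro h j _; funext i; exact congrFun h (j, i)
      by_cases h : (fun i => r (Sum.inl i)) = fun _ => false
      · rw [if_pos (this.2 h), ket, if_pos h, one_mul]; rfl
      · rw [if_neg (mt this.1 h), ket, if_neg h, zero_mul, zero_smul]
    | append_singleton l j ih =>
      intro hl
      have hj : j ∉ l := fun h => by
        have := List.nodup_append.1 hl
        exact this.2.2 j h j (List.mem_singleton_self j) rfl
      rw [List.flatMap_append, Circuit.run_append, ih (List.nodup_append.1 hl).1]
      simp only [List.flatMap_cons, List.flatMap_nil, List.append_nil, rewindingStep,
        Circuit.run_append]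
      have hinj1 : Function.Injective (proverChal : Fin L.chal → ProverWire L A.n) := fun i j h =>
        chalWire_injective 0 (Sum.inr_injective h)
      have hinj2 : Function.Injective
          (fun i : Fin L.resp => (Sum.inl (j, i) : RecordWire t L (Wire 1 s L m))) := by
        intro i i' h
        simpa using h
      have hmask : ∀ r : RecordWire t L (Wire 1 s L m) → Bool,
          Function.extend (proverChal : Fin L.chal → ProverWire L A.n)
            (fun i => r (Sum.inr (j, chalWire 0 i))) (fun _ => false) =
          chalMask (sampledChal r j) := fun r => extend_proverChal _
      rw [run_copy_inr_inl _ hinj1]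
      simp only [hmask]
      rw [run_inl_glue]
      simp only [← sendChallenge_eq_shift, ← A.run_ask]
      rw [run_copy_inl_inr proverResp hinj2, run_inl_glue, run_copy_inr_inl _ hinj1]
      simp only [hmask, ← A.run_ask_inv]
      congr 1
      funext r
      set r' : (ProverWire L A.n → Bool) → RecordWire t L (Wire 1 s L m) → Bool := fun b =>
        Function.extend (fun i : Fin L.resp => (Sum.inl (j, i) : RecordWire t L (Wire 1 s L m)))
          (fun i => xor (r (Sum.inl (j, i))) (b (proverResp i))) r with hr'
      have e1 : ∀ b w, r' b (Sum.inr w) = r (Sum.inr w) := fun b w =>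
        Function.extend_apply' _ _ _ (by simp)
      have e2 : ∀ b j', sampledChal (r' b) j' = sampledChal r j' := fun b j' =>
        funext fun i => e1 b _
      have e3 : ∀ b j', j' ≠ j → recordedResp (r' b) j' = recordedResp r j' := fun b j' hj' =>
        funext fun i => by
          show r' b (Sum.inl (j', i)) = r (Sum.inl (j', i))
          exact Function.extend_apply' _ _ _
            (by rintro ⟨a, ha⟩; simp at ha; exact hj' ha.1.symm)
      have e4 : ∀ b, recordedResp (r' b) j = (fun _ => false) ↔
          b ∘ proverResp = recordedResp r j := by
        intro b
        have : ∀ i, recordedResp (r' b) j i = xor (recordedResp r j i) (b (proverResp i)) :=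
          fun i => by
            show r' b (Sum.inl (j, i)) = _
            exact hinj2.extend_apply _ _ _
        rw [funext_iff, funext_iff]
        refine forall_congr' fun i => ?_
        rw [this, bne_eq_false_iff_eq]
        exact eq_comm
      have e5 : ∀ b, δ (r' b) = δ r := fun b => hδ _ _ (e1 b)
      have e6 : ∀ b, answerPath A.ask proverResp
          (l.map fun j => (sampledChal (r' b) j, recordedResp (r' b) j)) φ =
          answerPath A.ask proverResp
          (l.map fun j => (sampledChal r j, recordedResp r j)) φ := by
        intro b
        congr 1
        refine List.map_congr_left fun j' hj' => ?_
        rw [e2, e3 b j' (fun h => hj (h ▸ hj'))]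
      have e7 : ∀ b, (∀ j', j' ∉ l → recordedResp (r' b) j' = fun _ => false) ↔
          (∀ j', j' ∉ l ++ [j] → recordedResp r j' = fun _ => false) ∧
            b ∘ proverResp = recordedResp r j := by
        intro b
        rw [← e4 b]
        constructor
        · intro h
          refine ⟨fun j' hj' => ?_, h j hj⟩
          rw [List.mem_append, List.mem_singleton, not_or] at hj'
          rw [← e3 b j' hj'.2]
          exact h j' hj'.1
        · rintro ⟨h1, h2⟩ j' hj'
          by_cases hjj : j' = j
          · rw [hjj]; exact h2
          · rw [e3 b j' hjj]
            exact h1 j' (by simp [hj', hjj])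
      have hpath : answerPath A.ask proverResp
          ((l ++ [j]).map fun j => (sampledChal r j, recordedResp r j)) φ =
          answerStep A.ask proverResp (sampledChal r j) (recordedResp r j)
            (answerPath A.ask proverResp
              (l.map fun j => (sampledChal r j, recordedResp r j)) φ) := by
        simp [answerPath]
      rw [hpath]
      have hif : ∀ b, (A.ask (sampledChal (r' b) j)).run
          (if ∀ j', j' ∉ l → recordedResp (r' b) j' = fun _ => false then
            δ (r' b) • answerPath A.ask proverResp
              (l.map fun j => (sampledChal (r' b) j, recordedResp (r' b) j)) φ else 0) b =
          (if ∀ j', j' ∉ l ++ [j] → recordedResp r j' = fun _ => false then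
            δ r • proj (fun b => b ∘ proverResp = recordedResp r j)
              ((A.ask (sampledChal r j)).run (answerPath A.ask proverResp
              (l.map fun j => (sampledChal r j, recordedResp r j)) φ)) else 0) b := by
        intro b
        rw [e2, e6, e5]
        by_cases h1 : ∀ j', j' ∉ l ++ [j] → recordedResp r j' = fun _ => false
        · rw [if_pos h1]
          by_cases h2 : b ∘ proverResp = recordedResp r j
          · rw [if_pos ((e7 b).2 ⟨h1, h2⟩), Circuit.run_smul]
            simp [proj, h2]
          · rw [if_neg (fun h => h2 ((e7 b).1 h).2), Circuit.run_zero]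
            simp [proj, h2]
        · rw [if_neg h1, if_neg (fun h => h1 ((e7 b).1 h).1), Circuit.run_zero]
      refine (congrArg (A.ask (sampledChal r j)).inv.run (funext hif)).trans ?_
      split_ifs with h
      · rw [Circuit.run_smul]; rfl
      · rw [Circuit.run_zero]
  have h := key (List.finRange t) (List.nodup_finRange t)
  rw [h]
  congr 1
  funext r
  rw [if_pos (fun j hj => absurd (List.mem_finRange j) hj), ← List.ofFn_eq_map]

end ExtractorCircuit

section LoadCircuit

variable {t : ℕ} {L : Sizes} {n : ℕ}

section Loaded

variable {s m : ℕ}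

theorem extend_instWire_loaded (x x' : Bits L.inst) (a : Bits L.com) (c : Fin t → Bits L.chal)
    (z : Fin t → Bits L.resp) :
    Function.extend instWire x' (loaded x a c z) = (loaded x' a c z : Wire t s L m → Bool) := by
  funext w
  by_cases h : ∃ i, instWire i = w
  · obtain ⟨i, rfl⟩ := h
    exact instWire_injective.extend_apply _ _ _
  · rw [Function.extend_apply' _ _ _ h]
    rcases w with ⟨r, i⟩
    cases r with
    | inst => exact absurd ⟨i, rfl⟩ h
    | _ => rfl

theorem extend_comWire_loaded (x : Bits L.inst) (a a' : Bits L.com) (c : Fin t → Bits L.chal)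
    (z : Fin t → Bits L.resp) :
    Function.extend comWire a' (loaded x a c z) = (loaded x a' c z : Wire t s L m → Bool) := by
  funext w
  by_cases h : ∃ i, comWire i = w
  · obtain ⟨i, rfl⟩ := h
    exact comWire_injective.extend_apply _ _ _
  · rw [Function.extend_apply' _ _ _ h]
    rcases w with ⟨r, i⟩
    cases r with
    | com => exact absurd ⟨i, rfl⟩ h
    | _ => rfl

theorem extend_chalWire_loaded (x : Bits L.inst) (a : Bits L.com) (c : Fin t → Bits L.chal)
    (z : Fin t → Bits L.resp) (j : Fin t) (c' : Bits L.chal) :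
    Function.extend (chalWire j) c' (loaded x a c z) =
      (loaded x a (Function.update c j c') z : Wire t s L m → Bool) := by
  funext w
  by_cases h : ∃ i, chalWire j i = w
  · obtain ⟨i, rfl⟩ := h
    rw [(chalWire_injective j).extend_apply]
    simp [chalWire, loaded]
  · rw [Function.extend_apply' _ _ _ h]
    rcases w with ⟨r, i⟩
    cases r with
    | chal j' =>
      have : j' ≠ j := by rintro rfl; exact h ⟨i, rfl⟩
      simp [loaded, this]
    | _ => rfl

theorem extend_respWire_loaded_update (x : Bits L.inst) (a : Bits L.com) (c : Fin t → Bits L.chal)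
    (z : Fin t → Bits L.resp) (j : Fin t) (z' : Bits L.resp) :
    Function.extend (respWire j) z' (loaded x a c z) =
      (loaded x a c (Function.update z j z') : Wire t s L m → Bool) := by
  funext w
  by_cases h : ∃ i, respWire j i = w
  · obtain ⟨i, rfl⟩ := h
    rw [(respWire_injective j).extend_apply]
    simp [respWire, loaded]
  · rw [Function.extend_apply' _ _ _ h]
    rcases w with ⟨r, i⟩
    cases r with
    | resp j' =>
      have : j' ≠ j := by rintro rfl; exact h ⟨i, rfl⟩
      simp [loaded, this]
    | _ => rfl

end Loaded

/-- Copy the contents of the qubits `x`, `a`, `c j` and `z j` to the input registers of the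
algorithm that computes a witness. -/
def loadCircuit {X : Type} {s m : ℕ} (x : Fin L.inst → X) (a : Fin L.com → X)
    (c : Fin t → Fin L.chal → X) (z : Fin t → Fin L.resp → X) :
    Circuit (X ⊕ Wire t s L m) :=
  Circuit.copy (fun i => Sum.inl (x i)) (fun i => Sum.inr (instWire i)) ++
  (Circuit.copy (fun i => Sum.inl (a i)) (fun i => Sum.inr (comWire i)) ++
  (((List.finRange t).flatMap fun j =>
    Circuit.copy (fun i => Sum.inl (c j i)) (fun i => Sum.inr (chalWire j i))) ++
  ((List.finRange t).flatMap fun j =>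
    Circuit.copy (fun i => Sum.inl (z j i)) (fun i => Sum.inr (respWire j i)))))

theorem run_loadCircuit {X : Type} [DecidableEq X] {s m : ℕ} (x : Fin L.inst → X)
    (a : Fin L.com → X) (c : Fin t → Fin L.chal → X) (z : Fin t → Fin L.resp → X) (ψ : QState X) :
    (loadCircuit x a c z : Circuit (X ⊕ Wire t s L m)).run (withKet ψ fun _ => false) =
      tagged (fun b => loaded (b ∘ x) (b ∘ a) (fun j => b ∘ c j) (fun j => b ∘ z j)) ψ := by
  have h0 : (fun _ => false : Wire t s L m → Bool) =
      loaded (fun _ => false) (fun _ => false) (fun _ _ => false) (fun _ _ => false) := by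
    funext w; rcases w with ⟨r, i⟩; cases r <;> rfl
  have hc : ∀ l : List (Fin t), l.Nodup →
      Circuit.run (l.flatMap fun j =>
        Circuit.copy (fun i => Sum.inl (c j i)) (fun i => Sum.inr (chalWire j i)))
        (tagged (fun b => (loaded (b ∘ x) (b ∘ a) (fun _ _ => false) (fun _ _ => false) :
          Wire t s L m → Bool)) ψ) =
      tagged (fun b => loaded (b ∘ x) (b ∘ a) (fun j => if j ∈ l then b ∘ c j else fun _ => false)
        (fun _ _ => false)) ψ := by
    intro l
    induction l using List.reverseRecOn with
    | nil => intro _; simp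
    | append_singleton l j ih =>
      intro hl
      have hj : j ∉ l := fun h => by
        have := List.nodup_append.1 hl
        exact this.2.2 j h j (List.mem_singleton_self j) rfl
      rw [List.flatMap_append, Circuit.run_append, ih (List.nodup_append.1 hl).1]
      simp only [List.flatMap_cons, List.flatMap_nil, List.append_nil]
      rw [run_copy_tagged (c j) (chalWire_injective j)]
      congr 1
      funext b
      rw [extend_chalWire_loaded]
      congr 1
      funext j'
      by_cases h : j' = j
      · subst h
        rw [Function.update_self]
        funext i
        simp [chalWire, loaded, hj]
      · rw [Function.update_of_ne h]
        simp [h]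
  have hz : ∀ l : List (Fin t), l.Nodup →
      Circuit.run (l.flatMap fun j =>
        Circuit.copy (fun i => Sum.inl (z j i)) (fun i => Sum.inr (respWire j i)))
        (tagged (fun b => (loaded (b ∘ x) (b ∘ a) (fun j => b ∘ c j) (fun _ _ => false) :
          Wire t s L m → Bool)) ψ) =
      tagged (fun b => loaded (b ∘ x) (b ∘ a) (fun j => b ∘ c j)
        (fun j => if j ∈ l then b ∘ z j else fun _ => false)) ψ := by
    intro l
    induction l using List.reverseRecOn with
    | nil => intro _; simp
    | append_singleton l j ih =>
      intro hl
      have hj : j ∉ l := fun h => by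
        have := List.nodup_append.1 hl
        exact this.2.2 j h j (List.mem_singleton_self j) rfl
      rw [List.flatMap_append, Circuit.run_append, ih (List.nodup_append.1 hl).1]
      simp only [List.flatMap_cons, List.flatMap_nil, List.append_nil]
      rw [run_copy_tagged (z j) (respWire_injective j)]
      congr 1
      funext b
      rw [extend_respWire_loaded_update]
      congr 1
      funext j'
      by_cases h : j' = j
      · subst h
        rw [Function.update_self]
        funext i
        simp [respWire, loaded, hj]
      · rw [Function.update_of_ne h]
        simp [h]
  have hc' := hc _ (List.nodup_finRange t)
  have hz' := hz _ (List.nodup_finRange t)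
  simp only [List.mem_finRange, if_true] at hc' hz'
  rw [loadCircuit, Circuit.run_append, Circuit.run_append, Circuit.run_append, h0,
    withKet_eq_tagged, run_copy_tagged x instWire_injective]
  simp only [extend_instWire_loaded]
  rw [run_copy_tagged a comWire_injective]
  simp only [extend_comWire_loaded]
  have e1 : ∀ b : X → Bool, (fun i => xor ((loaded (fun _ => false) (fun _ => false)
      (fun _ _ => false) (fun _ _ => false) : Wire t s L m → Bool) (instWire i)) (b (x i))) =
      b ∘ x := fun b => funext fun i => by simp [instWire, loaded]
  have e2 : ∀ (b : X → Bool) y, (fun i => xor ((loaded y (fun _ => false)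
      (fun _ _ => false) (fun _ _ => false) : Wire t s L m → Bool) (comWire i)) (b (a i))) =
      b ∘ a := fun b y => funext fun i => by simp [comWire, loaded]
  simp only [e1, e2]
  rw [hc', hz']

end LoadCircuit

section ExtractorCircuit

variable {t : ℕ} {L : Sizes} {n sD mD sE mE : ℕ}

/-- The qubits of the prover, and those that record challenges and responses. -/
abbrev QuestioningWire (t : ℕ) (L : Sizes) (n sD mD : ℕ) : Type :=
  ProverWire L n ⊕ RecordWire t L (Wire 1 sD L mD)

/-- The qubits of the extractor and the prover: those of the prover, those that record challenges
and responses, and those of the algorithm that computes a witness. -/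
abbrev ExtractorWire (t : ℕ) (L : Sizes) (n sD mD sE mE : ℕ) : Type :=
  QuestioningWire t L n sD mD ⊕ Wire t sE L mE

/-- The part of the extractor that questions the prover. -/
def questioningCircuit (t : ℕ) (C₁ C₂ : Circuit (ProverWire L n)) (D : Circuit (Wire 1 sD L mD)) :
    Circuit (QuestioningWire t L n sD mD) :=
  C₁.relabel Sum.inl ++ (samplingCircuit t L D ++
    (List.finRange t).flatMap fun j => rewindingStep C₂ j)

/-- The extractor: `C₁` and `C₂` are the stages of the prover, `D` samples a challenge, and `E`
computes a witness from accepted responses. -/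
def extractorCircuit (C₁ C₂ : Circuit (ProverWire L n)) (D : Circuit (Wire 1 sD L mD))
    (E : Circuit (Wire t sE L mE)) : Circuit (ExtractorWire t L n sD mD sE mE) :=
  (questioningCircuit t C₁ C₂ D).relabel Sum.inl ++
  (loadCircuit (fun i => Sum.inl (Sum.inr (instWire i))) (fun i => Sum.inl (Sum.inr (comWire i)))
    (fun j i => Sum.inr (Sum.inr (j, chalWire 0 i))) (fun j i => Sum.inr (Sum.inl (j, i))) ++
  (E.relabel Sum.inr ++
  Circuit.copy (fun i => Sum.inr (witWire i)) (fun i => Sum.inl (Sum.inl (Sum.inr (witWire i))))))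

/-- The amplitude of the samples in a record. -/
noncomputable def sampleAmplitude (D : Circuit (Wire 1 sD L mD))
    (r : RecordWire t L (Wire 1 sD L mD) → Bool) : ℂ :=
  ∏ j, D.run (ket fun _ => false) (fun w => r (Sum.inr (j, w)))

theorem run_questioningCircuit {S : Set (Reg 1 0)} (A : MaliciousProver S L)
    (D : Circuit (Wire 1 sD L mD)) (ψ : QState (ProverWire L A.n)) :
    (questioningCircuit t A.stage1 A.stage2 D).run (withKet ψ fun _ => false) =
      glue fun r => sampleAmplitude D r • answerPath A.ask proverResp
        (List.ofFn fun j => (sampledChal r j, recordedResp r j)) (A.stage1.run ψ) := by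
  rw [questioningCircuit, Circuit.run_append, Circuit.run_append, run_inl_withKet,
    run_samplingCircuit]
  exact run_rewindingSteps A (sampleAmplitude D)
    (fun r r' h => prod_congr rfl fun j _ => by simp only [h]) _

/-- The contents of the witness register of the prover. -/
def proverWit {n : ℕ} (b : ProverWire L n → Bool) : Bits L.wit := witOf (b ∘ Sum.inr)

theorem proverWit_update {n : ℕ} {S : Set (Reg 1 0)} (hS : Reg.wit ∉ S) {w : ProverWire L n}
    (hw : Accessible S w) (b : ProverWire L n → Bool) (x : Bool) :
    proverWit (Function.update b w x) = proverWit b := by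
  funext i
  refine Function.update_of_ne ?_ _ _
  rintro rfl
  exact hS hw

/-- The witness register stays empty while the prover is questioned. -/
theorem proverWit_eq_of_answerPath_ne_zero {S : Set (Reg 1 0)} (hS : Reg.wit ∉ S)
    (A : MaliciousProver S L) (x : Bits L.inst) (p : List (Bits L.chal × Bits L.resp))
    {b : ProverWire L A.n → Bool}
    (h : answerPath A.ask proverResp p (A.stage1.run (withKet A.state (loadedInst x))) b ≠ 0) :
    proverWit b = fun _ => false := by
  have h1 : withKet A.state (loadedInst x) =
      proj (fun b : ProverWire L A.n → Bool => proverWit b = fun _ => false)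
        (withKet A.state (loadedInst x)) := by
    funext b
    by_cases hb : (fun w => b (Sum.inr w)) = (loadedInst x : Wire 1 0 L 0 → Bool)
    · have : proverWit b = fun _ => false := by
        funext i; exact congrFun hb ⟨.wit, i⟩
      simp [proj, this]
    · have : withKet A.state (loadedInst x) b = 0 := by
        rw [withKet, ket, if_neg hb, mul_zero]
      simp [proj, this]
  rw [h1, Circuit.run_proj_comm A.stage1_within _
    (fun b w x hw => by rw [proverWit_update hS hw]),
    answerPath_proj (ℓ := proverWit) (fun c l ψ => Circuit.run_proj_comm (A.ask_within c) _
      (fun b w x hw => by rw [proverWit_update (by simp) hw]) ψ)] at h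
  by_contra hb
  exact h (if_neg hb)

theorem sum_curry {α β : Type} [Fintype α] [Fintype β] [DecidableEq α] [DecidableEq β]
    (f : (α → β → Bool) → ℝ) :
    ∑ g : α × β → Bool, f (fun a b => g (a, b)) = ∑ g : α → β → Bool, f g :=
  Fintype.sum_equiv (Equiv.curry α β Bool) _ _ fun _ => rfl

/-- The distribution of the output of independent samplers. -/
theorem sum_prod_norm_sq_mul {α Ch : Type} [Fintype α] [DecidableEq α] [Fintype Ch]
    (δ : QState α) (f : (α → Bool) → Ch) (g : (Fin t → Ch) → ℝ) :
    ∑ d : Fin t → α → Bool, (∏ j, ‖δ (d j)‖ ^ 2) * g (fun j => f (d j)) =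
      ∑ c : Fin t → Ch, (∏ j, prob (fun b => f b = c j) δ) * g c := by
  classical
  have h : ∀ c : Fin t → Ch, ∏ j, prob (fun b => f b = c j) δ =
      ∑ d : Fin t → α → Bool, if (fun j => f (d j)) = c then ∏ j, ‖δ (d j)‖ ^ 2 else 0 := by
    intro c
    simp only [prob]
    rw [Finset.prod_univ_sum, Fintype.piFinset_univ]
    refine sum_congr rfl fun d _ => ?_
    by_cases hd : (fun j => f (d j)) = c
    · rw [if_pos hd]
      refine prod_congr rfl fun j _ => if_pos (congrFun hd j)
    · rw [if_neg hd]
      have : ∃ j, f (d j) ≠ c j := by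
        by_contra h
        push Not at h
        exact hd (funext h)
      obtain ⟨j, hj⟩ := this
      exact prod_eq_zero (mem_univ j) (if_neg hj)
  simp only [h, sum_mul]
  rw [sum_comm]
  refine sum_congr rfl fun d _ => ?_
  rw [sum_eq_single (fun j => f (d j))]
  · rw [if_pos rfl]
  · intro c _ hc
    rw [if_neg hc.symm, zero_mul]
  · simp

theorem sum_record {DW Ch : Type} [Fintype DW] [DecidableEq DW] [Fintype Ch]
    (δ : QState DW) (f : (DW → Bool) → Ch) (g : (Fin t → Ch) → (Fin t → Bits L.resp) → ℝ) :
    ∑ r : RecordWire t L DW → Bool, (∏ j, ‖δ (fun w => r (Sum.inr (j, w)))‖ ^ 2) *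
        g (fun j => f fun w => r (Sum.inr (j, w))) (recordedResp r) =
      ∑ c : Fin t → Ch, (∏ j, prob (fun b => f b = c j) δ) * ∑ z, g c z := by
  rw [sum_sum_arrow, ← sum_prod_norm_sq_mul δ f fun c => ∑ z, g c z,
    ← sum_curry (fun d : Fin t → DW → Bool => (∏ j, ‖δ (d j)‖ ^ 2) * ∑ z, g (fun j => f (d j)) z)]
  refine sum_congr rfl fun d _ => ?_
  rw [← sum_curry (fun z : Fin t → Fin L.resp → Bool => g (fun j => f fun w => d (j, w)) z),
    mul_sum]
  exact sum_congr rfl fun z _ => rfl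

open scoped Classical in
set_option synthInstance.maxSize 1000 in
/-- The success probability of the extractor. -/
theorem prob_extractorCircuit {S : Set (Reg 1 0)} (hS : Reg.wit ∉ S) (A : MaliciousProver S L)
    (D : Circuit (Wire 1 sD L mD)) (E : Circuit (Wire t sE L mE)) (x : Bits L.inst)
    (I : Set (Bits L.inst)) (rel : Bits L.inst → Bits L.wit → Prop) :
    prob (fun b => (firstMessage (b ∘ Sum.inl ∘ Sum.inl)).1 ∈ I ∧
        rel (firstMessage (b ∘ Sum.inl ∘ Sum.inl)).1 (proverWit (b ∘ Sum.inl ∘ Sum.inl)))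
      ((extractorCircuit A.stage1 A.stage2 D E).run
        (withKet (withKet (withKet A.state (loadedInst x)) fun _ => false) fun _ => false)) =
    ∑ c : Fin t → Bits L.chal,
      (∏ j, prob (fun b => chalOf 0 b = c j) (D.run (ket fun _ => false))) *
      ∑ z : Fin t → Bits L.resp, ∑ b, (if (firstMessage b).1 ∈ I then
        1 - prob (fun e => ¬ rel (firstMessage b).1 (witOf e))
          (E.run (ket (loaded (firstMessage b).1 (firstMessage b).2 c z))) else 0) *
        ‖answerPath A.ask proverResp (List.ofFn fun j => (c j, z j))
          (A.stage1.run (withKet A.state (loadedInst x))) b‖ ^ 2 := by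
  set φ := A.stage1.run (withKet A.state (loadedInst x)) with hφ
  set Θ : QState (QuestioningWire t L A.n sD mD) := glue fun r =>
      sampleAmplitude D r • answerPath A.ask proverResp
        (List.ofFn fun j => (sampledChal r j, recordedResp r j)) φ with hΘ
  have hwit : ∀ b, Θ b ≠ 0 → proverWit (b ∘ Sum.inl) = fun _ => false := by
    intro b hb
    refine proverWit_eq_of_answerPath_ne_zero hS A x (List.ofFn fun j =>
      (sampledChal (b ∘ Sum.inr) j, recordedResp (b ∘ Sum.inr) j)) (fun h => hb ?_)
    simp only [hΘ, glue, Pi.smul_apply, smul_eq_mul]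
    rw [hφ, h, mul_zero]
  set load : (QuestioningWire t L A.n sD mD → Bool) → Wire t sE L mE → Bool := fun b =>
    loaded (firstMessage (b ∘ Sum.inl)).1 (firstMessage (b ∘ Sum.inl)).2
      (sampledChal (b ∘ Sum.inr)) (recordedResp (b ∘ Sum.inr)) with hload
  set wit : Fin L.wit → QuestioningWire t L A.n sD mD := fun i => Sum.inl (Sum.inr (witWire i))
  have hinj : Function.Injective wit := by
    intro i j h
    exact witWire_injective (Sum.inr_injective (Sum.inl_injective h))
  rw [extractorCircuit, Circuit.run_append, Circuit.run_append, Circuit.run_append,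
    run_inl_withKet, run_questioningCircuit, run_loadCircuit]
  have htag : tagged (fun b : QuestioningWire t L A.n sD mD → Bool =>
      (loaded (b ∘ fun i => Sum.inl (Sum.inr (instWire i)))
      (b ∘ fun i => Sum.inl (Sum.inr (comWire i)))
      (fun j => b ∘ fun i => Sum.inr (Sum.inr (j, chalWire 0 i)))
      (fun j => b ∘ fun i => Sum.inr (Sum.inl (j, i))) : Wire t sE L mE → Bool)) Θ =
      tagged load Θ := rfl
  rw [htag, run_inr_tagged, run_copy_inr_inl witWire hinj, prob_glue]
  -- the copy of the witness is the content of the witness register of the algorithm `E`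
  have hterm : ∀ e : Wire t sE L mE → Bool,
      prob (fun b : QuestioningWire t L A.n sD mD → Bool =>
        (firstMessage (Sum.elim b e ∘ Sum.inl ∘ Sum.inl)).1 ∈ I ∧
        rel (firstMessage (Sum.elim b e ∘ Sum.inl ∘ Sum.inl)).1
          (proverWit (Sum.elim b e ∘ Sum.inl ∘ Sum.inl)))
        (shift (Function.extend wit
          (fun i => e (witWire i)) fun _ => false)
          fun b => E.run (ket (load b)) e * Θ b) =
      ∑ b, if (firstMessage (b ∘ Sum.inl)).1 ∈ I ∧ rel (firstMessage (b ∘ Sum.inl)).1 (witOf e)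
        then ‖E.run (ket (load b)) e‖ ^ 2 * ‖Θ b‖ ^ 2 else 0 := by
    intro e
    set v : QuestioningWire t L A.n sD mD → Bool := Function.extend wit
      (fun i => e (witWire i)) fun _ => false with hv
    rw [prob_shift]
    have hfm : ∀ b : QuestioningWire t L A.n sD mD → Bool,
        firstMessage ((fun w => xor (b w) (v w)) ∘ Sum.inl) =
        firstMessage (b ∘ Sum.inl) := by
      intro b
      have h1 : ∀ i, v (Sum.inl (Sum.inr ⟨.inst, i⟩)) = false := fun i =>
        Function.extend_apply' _ _ _ (by
          rintro ⟨j, hj⟩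
          exact absurd (congrArg Sigma.fst (Sum.inr_injective (Sum.inl_injective hj)))
            (by simp [witWire]))
      have h2 : ∀ i, v (Sum.inl (Sum.inr ⟨.com, i⟩)) = false := fun i =>
        Function.extend_apply' _ _ _ (by
          rintro ⟨j, hj⟩
          exact absurd (congrArg Sigma.fst (Sum.inr_injective (Sum.inl_injective hj)))
            (by simp [witWire]))
      simp only [firstMessage, Prod.mk.injEq]
      constructor
      · funext i; exact (congrArg (xor _) (h1 i)).trans (Bool.xor_false _)
      · funext i; exact (congrArg (xor _) (h2 i)).trans (Bool.xor_false _)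
    have hpw : ∀ b : QuestioningWire t L A.n sD mD → Bool, Θ b ≠ 0 →
        proverWit ((fun w => xor (b w) (v w)) ∘ Sum.inl) = witOf e := by
      intro b hb
      funext i
      have h1 : v (Sum.inl (Sum.inr (witWire i))) = e (witWire i) := hinj.extend_apply _ _ _
      have h2 : b (Sum.inl (Sum.inr (witWire i))) = false := congrFun (hwit b hb) i
      show xor (b (Sum.inl (Sum.inr (witWire i)))) (v (Sum.inl (Sum.inr (witWire i)))) = _
      rw [h1, h2, Bool.false_xor]; rfl
    rw [prob_congr (Q := fun b => (firstMessage (b ∘ Sum.inl)).1 ∈ I ∧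
      rel (firstMessage (b ∘ Sum.inl)).1 (witOf e))]
    · refine sum_congr rfl fun b _ => ?_
      rw [norm_mul, mul_pow]
      by_cases h : (firstMessage (b ∘ Sum.inl)).1 ∈ I ∧
        rel (firstMessage (b ∘ Sum.inl)).1 (witOf e)
      · rw [if_pos h, if_pos h]
      · rw [if_neg h, if_neg h]
    · intro b hb
      have hΘb : Θ b ≠ 0 := right_ne_zero_of_mul hb
      show (firstMessage ((fun w => xor (b w) (v w)) ∘ Sum.inl)).1 ∈ I ∧
        rel (firstMessage ((fun w => xor (b w) (v w)) ∘ Sum.inl)).1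
          (proverWit ((fun w => xor (b w) (v w)) ∘ Sum.inl)) ↔ _
      rw [hfm, hpw b hΘb]
  rw [sum_congr rfl fun e _ => hterm e, sum_comm]
  have hE : ∀ b : QuestioningWire t L A.n sD mD → Bool, ∑ e : Wire t sE L mE → Bool,
      (if (firstMessage (b ∘ Sum.inl)).1 ∈ I ∧ rel (firstMessage (b ∘ Sum.inl)).1 (witOf e)
        then ‖E.run (ket (load b)) e‖ ^ 2 * ‖Θ b‖ ^ 2 else 0) =
      (if (firstMessage (b ∘ Sum.inl)).1 ∈ I then
        1 - prob (fun e => ¬ rel (firstMessage (b ∘ Sum.inl)).1 (witOf e))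
          (E.run (ket (load b))) else 0) * ‖Θ b‖ ^ 2 := by
    intro b
    have hnot := prob_not (fun e => rel (firstMessage (b ∘ Sum.inl)).1 (witOf e))
      (E.run (ket (load b)))
    rw [Circuit.sqNorm_run, sqNorm_ket] at hnot
    rw [← hnot, prob]
    by_cases hI : (firstMessage (b ∘ Sum.inl)).1 ∈ I
    · rw [if_pos hI, sum_mul]
      refine sum_congr rfl fun e _ => ?_
      by_cases hr : rel (firstMessage (b ∘ Sum.inl)).1 (witOf e)
      · rw [if_pos ⟨hI, hr⟩, if_pos hr]
      · rw [if_neg fun h => hr h.2, if_neg hr, zero_mul]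
    · rw [if_neg hI, zero_mul]
      exact sum_eq_zero fun e _ => if_neg fun h => hI h.1
  rw [sum_congr rfl fun b _ => hE b, sum_sum_arrow]
  rw [← sum_record (D.run (ket fun _ => false)) (chalOf 0) fun c z =>
    ∑ b, (if (firstMessage b).1 ∈ I then
        1 - prob (fun e => ¬ rel (firstMessage b).1 (witOf e))
          (E.run (ket (loaded (firstMessage b).1 (firstMessage b).2 c z))) else 0) *
        ‖answerPath A.ask proverResp (List.ofFn fun j => (c j, z j)) φ b‖ ^ 2]
  refine sum_congr rfl fun r _ => ?_
  rw [mul_sum]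
  refine sum_congr rfl fun b _ => ?_
  have hn : ‖Θ (Sum.elim b r)‖ ^ 2 = (∏ j, ‖D.run (ket fun _ => false)
      (fun w => r (Sum.inr (j, w)))‖ ^ 2) * ‖answerPath A.ask proverResp
        (List.ofFn fun j => (sampledChal r j, recordedResp r j)) φ b‖ ^ 2 := by
    simp only [hΘ, glue, Sum.elim_comp_inl, Sum.elim_comp_inr, Pi.smul_apply, smul_eq_mul,
      norm_mul, mul_pow, sampleAmplitude, norm_prod, prod_pow]
  rw [hn]
  exact mul_left_comm _ _ _

end ExtractorCircuit

/-! ### Programs that consist of subroutines -/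

section Programs

variable {Ω ρ τ : Type}

/-- Relabel the wires of an elementary step that is no black-box call. -/
def Op.lift {V W : Type} (f : V → W) : Op Empty V → Op Ω W
  | gate g => gate (g.map f)
  | call o => o.elim

/-- Rename the registers of a program without black-box calls. -/
def Prog.mapRegs (f : ρ → τ) : Prog Empty ρ → Prog Ω τ
  | .skip => .skip
  | .inc k => .inc k
  | .dec k => .dec k
  | .get k a i => .get k a i
  | .put a i k => .put a i k
  | .emit o => .emit (o.lift fun w => (f w.1, w.2))
  | .seq P Q => .seq (P.mapRegs f) (Q.mapRegs f)
  | .ifZero k P Q => .ifZero k (P.mapRegs f) (Q.mapRegs f)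
  | .loop k P => .loop k (P.mapRegs f)
  | .sub P => .sub (P.mapRegs f)

/-- Rename the registers in the circuit written so far. -/
def Config.mapRegs (f : ρ → τ) (σ : Config Empty ρ) : Config Ω τ :=
  ⟨σ.mem, σ.out.map (Op.lift fun w => (f w.1, w.2)), σ.time⟩

theorem Prog.exec_mapRegs (ini : Mem) (f : ρ → τ) (P : Prog Empty ρ) (σ : Config Empty ρ) :
    (P.mapRegs f : Prog Ω τ).exec ini (σ.mapRegs f) = (P.exec ini σ).mapRegs f := by
  induction P generalizing σ with
  | emit o =>
    cases o with
    | gate g =>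
      simp [mapRegs, exec, Config.mapRegs, Config.tick, Op.lift, Op.map, Gate.map_map,
        Function.comp_def]
    | call o => exact o.elim
  | seq P Q hP hQ => exact (congrArg _ (hP σ)).trans (hQ _)
  | ifZero k P Q hP hQ =>
    by_cases h : σ.mem.ctr k = 0
    · have h' : (σ.mapRegs f : Config Ω τ).mem.ctr k = 0 := h
      simp only [mapRegs, exec, if_pos h, if_pos h']
      exact hP σ.tick
    · have h' : (σ.mapRegs f : Config Ω τ).mem.ctr k ≠ 0 := h
      simp only [mapRegs, exec, if_neg h, if_neg h']
      exact hQ σ.tick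
  | loop k P hP =>
    have h : Function.Semiconj (Config.mapRegs f : Config Empty ρ → Config Ω τ)
        (fun σ => P.exec ini σ.tick) (fun σ => (P.mapRegs f).exec ini σ.tick) :=
      fun σ => (hP σ.tick).symm
    exact ((h.iterate_right (σ.mem.ctr k)) σ.tick).symm
  | sub P hP =>
    have h := hP { σ with mem := ini, time := σ.time + 1 }
    simp only [mapRegs, exec]
    simp only [Config.mapRegs] at h ⊢
    rw [h]
  | _ => rfl

/-- The configuration `σ`, if the circuit `pre` was written and `T` steps were done before. -/
def Config.after (pre : List (Op Ω (ρ × ℕ))) (T : ℕ) (σ : Config Ω ρ) : Config Ω ρ :=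
  ⟨σ.mem, pre ++ σ.out, T + σ.time⟩

theorem Prog.exec_after (ini : Mem) (pre : List (Op Ω (ρ × ℕ))) (T : ℕ) (P : Prog Ω ρ)
    (σ : Config Ω ρ) : P.exec ini (σ.after pre T) = (P.exec ini σ).after pre T := by
  induction P generalizing σ with
  | emit o => simp [exec, Config.after, Config.tick, add_assoc]
  | seq P Q hP hQ => exact (congrArg _ (hP σ)).trans (hQ _)
  | ifZero k P Q hP hQ =>
    by_cases h : σ.mem.ctr k = 0
    · have h' : (σ.after pre T).mem.ctr k = 0 := h
      simp only [exec, if_pos h, if_pos h']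
      exact hP σ.tick
    · have h' : (σ.after pre T).mem.ctr k ≠ 0 := h
      simp only [exec, if_neg h, if_neg h']
      exact hQ σ.tick
  | loop k P hP =>
    have h : Function.Semiconj (Config.after pre T)
        (fun σ => P.exec ini σ.tick) (fun σ => P.exec ini σ.tick) :=
      fun σ => (hP σ.tick).symm
    exact ((h.iterate_right (σ.mem.ctr k)) σ.tick).symm
  | sub P hP =>
    have h := hP { σ with mem := ini, time := σ.time + 1 }
    simp only [exec]
    simp only [Config.after, ← add_assoc] at h ⊢
    rw [h]
  | _ => rfl

/-- The result of running a program from the beginning. -/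
def Prog.result (ini : Mem) (P : Prog Ω ρ) : Config Ω ρ := P.exec ini ⟨ini, [], 0⟩

theorem Prog.result_mapRegs (ini : Mem) (f : ρ → τ) (P : Prog Empty ρ) :
    (P.mapRegs f : Prog Ω τ).result ini = (P.result ini).mapRegs f :=
  P.exec_mapRegs ini f ⟨ini, [], 0⟩

/-- Run some programs one after the other as subroutines. -/
def Prog.subs : List (Prog Ω ρ) → Prog Ω ρ
  | [] => .skip
  | P :: l => .seq (.sub P) (subs l)

theorem Prog.result_subs (ini : Mem) (l : List (Prog Ω ρ)) :
    (subs l).result ini = ⟨ini, l.flatMap fun P => (P.result ini).out,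
      (l.map fun P => (P.result ini).time + 1).sum + 1⟩ := by
  induction l with
  | nil => rfl
  | cons P l ih =>
    have h1 : (Prog.sub P).exec ini ⟨ini, [], 0⟩ =
        Config.after (P.result ini).out ((P.result ini).time + 1) ⟨ini, [], 0⟩ := by
      have := P.exec_after ini [] 1 ⟨ini, [], 0⟩
      simp only [exec, result, Config.after, List.nil_append, List.append_nil, add_zero,
        zero_add] at this ⊢
      rw [this, add_comm 1]
    show (subs l).exec ini ((Prog.sub P).exec ini ⟨ini, [], 0⟩) = _
    rw [h1, exec_after]
    change Config.after _ _ ((subs l).result ini) = _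
    rw [ih]
    simp [Config.after, List.flatMap_cons, add_assoc]

/-- Copy the first qubits of the register `r` to the register `r'`; their number is the value of
counter `k`. -/
def Prog.copyReg (k : ℕ) (r r' : ρ) : Prog Ω ρ :=
  .loop k (.seq (.emit (.gate (.CNOT (r, 6) (r', 6)))) (.inc 6))

theorem Prog.result_copyReg {ini : Mem} (h6 : ini.ctr 6 = 0) (k : ℕ) (r r' : ρ) :
    ((copyReg k r r' : Prog Ω ρ).result ini).out =
      ((List.range (ini.ctr k)).map fun i => Op.gate (.CNOT (r, i) (r', i))) ∧
    ((copyReg k r r' : Prog Ω ρ).result ini).time = 3 * ini.ctr k + 1 := by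
  set step : Config Ω ρ → Config Ω ρ := fun σ =>
    (Prog.seq (.emit (.gate (.CNOT (r, 6) (r', 6)))) (.inc 6)).exec ini σ.tick with hstep
  have h1 : ∀ σ, (step σ).mem.ctr 6 = σ.mem.ctr 6 + 1 := fun σ => by
    simp [hstep, exec, Config.tick, Config.setCtr]
  have h2 : ∀ σ, (step σ).out = σ.out ++ [.gate (.CNOT (r, σ.mem.ctr 6) (r', σ.mem.ctr 6))] :=
    fun σ => rfl
  have h3 : ∀ σ, (step σ).time = σ.time + 3 := fun σ => rfl
  have key : ∀ n, (step^[n] (Config.tick ⟨ini, [], 0⟩)).mem.ctr 6 = n ∧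
      (step^[n] (Config.tick ⟨ini, [], 0⟩)).out =
        ((List.range n).map fun i => Op.gate (.CNOT (r, i) (r', i))) ∧
      (step^[n] (Config.tick ⟨ini, [], 0⟩)).time = 3 * n + 1 := by
    intro n
    induction n with
    | zero => exact ⟨h6, rfl, rfl⟩
    | succ n ih =>
      rw [Function.iterate_succ_apply', h1, h2, h3, ih.1, ih.2.1, ih.2.2]
      refine ⟨rfl, ?_, by ring⟩
      rw [List.range_succ, List.map_append]
      rfl
  exact (key (ini.ctr k)).2

end Programs

/-! ### The program of the extractor -/

section WrittenCircuit

variable {Ω V : Type} {t s : ℕ} {L : Sizes} {m : ℕ}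

/-- The qubit with a given register name and index, if there is one. -/
def wireAt (w : Reg t s × ℕ) : Option (Wire t s L m) :=
  if h : w.2 < regLen L m w.1 then some ⟨w.1, ⟨w.2, h⟩⟩ else none

theorem wireAt_eq_some (r : Reg t s) {i : ℕ} (h : i < regLen L m r) :
    (wireAt (r, i) : Option (Wire t s L m)) = some ⟨r, ⟨i, h⟩⟩ := dif_pos h

/-- The circuit that is described by a list of elementary steps. -/
def writtenCircuit (U : Ω → Circuit (V ⊕ Wire t s L m)) (out : List (Op Ω (Reg t s × ℕ))) :
    Circuit (V ⊕ Wire t s L m) :=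
  (out.filterMap (Op.partialMap wireAt)).flatMap (Op.expand Sum.inr U)

variable (U : Ω → Circuit (V ⊕ Wire t s L m))

theorem writtenCircuit_cons (o : Op Ω (Reg t s × ℕ)) (l : List (Op Ω (Reg t s × ℕ))) :
    writtenCircuit U (o :: l) = writtenCircuit U [o] ++ writtenCircuit U l := by
  simp only [writtenCircuit, ← List.flatMap_append, ← List.filterMap_append]
  rfl

theorem writtenCircuit_append (l l' : List (Op Ω (Reg t s × ℕ))) :
    writtenCircuit U (l ++ l') = writtenCircuit U l ++ writtenCircuit U l' := by
  simp [writtenCircuit]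

theorem writtenCircuit_flatMap {α : Type} (l : List α) (f : α → List (Op Ω (Reg t s × ℕ))) :
    writtenCircuit U (l.flatMap f) = l.flatMap fun a => writtenCircuit U (f a) := by
  induction l with
  | nil => rfl
  | cons a l ih => rw [List.flatMap_cons, writtenCircuit_append, ih, List.flatMap_cons]

theorem writtenCircuit_call (o : Ω) : writtenCircuit U [Op.call o] = U o := by
  simp [writtenCircuit, Op.partialMap, Op.expand]

theorem writtenCircuit_copy {n : ℕ} {r r' : Reg t s} {u v : Fin n → Wire t s L m}
    (hu : ∀ i : Fin n, wireAt (r, ↑i) = some (u i))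
    (hv : ∀ i : Fin n, wireAt (r', ↑i) = some (v i)) :
    writtenCircuit U ((List.range n).map fun i => Op.gate (.CNOT (r, i) (r', i))) =
      Circuit.copy (fun i => Sum.inr (u i)) (fun i => Sum.inr (v i)) := by
  rw [Circuit.copy, ← List.map_coe_finRange_eq_range, List.map_map]
  induction List.finRange n with
  | nil => rfl
  | cons i l ih =>
    rw [List.map_cons, writtenCircuit_cons, ih, List.map_cons]
    simp [writtenCircuit, Op.partialMap, Gate.partialMap, hu, hv, Op.expand, Gate.map]

/-- The circuit of a subroutine without black-box calls that works on some registers of its own. -/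
theorem writtenCircuit_lift {t' s' m' : ℕ} (f : Reg t' s' → Reg t s)
    (e : Wire t' s' L m' → Wire t s L m) (out : List (Op Empty (Reg t' s' × ℕ)))
    (h : ∀ o ∈ out, ∀ w ∈ o.wires, ∃ v, wireAt w = some v ∧ wireAt (f w.1, w.2) = some (e v)) :
    writtenCircuit U (out.map (Op.lift fun w => (f w.1, w.2))) =
      Circuit.relabel (fun w => Sum.inr (e w))
        ((out.filterMap (Op.partialMap wireAt)).flatMap (Op.expand id Empty.elim)) := by
  induction out with
  | nil => rfl
  | cons o out ih =>
    rw [List.map_cons, writtenCircuit_cons, ih fun o' ho' => h o' (List.mem_cons_of_mem _ ho')]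
    have ho := h o (List.mem_cons_self ..)
    cases o with
    | call o => exact o.elim
    | gate g =>
      cases g with
      | CNOT u v =>
        obtain ⟨u', hu, hu'⟩ := ho u (by simp [Op.wires, Gate.wires])
        obtain ⟨v', hv, hv'⟩ := ho v (by simp [Op.wires, Gate.wires])
        simp [writtenCircuit, Op.lift, Op.partialMap, Gate.partialMap, hu, hv, hu', hv', Gate.map,
          Op.expand, Circuit.relabel]
      | CCNOT u v w =>
        obtain ⟨u', hu, hu'⟩ := ho u (by simp [Op.wires, Gate.wires])
        obtain ⟨v', hv, hv'⟩ := ho v (by simp [Op.wires, Gate.wires])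
        obtain ⟨w', hw, hw'⟩ := ho w (by simp [Op.wires, Gate.wires])
        simp [writtenCircuit, Op.lift, Op.partialMap, Gate.partialMap, hu, hv, hw, hu', hv', hw',
          Gate.map, Op.expand, Circuit.relabel]
      | _ w =>
        obtain ⟨w', hw, hw'⟩ := ho w (by simp [Op.wires, Gate.wires])
        simp [writtenCircuit, Op.lift, Op.partialMap, Gate.partialMap, hw, hw', Gate.map,
          Op.expand, Circuit.relabel]

theorem Circuit.relabel_flatMap {V W α : Type} (f : V → W) (l : List α) (F : α → Circuit V) :
    relabel f (l.flatMap F) = l.flatMap fun a => relabel f (F a) := List.map_flatMap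

end WrittenCircuit

section ExtractorProgram

variable {t s sD sE : ℕ}

/-- Names for the work registers of the extractor: the registers of the algorithm that computes
a witness, the registers of `t` samplers of challenges, and `t` registers for responses. -/
abbrev WorkName (t sD sE : ℕ) : Type := Reg t sE ⊕ ((Fin t × Reg 1 sD) ⊕ Fin t)

/-- The work registers with given names, if `nm` enumerates the names. -/
def witnessReg (nm : WorkName t sD sE → Fin s) (r : Reg t sE) : Reg 1 s := .work (nm (Sum.inl r))

def samplerReg (nm : WorkName t sD sE → Fin s) (j : Fin t) (r : Reg 1 sD) : Reg 1 s :=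
  .work (nm (Sum.inr (Sum.inl (j, r))))

def answerReg (nm : WorkName t sD sE → Fin s) (j : Fin t) : Reg 1 s :=
  .work (nm (Sum.inr (Sum.inr j)))

/-- The subroutines of the extractor. Counters `1, …, 5` hold the lengths of the registers for
instances, witnesses, commitments, challenges and responses. -/
def extractorSubs (nm : WorkName t sD sE → Fin s) (D : Prog Empty (Reg 1 sD))
    (E : Prog Empty (Reg t sE)) : List (Prog ProverCall (Reg 1 s)) :=
  ([.emit (.call .first)] ++ ((List.finRange t).map (fun j => D.mapRegs (samplerReg nm j)) ++
    (List.finRange t).flatMap fun j =>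
      [.copyReg 4 (samplerReg nm j (.chal 0)) (.chal 0), .emit (.call .second),
        .copyReg 5 (.resp 0) (answerReg nm j), .emit (.call .secondInv),
        .copyReg 4 (samplerReg nm j (.chal 0)) (.chal 0)])) ++
  (([.copyReg 1 .inst (witnessReg nm .inst)] ++ ([.copyReg 3 .com (witnessReg nm .com)] ++
    ((List.finRange t).map (fun j =>
      .copyReg 4 (samplerReg nm j (.chal 0)) (witnessReg nm (.chal j))) ++
    (List.finRange t).map fun j => .copyReg 5 (answerReg nm j) (witnessReg nm (.resp j))))) ++
  ([E.mapRegs (witnessReg nm)] ++ [.copyReg 2 (witnessReg nm .wit) .wit]))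

theorem length_extractorSubs (nm : WorkName t sD sE → Fin s) (D : Prog Empty (Reg 1 sD))
    (E : Prog Empty (Reg t sE)) : (extractorSubs nm D E).length = 8 * t + 5 := by
  simp [extractorSubs]
  ring

theorem forall_mem_extractorSubs {nm : WorkName t sD sE → Fin s} {D : Prog Empty (Reg 1 sD)}
    {E : Prog Empty (Reg t sE)} {Q : Prog ProverCall (Reg 1 s) → Prop}
    (hcall : ∀ o, Q (.emit (.call o))) (hD : ∀ j, Q (D.mapRegs (samplerReg nm j)))
    (hchal : ∀ j, Q (.copyReg 4 (samplerReg nm j (.chal 0)) (.chal 0)))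
    (hresp : ∀ j, Q (.copyReg 5 (.resp 0) (answerReg nm j)))
    (hinst : Q (.copyReg 1 .inst (witnessReg nm .inst)))
    (hcom : Q (.copyReg 3 .com (witnessReg nm .com)))
    (hchal' : ∀ j, Q (.copyReg 4 (samplerReg nm j (.chal 0)) (witnessReg nm (.chal j))))
    (hresp' : ∀ j, Q (.copyReg 5 (answerReg nm j) (witnessReg nm (.resp j))))
    (hE : Q (E.mapRegs (witnessReg nm))) (hwit : Q (.copyReg 2 (witnessReg nm .wit) .wit)) :
    ∀ P ∈ extractorSubs nm D E, Q P := by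
  simp [extractorSubs, or_imp, forall_and, *]

variable {L : Sizes} {mD mE m n : ℕ}

/-- The qubits of an algorithm, as qubits of some work registers. -/
def workWire {t' s' m' : ℕ} (f : Reg t' s' → Fin s) (hm : ∀ r : Reg t' s', regLen L m' r ≤ m)
    (w : Wire t' s' L m') : Wire 1 s L m :=
  ⟨.work (f w.1), ⟨w.2, w.2.2.trans_le (hm w.1)⟩⟩

/-- The places of the qubits of the extractor in its registers. -/
def extractorWire (nm : WorkName t sD sE → Fin s) (hD : ∀ r : Reg 1 sD, regLen L mD r ≤ m)
    (hE : ∀ r : Reg t sE, regLen L mE r ≤ m) (hZ : L.resp ≤ m) :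
    ExtractorWire t L n sD mD sE mE → Fin n ⊕ Wire 1 s L m
  | Sum.inl (Sum.inl p) => Sum.map id shareWire p
  | Sum.inl (Sum.inr (Sum.inl (j, i))) =>
      Sum.inr ⟨answerReg nm j, ⟨i, i.2.trans_le hZ⟩⟩
  | Sum.inl (Sum.inr (Sum.inr (j, w))) =>
      Sum.inr (workWire (fun r => nm (Sum.inr (Sum.inl (j, r)))) hD w)
  | Sum.inr w => Sum.inr (workWire (fun r => nm (Sum.inl r)) hE w)

theorem writtenCircuit_extractorSubs {S : Set (Reg 1 0)} (A : MaliciousProver S L)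
    {nm : WorkName t sD sE → Fin s} (hD : ∀ r : Reg 1 sD, regLen L mD r ≤ m)
    (hE : ∀ r : Reg t sE, regLen L mE r ≤ m) (hZ : L.resp ≤ m) {η : ℕ}
    (D : Prog Empty (Reg 1 sD)) (E : Prog Empty (Reg t sE))
    (hD' : ∀ o ∈ (D.result (inputMem η L)).out, ∀ w ∈ o.wires, w.2 < regLen L mD w.1)
    (hE' : ∀ o ∈ (E.result (inputMem η L)).out, ∀ w ∈ o.wires, w.2 < regLen L mE w.1) :
    ((extractorSubs nm D E).flatMap fun P =>
      writtenCircuit (A.blackBox s m) (P.result (inputMem η L)).out) =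
    (extractorCircuit A.stage1 A.stage2
      (((D.result (inputMem η L)).out.filterMap (Op.partialMap wireAt)).flatMap
        (Op.expand id Empty.elim))
      (((E.result (inputMem η L)).out.filterMap (Op.partialMap wireAt)).flatMap
        (Op.expand id Empty.elim))).relabel (extractorWire nm hD hE hZ) := by
  set ini := inputMem η L with hini
  set g : ExtractorWire t L A.n sD mD sE mE → Fin A.n ⊕ Wire 1 s L m :=
    extractorWire nm hD hE hZ with hg
  generalize hCD : ((D.result ini).out.filterMap (Op.partialMap wireAt)).flatMap
    (Op.expand id Empty.elim) = CD
  generalize hCE : ((E.result ini).out.filterMap (Op.partialMap wireAt)).flatMap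
    (Op.expand id Empty.elim) = CE
  have hcall : ∀ o, writtenCircuit (A.blackBox s m)
      ((Prog.emit (.call o) : Prog ProverCall (Reg 1 s)).result ini).out = A.blackBox s m o :=
    writtenCircuit_call _
  have h6 : ini.ctr 6 = 0 := rfl
  have hcopy : ∀ (k : ℕ) (r r' : Reg 1 s)
      (u v : Fin (ini.ctr k) → ExtractorWire t L A.n sD mD sE mE)
      (hu : ∀ i, ∃ h, g (u i) = Sum.inr ⟨r, ⟨i, h⟩⟩)
      (hv : ∀ i, ∃ h, g (v i) = Sum.inr ⟨r', ⟨i, h⟩⟩),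
      writtenCircuit (A.blackBox s m) ((Prog.copyReg k r r').result ini).out =
        (Circuit.copy u v).relabel g := by
    intro k r r' u v hu hv
    choose hu hu' using hu
    choose hv hv' using hv
    rw [(Prog.result_copyReg h6 k r r').1, writtenCircuit_copy _
      (fun i => wireAt_eq_some r (hu i)) (fun i => wireAt_eq_some r' (hv i)), Circuit.relabel_copy]
    congr 1 <;> funext i
    · exact (hu' i).symm
    · exact (hv' i).symm
  have hsub : ∀ {t' s' m' : ℕ} (P : Prog Empty (Reg t' s')) (f : Reg t' s' → Fin s)
      (hm : ∀ r : Reg t' s', regLen L m' r ≤ m)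
      (_ : ∀ o ∈ (P.result ini).out, ∀ w ∈ o.wires, w.2 < regLen L m' w.1),
      writtenCircuit (A.blackBox s m) ((P.mapRegs fun r => .work (f r)).result ini).out =
        Circuit.relabel (fun w => Sum.inr (workWire f hm w))
          (((P.result ini).out.filterMap (Op.partialMap wireAt)).flatMap
            (Op.expand id Empty.elim)) := by
    intro t' s' m' P f hm hP
    rw [Prog.result_mapRegs]
    refine writtenCircuit_lift (A.blackBox s m) (fun r => .work (f r)) (workWire f hm)
      (P.result ini).out fun o ho w hw => ?_
    exact ⟨_, wireAt_eq_some w.1 (hP o ho w hw), wireAt_eq_some _ _⟩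
  have hchal : ∀ j : Fin t, writtenCircuit (A.blackBox s m) ((Prog.copyReg 4
      (samplerReg nm j (.chal 0)) (.chal 0) : Prog ProverCall (Reg 1 s)).result ini).out =
      (Circuit.copy (fun i => Sum.inl (Sum.inr (Sum.inr (j, chalWire 0 i))))
        (fun i => Sum.inl (Sum.inl (proverChal i)))).relabel g := fun j =>
    hcopy 4 _ _ _ _ (fun i => ⟨_, rfl⟩) (fun i => ⟨i.2, rfl⟩)
  simp only [extractorSubs, extractorCircuit, questioningCircuit, samplingCircuit, loadCircuit,
    List.flatMap_append, Circuit.relabel_append, List.flatMap_singleton, List.flatMap_map,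
    List.flatMap_assoc, Circuit.relabel_flatMap, Circuit.relabel_relabel]
  refine congrArg₂ _ (congrArg₂ _ ?_ (congrArg₂ _ ?_ ?_)) (congrArg₂ _ (congrArg₂ _ ?_
    (congrArg₂ _ ?_ (congrArg₂ _ ?_ ?_))) (congrArg₂ _ ?_ ?_))
  · exact hcall .first
  · exact List.flatMap_congr fun j _ =>
      (hsub D (fun r => nm (Sum.inr (Sum.inl (j, r)))) hD hD').trans (congrArg _ hCD)
  · refine List.flatMap_congr fun j _ => ?_
    simp only [List.flatMap_cons, List.flatMap_nil, List.append_nil, rewindingStep,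
      Circuit.relabel_append, Circuit.relabel_relabel, Circuit.relabel_inv, hchal, hcall,
      Circuit.relabel_copy]
    refine congrArg₂ _ rfl (congrArg₂ _ rfl (congrArg₂ _ ?_ rfl))
    refine (hcopy 5 (.resp 0) (answerReg nm j) (fun i => Sum.inl (Sum.inl (proverResp i)))
      (fun i => Sum.inl (Sum.inr (Sum.inl (j, i)))) (fun i => ⟨i.2, rfl⟩)
      (fun i => ⟨_, rfl⟩)).trans ?_
    exact Circuit.relabel_copy ..
  · exact hcopy 1 _ _ _ _ (fun i => ⟨i.2, rfl⟩) (fun i => ⟨_, rfl⟩)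
  · exact hcopy 3 _ _ _ _ (fun i => ⟨i.2, rfl⟩) (fun i => ⟨_, rfl⟩)
  · exact List.flatMap_congr fun j _ =>
      hcopy 4 _ _ _ _ (fun i => ⟨_, rfl⟩) (fun i => ⟨_, rfl⟩)
  · exact List.flatMap_congr fun j _ =>
      hcopy 5 _ _ _ _ (fun i => ⟨_, rfl⟩) (fun i => ⟨_, rfl⟩)
  · exact (hsub E (fun r => nm (Sum.inl r)) hE hE').trans (congrArg _ hCE)
  · exact hcopy 2 _ _ _ _ (fun i => ⟨_, rfl⟩) (fun i => ⟨i.2, rfl⟩)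

end ExtractorProgram

/-! ### The extractor -/

section Extractor

variable {t s sD sE : ℕ} {L : Sizes} {mD mE m n : ℕ}

theorem shareWire_injective : Function.Injective (shareWire : Wire 1 0 L 0 → Wire 1 s L m) := by
  rintro ⟨r, i⟩ ⟨r', i'⟩ h
  cases r <;> cases r' <;> first
    | exact Fin.elim0 ‹Fin 0›
    | exact congrArg (Sigma.mk _) (eq_of_heq (Sigma.mk.inj_iff.1 h).2)
    | rename_i j j'
      obtain rfl := Subsingleton.elim j j'
      exact congrArg (Sigma.mk _) (eq_of_heq (Sigma.mk.inj_iff.1 h).2)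
    | exact nomatch congrArg Sigma.fst h

theorem shareWire_fst_ne_work (w : Wire 1 0 L 0) (k : Fin s) :
    (shareWire w : Wire 1 s L m).1 ≠ .work k := by
  rcases w with ⟨r, i⟩
  cases r with
  | work k => exact k.elim0
  | _ => simp [shareWire]

theorem workWire_injective {t' s' m' : ℕ} {f : Reg t' s' → Fin s} (hf : Function.Injective f)
    (hm : ∀ r : Reg t' s', regLen L m' r ≤ m) :
    Function.Injective (workWire f hm : Wire t' s' L m' → Wire 1 s L m) := by
  rintro ⟨r, i⟩ ⟨r', i'⟩ h
  simp only [workWire, Sigma.mk.injEq, Reg.work.injEq] at h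
  obtain rfl := hf h.1
  simpa [Fin.ext_iff] using h.2

theorem extractorWire_injective {nm : WorkName t sD sE → Fin s} (hnm : Function.Injective nm)
    (hD : ∀ r : Reg 1 sD, regLen L mD r ≤ m) (hE : ∀ r : Reg t sE, regLen L mE r ≤ m)
    (hZ : L.resp ≤ m) :
    Function.Injective
      (extractorWire nm hD hE hZ : ExtractorWire t L n sD mD sE mE → Fin n ⊕ Wire 1 s L m) := by
  have hshare : ∀ (p : ProverWire L n) (w : Wire 1 s L m) (k : Fin s), w.1 = .work k →
      (Sum.map id shareWire p : Fin n ⊕ Wire 1 s L m) ≠ Sum.inr w := by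
    rintro (p | p) w k hw h
    · cases h
    · exact shareWire_fst_ne_work p k ((congrArg Sigma.fst (Sum.inr_injective h)).trans hw)
  have hreg : ∀ {w w' : Wire 1 s L m} {k k' : WorkName t sD sE}, w.1 = .work (nm k) →
      w'.1 = .work (nm k') →
      (Sum.inr w : Fin n ⊕ Wire 1 s L m) = Sum.inr w' → k = k' := by
    intro w w' k k' hw hw' h
    rw [Sum.inr_injective h, hw'] at hw
    exact hnm (Reg.work.inj hw).symm
  rintro ((p | ⟨j, i⟩ | ⟨j, w⟩) | w) ((p' | ⟨j', i'⟩ | ⟨j', w'⟩) | w') h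
  · exact congrArg (fun p => Sum.inl (Sum.inl p))
      (Sum.map_injective.2 ⟨Function.injective_id, shareWire_injective⟩ h)
  · exact absurd h (hshare p _ _ rfl)
  · exact absurd h (hshare p _ _ rfl)
  · exact absurd h (hshare p _ _ rfl)
  · exact absurd h.symm (hshare p' _ _ rfl)
  · have hj := hreg (k := Sum.inr (Sum.inr j)) (k' := Sum.inr (Sum.inr j')) rfl rfl h
    simp only [Sum.inr.injEq] at hj
    subst hj
    simp only [extractorWire, Sum.inr.injEq, Sigma.mk.injEq, heq_eq_eq, Fin.mk.injEq, true_and]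
      at h
    rw [Fin.ext h]
  · exact nomatch hreg (k := Sum.inr (Sum.inr j)) (k' := Sum.inr (Sum.inl (j', w'.1))) rfl rfl h
  · exact nomatch hreg (k := Sum.inr (Sum.inr j)) (k' := Sum.inl w'.1) rfl rfl h
  · exact absurd h.symm (hshare p' _ _ rfl)
  · exact nomatch hreg (k := Sum.inr (Sum.inl (j, w.1))) (k' := Sum.inr (Sum.inr j')) rfl rfl h
  · have hj := hreg (k := Sum.inr (Sum.inl (j, w.1))) (k' := Sum.inr (Sum.inl (j', w'.1))) rfl rfl h
    simp only [Sum.inr.injEq, Sum.inl.injEq, Prod.mk.injEq] at hj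
    obtain rfl := hj.1
    have : Function.Injective fun r : Reg 1 sD => nm (Sum.inr (Sum.inl (j, r))) := by
      intro r r' h
      simpa using hnm h
    rw [workWire_injective this hD (Sum.inr_injective h)]
  · exact nomatch hreg (k := Sum.inr (Sum.inl (j, w.1))) (k' := Sum.inl w'.1) rfl rfl h
  · exact absurd h.symm (hshare p' _ _ rfl)
  · exact nomatch hreg (k := Sum.inl w.1) (k' := Sum.inr (Sum.inr j')) rfl rfl h
  · exact nomatch hreg (k := Sum.inl w.1) (k' := Sum.inr (Sum.inl (j', w'.1))) rfl rfl h
  · have : Function.Injective fun r : Reg t sE => nm (Sum.inl r) := by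
      intro r r' h
      simpa using hnm h
    rw [workWire_injective this hE (Sum.inr_injective h)]

/-- The initial state of the extractor, as a state of the prover in which all other qubits are
zero. -/
theorem withKet_loadedInst_eq_embed (φ : QState (Fin n)) (x : Bits L.inst) :
    (withKet φ (loadedInst x) : QState (Fin n ⊕ Wire 1 s L m)) =
      embed (Sum.map id shareWire) (withKet φ (loadedInst x) : QState (ProverWire L n)) := by
  funext b
  have h : (fun w => b (Sum.inr w)) = (loadedInst x : Wire 1 s L m → Bool) ↔
      (∀ w, (∀ i : ProverWire L n, Sum.map id shareWire i ≠ w) → b w = false) ∧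
        (fun w => b (Sum.inr (shareWire w))) = (loadedInst x : Wire 1 0 L 0 → Bool) := by
    constructor
    · intro h
      refine ⟨?_, ?_⟩
      · rintro (w | ⟨r, i⟩) hw
        · exact absurd rfl (hw (Sum.inl w))
        · rw [show b (Sum.inr ⟨r, i⟩) = _ from congrFun h ⟨r, i⟩]
          cases r with
          | inst => exact absurd rfl (hw (Sum.inr ⟨.inst, i⟩))
          | _ => rfl
      · funext ⟨r, i⟩
        rw [show b (Sum.inr (shareWire ⟨r, i⟩)) = _ from congrFun h (shareWire ⟨r, i⟩)]
        cases r with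
        | work k => exact k.elim0
        | _ => rfl
    · rintro ⟨h1, h2⟩
      funext ⟨r, i⟩
      cases r with
      | work k =>
        refine h1 _ ?_
        rintro (p | p) hp
        · cases hp
        · exact shareWire_fst_ne_work p k (congrArg Sigma.fst (Sum.inr_injective hp))
      | inst => exact congrFun h2 ⟨.inst, i⟩
      | wit => exact congrFun h2 ⟨.wit, i⟩
      | com => exact congrFun h2 ⟨.com, i⟩
      | chal j => exact congrFun h2 ⟨.chal j, i⟩
      | resp j => exact congrFun h2 ⟨.resp j, i⟩
  simp only [embed]
  by_cases h1 : ∀ w, (∀ i : ProverWire L n, Sum.map id shareWire i ≠ w) → b w = false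
  · rw [if_pos h1]
    show _ = φ (fun i => b (Sum.inl i)) * ket (loadedInst x) (fun w => b (Sum.inr (shareWire w)))
    rw [withKet, ket, ket]
    by_cases h2 : (fun w => b (Sum.inr (shareWire w))) = (loadedInst x : Wire 1 0 L 0 → Bool)
    · rw [if_pos h2, if_pos (h.2 ⟨h1, h2⟩)]
    · rw [if_neg h2, if_neg fun h3 => h2 (h.1 h3).2]
  · rw [if_neg h1, withKet, ket, if_neg fun h3 => h1 (h.1 h3).1, mul_zero]

end Extractor

section ExtractorAlgorithm

variable {t : ℕ}

theorem regLen_le {t s : ℕ} {L : Sizes} {m k : ℕ} (hm : m ≤ k)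
    (hL : L.inst + L.wit + L.com + L.chal + L.resp ≤ k) (r : Reg t s) : regLen L m r ≤ k := by
  cases r <;> simp only [regLen] <;> omega

/-- The extractor, for register lengths that are bounded by `q`. It calls the first stage of the
prover and samples `t` challenges with `D`; for each of them it calls the second stage, copies the
response, and calls the inverse of the second stage; finally it runs `E` on the transcripts. -/
noncomputable def extractor (D : QAlg Empty 1) (E : QAlg Empty t) (q : Polynomial ℕ) :
    QAlg ProverCall 1 where
  s := Fintype.card (WorkName t D.s E.s)
  prog := .subs (extractorSubs (Fintype.equivFin (WorkName t D.s E.s)) D.prog E.prog)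
  bound := 1 + Polynomial.C (8 * t + 5) * (2 + 3 * q + D.bound + E.bound)

variable {D : QAlg Empty 1} {E : QAlg Empty t} {q : Polynomial ℕ} {size : ℕ → Sizes}

theorem workLen_extractor (D : QAlg Empty 1) (E : QAlg Empty t) (q : Polynomial ℕ) (η : ℕ) :
    (extractor D E q).workLen η =
      1 + (8 * t + 5) * (2 + 3 * q.eval η + D.workLen η + E.workLen η) := by
  simp [QAlg.workLen, extractor]

theorem sum_le_workLen_extractor (D : QAlg Empty 1) (E : QAlg Empty t) (q : Polynomial ℕ) (η : ℕ) :
    q.eval η + D.workLen η + E.workLen η ≤ (extractor D E q).workLen η := by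
  rw [workLen_extractor]
  nlinarith [Nat.zero_le (8 * t * (2 + 3 * q.eval η + D.workLen η + E.workLen η))]

theorem extractor_polyTime
    (hq : ∀ η, (size η).inst + (size η).wit + (size η).com + (size η).chal + (size η).resp ≤
      q.eval η)
    (hD : D.PolyTime size) (hE : E.PolyTime size) : (extractor D E q).PolyTime size := by
  intro η
  have hm := sum_le_workLen_extractor D E q η
  set nm := Fintype.equivFin (WorkName t D.s E.s)
  set ini := inputMem η (size η) with hini
  have h6 : ini.ctr 6 = 0 := rfl
  have hfinal : (extractor D E q).final (size η) η =
      (Prog.subs (extractorSubs nm D.prog E.prog)).result ini := rfl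
  have hL := hq η
  set L := size η
  rw [hfinal, Prog.result_subs]
  constructor
  · have hP : ∀ P ∈ extractorSubs nm D.prog E.prog, (P.result ini).time + 1 ≤
        2 + 3 * q.eval η + D.workLen η + E.workLen η := by
      have hcopy : ∀ (k : ℕ) (r r' : Reg 1 (Fintype.card (WorkName t D.s E.s))),
          ini.ctr k ≤ q.eval η →
          ((Prog.copyReg k r r' : Prog ProverCall _).result ini).time + 1 ≤
            2 + 3 * q.eval η + D.workLen η + E.workLen η := by
        intro k r r' hk
        rw [(Prog.result_copyReg h6 k r r').2]
        omega
      have hi : L.inst ≤ q.eval η := by omega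
      have hw : L.wit ≤ q.eval η := by omega
      have hc : L.com ≤ q.eval η := by omega
      have hch : L.chal ≤ q.eval η := by omega
      have hr : L.resp ≤ q.eval η := by omega
      refine forall_mem_extractorSubs (fun o => ?_) (fun j => ?_) (fun j => hcopy _ _ _ hch)
        (fun j => hcopy _ _ _ hr) (hcopy _ _ _ hi) (hcopy _ _ _ hc) (fun j => hcopy _ _ _ hch)
        (fun j => hcopy _ _ _ hr) ?_ (hcopy _ _ _ hw)
      · show 0 + 1 + 1 ≤ _
        omega
      · rw [Prog.result_mapRegs]
        have h : (D.prog.result ini).time ≤ D.workLen η := (hD η).1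
        show (D.prog.result ini).time + 1 ≤ _
        omega
      · rw [Prog.result_mapRegs]
        have h : (E.prog.result ini).time ≤ E.workLen η := (hE η).1
        show (E.prog.result ini).time + 1 ≤ _
        omega
    have hsum := List.sum_le_card_nsmul
      ((extractorSubs nm D.prog E.prog).map fun P => (P.result ini).time + 1)
      (2 + 3 * q.eval η + D.workLen η + E.workLen η) (by
        intro x hx
        obtain ⟨P, hP', rfl⟩ := List.mem_map.1 hx
        exact hP P hP')
    rw [List.length_map, length_extractorSubs, smul_eq_mul] at hsum
    show _ + 1 ≤ (extractor D E q).workLen η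
    rw [workLen_extractor]
    omega
  · have hP : ∀ P ∈ extractorSubs nm D.prog E.prog, ∀ o ∈ (P.result ini).out, ∀ w ∈ o.wires,
        w.2 < regLen L ((extractor D E q).workLen η) w.1 := by
      have hcopy : ∀ (k : ℕ) (r r' : Reg 1 (Fintype.card (WorkName t D.s E.s))),
          ini.ctr k ≤ regLen L ((extractor D E q).workLen η) r →
          ini.ctr k ≤ regLen L ((extractor D E q).workLen η) r' →
          ∀ o ∈ ((Prog.copyReg k r r' : Prog ProverCall _).result ini).out, ∀ w ∈ o.wires,
            w.2 < regLen L ((extractor D E q).workLen η) w.1 := by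
        intro k r r' hr hr' o ho w hw
        rw [(Prog.result_copyReg h6 k r r').1] at ho
        obtain ⟨i, hi, rfl⟩ := List.mem_map.1 ho
        rw [List.mem_range] at hi
        simp only [Op.wires, Gate.wires, List.mem_cons, List.not_mem_nil, or_false] at hw
        rcases hw with rfl | rfl
        · exact hi.trans_le hr
        · exact hi.trans_le hr'
      have hlift : ∀ {t' s' m' : ℕ} (P : Prog Empty (Reg t' s'))
          (f : Reg t' s' → Fin (Fintype.card (WorkName t D.s E.s)))
          (_ : ∀ r : Reg t' s', regLen L m' r ≤ (extractor D E q).workLen η)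
          (_ : ∀ o ∈ (P.result ini).out, ∀ w ∈ o.wires, w.2 < regLen L m' w.1),
          ∀ o ∈ ((P.mapRegs fun r => .work (f r) : Prog ProverCall (Reg 1 _)).result ini).out,
            ∀ w ∈ o.wires, w.2 < regLen L ((extractor D E q).workLen η) w.1 := by
        intro t' s' m' P f hm' hP o ho w hw
        rw [Prog.result_mapRegs] at ho
        obtain ⟨o', ho', rfl⟩ := List.mem_map.1 ho
        cases o' with
        | call o => exact o.elim
        | gate g =>
          have : ∃ v ∈ g.wires, w = (.work (f v.1), v.2) := by
            cases g <;> simpa [Op.lift, Op.wires, Gate.wires, Gate.map] using hw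
          obtain ⟨v, hv, rfl⟩ := this
          exact (hP _ ho' v hv).trans_le (hm' _)
      have hi : L.inst ≤ (extractor D E q).workLen η := by omega
      have hw : L.wit ≤ (extractor D E q).workLen η := by omega
      have hc : L.com ≤ (extractor D E q).workLen η := by omega
      have hch : L.chal ≤ (extractor D E q).workLen η := by omega
      have hr : L.resp ≤ (extractor D E q).workLen η := by omega
      refine forall_mem_extractorSubs (fun o => ?_) (fun j => ?_)
        (fun j => hcopy 4 _ _ hch le_rfl) (fun j => hcopy 5 _ _ le_rfl hr)
        (hcopy 1 _ _ le_rfl hi) (hcopy 3 _ _ le_rfl hc) (fun j => hcopy 4 _ _ hch hch)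
        (fun j => hcopy 5 _ _ hr hr) ?_ (hcopy 2 _ _ hw le_rfl)
      · intro o' ho' w hw
        rw [List.mem_singleton.1 ho'] at hw
        exact absurd hw List.not_mem_nil
      · exact hlift D.prog (fun r => nm (Sum.inr (Sum.inl (j, r))))
          (fun r => regLen_le (by omega) (by omega) r) (hD η).2
      · exact hlift E.prog (fun r => nm (Sum.inl r))
          (fun r => regLen_le (by omega) (by omega) r) (hE η).2
    intro o ho
    obtain ⟨P, hP', ho⟩ := List.mem_flatMap.1 ho
    exact hP P hP' o ho

open scoped Classical in
set_option synthInstance.maxSize 1000 in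
/-- The success probability of the extractor against a prover. -/
theorem prob_extract_extractor
    (hq : ∀ η, (size η).inst + (size η).wit + (size η).com + (size η).chal + (size η).resp ≤
      q.eval η)
    (hD : D.PolyTime size) (hE : E.PolyTime size) (η : ℕ) {S : Set (Reg 1 0)} (hS : Reg.wit ∉ S)
    (A : MaliciousProver S (size η)) (x : Bits (size η).inst) (I : Set (Bits (size η).inst))
    (rel : Bits (size η).inst → Bits (size η).wit → Prop) :
    prob (fun b => instOf (b ∘ Sum.inr) ∈ I ∧ rel (instOf (b ∘ Sum.inr)) (witOf (b ∘ Sum.inr)))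
      ((extractor D E q).extract η A x) =
    ∑ c : Fin t → Bits (size η).chal,
      (∏ j, prob (fun b => chalOf 0 b = c j)
        ((D.circuit (size η) η).run (ket fun _ => false))) *
      ∑ z : Fin t → Bits (size η).resp, ∑ b, (if (firstMessage b).1 ∈ I then
        1 - prob (fun e => ¬ rel (firstMessage b).1 (witOf e))
          ((E.circuit (size η) η).run
            (ket (loaded (firstMessage b).1 (firstMessage b).2 c z))) else 0) *
        ‖answerPath A.ask proverResp (List.ofFn fun j => (c j, z j))
          (A.stage1.run (withKet A.state (loadedInst x))) b‖ ^ 2 := by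
  have hm := sum_le_workLen_extractor D E q η
  have hL := hq η
  set nm := Fintype.equivFin (WorkName t D.s E.s)
  have hD1 : ∀ r : Reg 1 D.s, regLen (size η) (D.workLen η) r ≤ (extractor D E q).workLen η :=
    regLen_le (by omega) (by omega)
  have hE1 : ∀ r : Reg t E.s, regLen (size η) (E.workLen η) r ≤ (extractor D E q).workLen η :=
    regLen_le (by omega) (by omega)
  have hZ : (size η).resp ≤ (extractor D E q).workLen η := by omega
  set g : ExtractorWire t (size η) A.n D.s (D.workLen η) E.s (E.workLen η) →
      Fin A.n ⊕ Wire 1 (extractor D E q).s (size η) ((extractor D E q).workLen η) :=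
    extractorWire nm hD1 hE1 hZ with hg
  have hginj : Function.Injective g := extractorWire_injective nm.injective hD1 hE1 hZ
  have hcirc : (extractor D E q).withProver η A =
      (extractorCircuit A.stage1 A.stage2 (D.circuit (size η) η)
        (E.circuit (size η) η)).relabel g := by
    refine Eq.trans ?_ (writtenCircuit_extractorSubs A hD1 hE1 hZ D.prog E.prog (hD η).2 (hE η).2)
    rw [← writtenCircuit_flatMap]
    show writtenCircuit _ ((Prog.subs (extractorSubs nm D.prog E.prog)).result
      (inputMem η (size η))).out = _
    rw [Prog.result_subs]
    rfl
  have hstate : (withKet A.state (loadedInst x) :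
      QState (Fin A.n ⊕ Wire 1 (extractor D E q).s (size η) ((extractor D E q).workLen η))) =
      embed g (withKet (withKet (withKet A.state (loadedInst x)) fun _ => false)
        fun _ => false) := by
    rw [← embed_inl, ← embed_inl, embed_embed Sum.inl_injective, embed_embed hginj,
      withKet_loadedInst_eq_embed]
    rfl
  rw [← prob_extractorCircuit hS A, ← prob_embed hginj, ← run_relabel_embed hginj, ← hstate,
    ← hcirc]
  rfl

end ExtractorAlgorithm

/-! ### Static and adaptive provers -/

theorem withKet_eq_shift {N W : Type} (φ : QState N) (v : W → Bool) :
    withKet φ v = shift (Sum.elim (fun _ => false) v) (withKet φ fun _ => false) := by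
  funext b
  have h : (fun w => b (Sum.inr w)) = v ↔
      (fun w => xor (b (Sum.inr w)) (v w)) = fun _ => false := by
    rw [funext_iff, funext_iff]
    exact forall_congr' fun w => (bne_eq_false_iff_eq).symm
  have hφ : (fun i => b (Sum.inl i)) = fun i => xor (b (Sum.inl i)) false :=
    funext fun i => (Bool.xor_false _).symm
  show φ _ * ket v _ = φ (fun i => xor (b (Sum.inl i)) false) *
    ket (fun _ => false) (fun w => xor (b (Sum.inr w)) (v w))
  rw [← hφ, ket, ket]
  by_cases hb : (fun w => b (Sum.inr w)) = v
  · rw [if_pos hb, if_pos (h.1 hb)]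
  · rw [if_neg hb, if_neg (mt h.2 hb)]

namespace SigmaProtocol

variable {Pi : SigmaProtocol}

/-- The verifier may as well find the instance in the instance register, which a static prover does
not touch. -/
theorem prob_outcome_static {η : ℕ} (A : StaticProver (Pi.size η)) (x : Bits (Pi.size η).inst)
    (c : Bits (Pi.size η).chal) :
    prob (fun b => Pi.verify η x (comOf (b ∘ Sum.inr)) c (respOf 0 (b ∘ Sum.inr)) = true)
      (A.outcome c) =
    prob (fun b => (firstMessage b).1 ∈ ({x} : Set (Bits (Pi.size η).inst)) ∧
        Pi.verify η (firstMessage b).1 (firstMessage b).2 c (b ∘ proverResp) = true)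
      ((A.ask c).run (A.stage1.run (withKet A.state (loadedInst x)))) := by
  set v : ProverWire (Pi.size η) A.n → Bool := Sum.elim (fun _ => false) (loadedInst x) with hv
  have hv1 : ∀ w, Accessible ({Reg.com} : Set (Reg 1 0)) w → v w = false := by
    rintro (w | ⟨r, i⟩) hw
    · rfl
    · obtain rfl : r = Reg.com := hw
      rfl
  have hv2 : ∀ w, Accessible ({Reg.chal 0, Reg.resp 0} : Set (Reg 1 0)) w → v w = false := by
    rintro (w | ⟨r, i⟩) hw
    · rfl
    · obtain rfl | rfl : r = Reg.chal 0 ∨ r = Reg.resp 0 := hw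
      · rfl
      · rfl
  have hupd : ∀ (b : ProverWire (Pi.size η) A.n → Bool) w y,
      (∀ i, (Sum.inr ⟨.inst, i⟩ : ProverWire (Pi.size η) A.n) ≠ w) →
      (firstMessage (Function.update b w y)).1 = (firstMessage b).1 := by
    intro b w y hw
    funext i
    exact Function.update_of_ne (hw i) _ _
  have hstate : withKet A.state (loadedInst x) =
      proj (fun b : ProverWire (Pi.size η) A.n → Bool => (firstMessage b).1 = x)
        (withKet A.state (loadedInst x)) := by
    funext b
    by_cases hb : (fun w => b (Sum.inr w)) = (loadedInst x : Wire 1 0 (Pi.size η) 0 → Bool)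
    · have : (firstMessage b).1 = x := by
        funext i; exact congrFun hb ⟨.inst, i⟩
      simp [proj, this]
    · have : withKet A.state (loadedInst x) b = 0 := by
        rw [withKet, ket, if_neg hb, mul_zero]
      simp [proj, this]
  have hsupp : ∀ b, (A.ask c).run (A.stage1.run (withKet A.state (loadedInst x))) b ≠ 0 →
      (firstMessage b).1 = x := by
    intro b hb
    rw [hstate, Circuit.run_proj_comm A.stage1_within _ (fun b w y hw => by
      rw [hupd]
      rintro i rfl
      exact absurd (show Reg.inst = Reg.com from hw) (by simp)),
      Circuit.run_proj_comm (A.ask_within c) _ (fun b w y hw => by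
      rw [hupd]
      rintro i rfl
      exact absurd hw (by simp [Accessible]))] at hb
    by_contra h
    exact hb (if_neg h)
  have hshift : (A.ask c).run (A.stage1.run (withKet A.state (loadedInst x))) =
      shift v (A.outcome c) := by
    rw [withKet_eq_shift, Circuit.run_shift_comm A.stage1_within _ hv1,
      Circuit.run_shift_comm (A.ask_within c) _ hv2, A.run_ask]
    rfl
  have hcongr : prob (fun b => (firstMessage b).1 ∈ ({x} : Set (Bits (Pi.size η).inst)) ∧
        Pi.verify η (firstMessage b).1 (firstMessage b).2 c (b ∘ proverResp) = true)
      ((A.ask c).run (A.stage1.run (withKet A.state (loadedInst x)))) =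
      prob (fun b => Pi.verify η x (firstMessage b).2 c (b ∘ proverResp) = true)
      ((A.ask c).run (A.stage1.run (withKet A.state (loadedInst x)))) :=
    prob_congr fun b hb => by rw [hsupp b hb]; simp
  rw [hcongr, hshift, prob_shift]
  congr 1
  funext b
  have h1 : (firstMessage fun w => xor (b w) (v w)).2 = comOf (b ∘ Sum.inr) := by
    funext i; exact Bool.xor_false _
  have h2 : (fun w => xor (b w) (v w)) ∘ proverResp = respOf 0 (b ∘ Sum.inr) := by
    funext i; exact Bool.xor_false _
  rw [h1, h2]

/-- One extractor works for static and for adaptive provers. -/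
theorem TSound.exists_extractor (hV : Pi.EfficientVerifier) {t : ℕ} (hsound : Pi.TSound t)
    (hresp : Pi.QuantumUniqueResponses) :
    ∃ K : QAlg ProverCall 1, K.PolyTime Pi.size ∧ ∀ q : Polynomial ℕ, ∃ κ : ℕ → ℝ, Negligible κ ∧
      ∀ (η : ℕ) (S : Set (Reg 1 0)) (A : MaliciousProver S (Pi.size η)), Reg.wit ∉ S →
        A.size ≤ q.eval η → ∀ I ⊆ Pi.instances η, ∀ x : Bits (Pi.size η).inst,
        ((∑ c ∈ Pi.challenges η, prob (fun b => (firstMessage b).1 ∈ I ∧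
            Pi.verify η (firstMessage b).1 (firstMessage b).2 c (b ∘ proverResp) = true)
            ((A.ask c).run (A.stage1.run (withKet A.state (loadedInst x))))) /
              (Pi.challenges η).card) ^ (2 * t + 1) - κ η ≤
          prob (fun b => instOf (b ∘ Sum.inr) ∈ I ∧
              Pi.rel η (instOf (b ∘ Sum.inr)) (witOf (b ∘ Sum.inr)))
            (K.extract η A x) := by
  obtain ⟨ql, hql⟩ := hV.polySize
  obtain ⟨D, hDt, hD⟩ := hV.polySamplable
  obtain ⟨E, hEt, μ, hμ, hE⟩ := hsound
  refine ⟨extractor D E ql, extractor_polyTime hql hDt hEt, fun q => ?_⟩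
  obtain ⟨κ, hκ, hκA⟩ := TSound.exists_rewinding_bound hV hresp hμ hE
    (D := fun η c => prob (fun b => chalOf 0 b = c)
      ((D.circuit (Pi.size η) η).run (ket fun _ => false)))
    (fun η c => prob_nonneg _ _)
    (fun η => by
      simp only [prob_eq_sqNorm_proj]
      rw [sum_sqNorm_proj, Circuit.sqNorm_run, sqNorm_ket])
    hD q
  refine ⟨κ, hκ, fun η S A hS hA I hI x => ?_⟩
  rw [prob_extract_extractor hql hDt hEt η hS A x I (Pi.rel η)]
  refine hκA η S A hA I hI _ ?_
  rw [Circuit.sqNorm_run, sqNorm_withKet]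
  exact A.unit_state

end SigmaProtocol

theorem theorem5 (Pi : SigmaProtocol) (hV : Pi.EfficientVerifier) (t : ℕ) (hsound : Pi.TSound t)
    (hresp : Pi.QuantumUniqueResponses) : Pi.ComputationalPoK := by
  obtain ⟨K, hK, hbound⟩ := hsound.exists_extractor hV hresp
  refine ⟨⟨K, 1, 2 * t + 1, hK, by simp, fun q => ?_⟩, ⟨K, 1, 2 * t + 1, hK, by simp, fun q => ?_⟩⟩
  · obtain ⟨κ, hκ, h⟩ := hbound q
    refine ⟨κ, hκ, fun η A hA x hx => ?_⟩
    have h1 := h η _ A (by simp) hA {x} (Set.singleton_subset_iff.2 hx) x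
    simp only [← SigmaProtocol.prob_outcome_static] at h1
    refine le_trans (le_of_eq ?_) (h1.trans (prob_mono fun b _ hb => ?_))
    · simp [SigmaProtocol.acceptProb]
    · rw [← show _ = x from hb.1]
      exact hb.2
  · obtain ⟨κ, hκ, h⟩ := hbound q
    refine ⟨κ, hκ, fun η A hA I hI => ?_⟩
    have h1 := h η _ A (by simp) hA I hI fun _ => false
    have h0 : (loadedInst fun _ => false : Wire 1 0 (Pi.size η) 0 → Bool) = zeroRegs := by
      funext ⟨r, i⟩
      cases r <;> rfl
    simp only [A.run_ask, h0] at h1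
    refine le_trans (le_of_eq ?_) h1
    simp only [SigmaProtocol.adaptiveAcceptProb, Polynomial.eval_one, Nat.cast_one, div_one,
      one_mul]
    rfl
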